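/- Let $d\ge 2$. An instance consists of finitely many items $\mathcal I=\{1,\dots,n\}$; item $i$ is a $d$-dimensional hypercube with side length $s(i)\in(0,1]$ and profit $p(i)>0$. A packing is a set $\mathcal Q\subseteq\mathcal I$ of items together with a position for each of them, such that the resulting axis-aligned cubes are contained in $[0,1]^d$ and pairwise non-overlapping (their interiors are disjoint). Its profit is $\sum_{i\in\mathcal Q}p(i)$, and $\mathrm{OPT}(\mathcal I)$ is the maximum profit of a packing. Let $B$ be an axis-aligned $d$-dimensional hypercuboid with side lengths $\ell_1,\dots,\ell_d>0$, and put $\mathrm{VOL}(B)=\prod_k\ell_k$ and $\mathrm{SURF}(B)=2\sum_k\prod_{l\ne k}\ell_l$. Let $\mathcal Q_B$ be a set of items packed in $B$. Suppose that there are $\hat s>0$ and positive integers $n_1,\dots,n_d$ with $s(i)\le\hat s$ for all $i\in\mathcal Q_B$ and $\ell_k=n_k\hat s$ for all $k$. Then $B$ is a $\mathcal V$-Box if such $\hat s,n_k$ can be chosen with $\sum_{i\in\mathcal Q_B}s(i)^d\le\mathrm{VOL}(B)-\hat s\,\mathrm{SURF}(B)/2$, and an $\mathcal N$-Box if they can be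 chosen with $|\mathcal Q_B|\le\prod_k n_k$. Theorem. There are constants $C_{\mathrm{boxes}}(d,\varepsilon)$ and $C_{\mathrm{large}}(d,\varepsilon)$, depending only on $d$ and $\varepsilon$, such that for all $d\ge2$, all $0<\varepsilon<1/2^{d+2}$ and every instance $\mathcal I$ there is a packing with the following properties. (i) There are at most $C_{\mathrm{boxes}}(d,\varepsilon)$ pairwise non-overlapping hypercuboids in $[0,1]^d$, with pairwise disjoint sets of items of the packing assigned to them, such that every assigned item is placed inside its hypercuboid and each hypercuboid is a $\mathcal V$-Box or an $\mathcal N$-Box for its assigned set of items. (ii) At most $C_{\mathrm{large}}(d,\varepsilon)$ items of the packing are not assigned to any of these boxes, and these items do not overlap the boxes. (iii) The profit of the packing is at least $(1-2^{d+2}\varepsilon)\,\mathrm{OPT}(\mathcal I)$. -/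

import Mathlib

open scoped BigOperators

/-- A `d`-dimensional axis-aligned hypercuboid, given by its lower corner and its
(positive) side lengths. -/
structure Cuboid (d : ℕ) where
  lower : Fin d → ℝ
  side : Fin d → ℝ
  side_pos : ∀ k, 0 < side k

namespace Cuboid

variable {d : ℕ}

/-- The closed region `∏ₖ [xₖ, xₖ + ℓₖ]`. -/
def region (B : Cuboid d) : Set (Fin d → ℝ) :=
  Set.Icc B.lower (B.lower + B.side)

/-- The `d`-dimensional volume. -/
noncomputable def vol (B : Cuboid d) : ℝ := ∏ k, B.side k

/-- The surface area: the sum of the `(d-1)`-dimensional volumes of the `2 d` facets. -/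
noncomputable def surf (B : Cuboid d) : ℝ :=
  2 * ∑ k, ∏ l ∈ Finset.univ.erase k, B.side l

/-- `B` is contained in the knapsack `[0,1]^d`. -/
def InKnapsack (B : Cuboid d) : Prop := B.region ⊆ Set.Icc 0 1

/-- Two hypercuboids do not overlap: they may touch, but have no common interior point. -/
def NonOverlapping (A B : Cuboid d) : Prop :=
  Disjoint (interior A.region) (interior B.region)

end Cuboid

/-- The items `0, …, n-1`: hypercubes with side lengths in `(0,1]` and positive profits. -/
structure ItemSet (n : ℕ) where
  size : Fin n → ℝ
  size_pos : ∀ i, 0 < size i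
  size_le_one : ∀ i, size i ≤ 1
  profit : Fin n → ℝ
  profit_pos : ∀ i, 0 < profit i

namespace ItemSet

variable {n : ℕ}

/-- The `d`-dimensional hypercube occupied by item `i` when its lower corner is at `x`. -/
def cubeAt {d : ℕ} (I : ItemSet n) (i : Fin n) (x : Fin d → ℝ) : Cuboid d where
  lower := x
  side := fun _ => I.size i
  side_pos := fun _ => I.size_pos i

/-- The total profit of a set of items. -/
noncomputable def totalProfit (I : ItemSet n) (Q : Finset (Fin n)) : ℝ := ∑ i ∈ Q, I.profit i

/-- The total `d`-dimensional volume of a set of items. -/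
noncomputable def totalVol (I : ItemSet n) (d : ℕ) (Q : Finset (Fin n)) : ℝ :=
  ∑ i ∈ Q, I.size i ^ d

/-- The side lengths of `B` are positive integral multiples `n₁ ŝ, …, n_d ŝ` of `shat`, and
`shat` bounds the side lengths of all items in `Q`. -/
structure FitsScale {d : ℕ} (I : ItemSet n) (B : Cuboid d) (Q : Finset (Fin n))
    (shat : ℝ) (m : Fin d → ℕ) : Prop where
  shat_pos : 0 < shat
  size_le : ∀ i ∈ Q, I.size i ≤ shat
  m_pos : ∀ k, 0 < m k
  side_eq : ∀ k, B.side k = m k * shat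

/-- `B`, with the set `Q` of items packed in it, is a `𝒱`-Box.
(That the items of `Q` are packed inside `B` is stated in `Packing.BoxStructure`.) -/
def IsVBox {d : ℕ} (I : ItemSet n) (B : Cuboid d) (Q : Finset (Fin n)) : Prop :=
  ∃ (shat : ℝ) (m : Fin d → ℕ), I.FitsScale B Q shat m ∧
    I.totalVol d Q ≤ B.vol - shat * (B.surf / 2)

/-- `B`, with the set `Q` of items packed in it, is an `𝒩`-Box.
(That the items of `Q` are packed inside `B` is stated in `Packing.BoxStructure`.) -/
def IsNBox {d : ℕ} (I : ItemSet n) (B : Cuboid d) (Q : Finset (Fin n)) : Prop :=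
  ∃ (shat : ℝ) (m : Fin d → ℕ), I.FitsScale B Q shat m ∧ Q.card ≤ ∏ k, m k

end ItemSet

/-- A valid packing of some of the items into the knapsack `[0,1]^d`. Only the positions of the
packed items matter. -/
structure Packing {n : ℕ} (I : ItemSet n) (d : ℕ) where
  items : Finset (Fin n)
  pos : Fin n → Fin d → ℝ
  inside : ∀ i ∈ items, (I.cubeAt i (pos i)).InKnapsack
  nonOverlapping : ∀ i ∈ items, ∀ j ∈ items, i ≠ j →
    (I.cubeAt i (pos i)).NonOverlapping (I.cubeAt j (pos j))

namespace Packing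

variable {n d : ℕ} {I : ItemSet n}

/-- The hypercube occupied by item `i` in the packing. -/
def cube (P : Packing I d) (i : Fin n) : Cuboid d := I.cubeAt i (P.pos i)

/-- The profit of a packing. -/
noncomputable def profit (P : Packing I d) : ℝ := I.totalProfit P.items

/-- The packed items that are in none of the sets `Q 0, …, Q (b-1)`. -/
def loose (P : Packing I d) {b : ℕ} (Q : Fin b → Finset (Fin n)) : Finset (Fin n) :=
  P.items \ Finset.univ.biUnion Q

/-- The packing consists of the pairwise non-overlapping boxes `B 0, …, B (b-1)`, each of which is
a `𝒱`-Box or an `𝒩`-Box for the set `Q j` of items packed in it, and of the loose items, which do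
not overlap the boxes. -/
structure BoxStructure (P : Packing I d) {b : ℕ} (B : Fin b → Cuboid d)
    (Q : Fin b → Finset (Fin n)) : Prop where
  box_inside : ∀ j, (B j).InKnapsack
  box_nonOverlapping : ∀ j k, j ≠ k → (B j).NonOverlapping (B k)
  content_subset : ∀ j, Q j ⊆ P.items
  content_disjoint : ∀ j k, j ≠ k → Disjoint (Q j) (Q k)
  content_inside : ∀ j, ∀ i ∈ Q j, (P.cube i).region ⊆ (B j).region
  isBox : ∀ j, I.IsVBox (B j) (Q j) ∨ I.IsNBox (B j) (Q j)
  loose_nonOverlapping : ∀ i ∈ P.loose Q, ∀ j, (P.cube i).NonOverlapping (B j)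

end Packing

/-- The optimal profit of a packing of a subset of the items into `[0,1]^d`. -/
noncomputable def ItemSet.opt {n : ℕ} (I : ItemSet n) (d : ℕ) : ℝ :=
  sSup (Set.range fun P : Packing I d => P.profit)

/-- The supremum in the definition of `ItemSet.opt` is attained. -/
theorem ItemSet.isGreatest_opt {n : ℕ} (I : ItemSet n) (d : ℕ) :
    IsGreatest (Set.range fun P : Packing I d => P.profit) (I.opt d) := by
  have hfin : (Set.range fun P : Packing I d => P.profit).Finite := by
    refine (Set.finite_range fun Q : Finset (Fin n) => I.totalProfit Q).subset ?_
    rintro _ ⟨P, rfl⟩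
    exact ⟨P.items, rfl⟩
  have hne : (Set.range fun P : Packing I d => P.profit).Nonempty :=
    ⟨_, ⟨⟨∅, fun _ _ => 0, by simp, by simp⟩, rfl⟩⟩
  exact ⟨hne.csSup_mem hfin, fun x hx => le_csSup hfin.bddAbove hx⟩

/-! The packing is obtained from an optimal one. A bounded set `P` of its items stays in place, and
their cubes are obstacles for the others. Up to a small loss of profit the others are rearranged
into boundedly many boxes avoiding the obstacles, except for boundedly many items that are too large
for this. If the exceptional items carry at most a fraction ε of the optimum, they are discarded;
otherwise they join `P` and the argument starts again from the original packing. Each restart adds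
more than ε · OPT to the profit of `P`, so about 1/ε rounds suffice and all bounds depend on d and ε
only (`exists_loose_of_profitable`). The total loss is 3ε, which is less than 2^(d+2) ε.

The rearrangement needs regions of simple shape (`exists_decomp`). Let f be the size of the largest
item in a region. Among T parallel planes at mutual distance f, one passes through items of at most
1/T of the profit. Such cuts are made next to, and between, the facet coordinates of obstacles
inside the region until every piece is a good cell: each axis is short, of length at most 3Tf, or
has no facet coordinate strictly inside. A free cube of side f in each cell keeps its free volume
comparable to its total volume.

In a good cell, a pigeonhole argument over the d axes separates short axes from very long ones
(`exists_boxFam_of_goodCell`). If all are short (`exists_corner`), the items above μf are bounded in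
number by volume; these are the exceptional items. The tiny ones go into 𝒱-Boxes in those cells of a
fine grid which meet no obstacle (`exists_vpack`), after a part of low profit density is discarded
to gain volume.

If there is a long axis (`exists_long`), a cheap range of medium sizes is discarded, so every item
is tiny or large relative to f. A grid with cells of width about Kf is laid along the long axes.
These axes are unobstructed, so the free parts of the cells are translates of each other. The large
items inside cells are grouped linearly by size, and cells with equal numbers of items in every
class are merged: one representative is stretched over a slab, and each of its slots becomes an
𝒩-Box for items of the next smaller class (`boxFam_of_linear_grouping`). Dropping a cheap fraction
of the cells pays for rounding and for one more 𝒩-Box, which takes the first class and the large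
items crossing grid planes. The tiny items fill the remaining volume, with the new boxes as further
obstacles. -/

open MeasureTheory

/-! ### Non-overlap as separation along one coordinate -/

namespace Cuboid

variable {d : ℕ}

/-- Two hypercuboids are separated by a coordinate hyperplane. -/
def Sep (A B : Cuboid d) : Prop :=
  ∃ k, A.lower k + A.side k ≤ B.lower k ∨ B.lower k + B.side k ≤ A.lower k

/-- Coordinatewise containment of hypercuboids. -/
def Within (A B : Cuboid d) : Prop :=
  ∀ k, B.lower k ≤ A.lower k ∧ A.lower k + A.side k ≤ B.lower k + B.side k

/-- The half-open hypercuboid. -/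
def halfOpen (A : Cuboid d) : Set (Fin d → ℝ) :=
  Set.univ.pi fun k => Set.Ico (A.lower k) (A.lower k + A.side k)

theorem Sep.symm {A B : Cuboid d} (h : A.Sep B) : B.Sep A := by
  obtain ⟨k, hk⟩ := h
  exact ⟨k, hk.symm⟩

theorem Within.refl (A : Cuboid d) : A.Within A := fun _ => ⟨le_rfl, le_rfl⟩

theorem Within.trans {A B C : Cuboid d} (h : A.Within B) (h' : B.Within C) : A.Within C :=
  fun k => ⟨(h' k).1.trans (h k).1, (h k).2.trans (h' k).2⟩

theorem Sep.mono_left {A A' B : Cuboid d} (h : A.Sep B) (hA : A'.Within A) : A'.Sep B := by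
  obtain ⟨k, hk | hk⟩ := h
  · exact ⟨k, Or.inl ((hA k).2.trans hk)⟩
  · exact ⟨k, Or.inr (hk.trans (hA k).1)⟩

theorem Sep.mono {A A' B B' : Cuboid d} (h : A.Sep B) (hA : A'.Within A) (hB : B'.Within B) :
    A'.Sep B' :=
  ((h.mono_left hA).symm.mono_left hB).symm

theorem mem_halfOpen {A : Cuboid d} {x : Fin d → ℝ} :
    x ∈ A.halfOpen ↔ ∀ k, A.lower k ≤ x k ∧ x k < A.lower k + A.side k := by
  simp [halfOpen, Set.mem_pi]

theorem Sep.disjoint {A B : Cuboid d} (h : A.Sep B) : Disjoint A.halfOpen B.halfOpen := by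
  rw [Set.disjoint_left]
  intro x hx hx'
  rw [mem_halfOpen] at hx hx'
  obtain ⟨k, hk⟩ := h
  have h1 := hx k
  have h2 := hx' k
  rcases hk with hk | hk <;> linarith [h1.1, h1.2, h2.1, h2.2]

theorem Within.subset {A B : Cuboid d} (h : A.Within B) : A.halfOpen ⊆ B.halfOpen := by
  intro x hx
  rw [mem_halfOpen] at hx ⊢
  exact fun k => ⟨(h k).1.trans (hx k).1, (hx k).2.trans_le (h k).2⟩

theorem measurableSet_halfOpen (A : Cuboid d) : MeasurableSet A.halfOpen :=
  MeasurableSet.univ_pi fun _ => measurableSet_Ico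

theorem volume_halfOpen (A : Cuboid d) : volume A.halfOpen = ENNReal.ofReal A.vol := by
  rw [halfOpen, Real.volume_pi_Ico, vol, ENNReal.ofReal_prod_of_nonneg]
  · simp
  · exact fun k _ => (A.side_pos k).le

theorem vol_pos (A : Cuboid d) : 0 < A.vol := Finset.prod_pos fun k _ => A.side_pos k

theorem volume_real_halfOpen (A : Cuboid d) : volume.real A.halfOpen = A.vol := by
  rw [Measure.real, volume_halfOpen, ENNReal.toReal_ofReal A.vol_pos.le]

theorem volume_halfOpen_ne_top (A : Cuboid d) : volume A.halfOpen ≠ ⊤ := by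
  simp [volume_halfOpen]

theorem Within.region_subset {A B : Cuboid d} (h : A.Within B) : A.region ⊆ B.region :=
  Set.Icc_subset_Icc (fun k => (h k).1) fun k => (h k).2

theorem within_of_region_subset {A B : Cuboid d} (h : A.region ⊆ B.region) : A.Within B := by
  have h0 : ∀ k, 0 ≤ A.side k := fun k => (A.side_pos k).le
  have h1 : A.lower ∈ A.region := ⟨le_rfl, fun k => by simpa using h0 k⟩
  have h2 : A.lower + A.side ∈ A.region := ⟨fun k => by simpa using h0 k, le_rfl⟩
  exact fun k => ⟨(h h1).1 k, (h h2).2 k⟩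

theorem interior_region (A : Cuboid d) :
    interior A.region = Set.univ.pi fun k => Set.Ioo (A.lower k) (A.lower k + A.side k) := by
  rw [region, ← Set.pi_univ_Icc, interior_pi_set Set.finite_univ]
  simp [interior_Icc]

theorem Sep.nonOverlapping {A B : Cuboid d} (h : A.Sep B) : A.NonOverlapping B := by
  rw [NonOverlapping, interior_region, interior_region]
  refine h.disjoint.mono ?_ ?_ <;>
    exact Set.pi_mono fun k _ => Set.Ioo_subset_Ico_self

/-- If no axis separates the two, their open side intervals meet on every axis, and a coordinatewise
choice gives a common interior point. Together with `Sep.nonOverlapping` this reduces non-overlap to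
an inequality in one coordinate. -/
theorem NonOverlapping.sep {A B : Cuboid d} (h : A.NonOverlapping B) : A.Sep B := by
  by_contra hs
  simp only [Sep, not_exists, not_or, not_le] at hs
  rw [NonOverlapping, interior_region, interior_region, Set.disjoint_left] at h
  have hlt : ∀ k, max (A.lower k) (B.lower k) <
      min (A.lower k + A.side k) (B.lower k + B.side k) := by
    intro k
    have h1 := A.side_pos k
    have h2 := B.side_pos k
    have h3 := hs k
    simp only [max_lt_iff, lt_min_iff]
    refine ⟨⟨?_, ?_⟩, ?_, ?_⟩ <;> linarith [h3.1, h3.2]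
  choose x hx using fun k => exists_between (hlt k)
  refine h (a := x) ?_ ?_ <;>
  · intro k _
    have := hx k
    simp only [max_lt_iff, lt_min_iff] at this
    exact ⟨by tauto, by tauto⟩

/-- The unit knapsack as a hypercuboid. -/
def unit (d : ℕ) : Cuboid d := ⟨0, 1, fun _ => one_pos⟩

theorem within_unit {A : Cuboid d} : A.Within (unit d) ↔ A.InKnapsack := by
  have h : (unit d).region = Set.Icc 0 1 := by simp [region, unit]
  rw [InKnapsack, ← h]
  exact ⟨Within.region_subset, within_of_region_subset⟩

end Cuboid

/-! ### Packed item sets, box families and free volume -/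

namespace ItemSet

variable {n d : ℕ}

/-- The items of `Q` are placed at `pos` inside `R`, pairwise separated. -/
structure PackedIn (I : ItemSet n) (Q : Finset (Fin n)) (pos : Fin n → Fin d → ℝ)
    (R : Cuboid d) : Prop where
  within : ∀ i ∈ Q, (I.cubeAt i (pos i)).Within R
  sep : ∀ i ∈ Q, ∀ j ∈ Q, i ≠ j → (I.cubeAt i (pos i)).Sep (I.cubeAt j (pos j))

/-- The placed items avoid the obstacles. -/
def Avoids (I : ItemSet n) (Q : Finset (Fin n)) (pos : Fin n → Fin d → ℝ)
    (obs : Finset (Cuboid d)) : Prop :=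
  ∀ i ∈ Q, ∀ o ∈ obs, (I.cubeAt i (pos i)).Sep o

theorem PackedIn.mono {I : ItemSet n} {Q Q' : Finset (Fin n)} {pos : Fin n → Fin d → ℝ}
    {R : Cuboid d} (h : I.PackedIn Q pos R) (hQ : Q' ⊆ Q) : I.PackedIn Q' pos R :=
  ⟨fun i hi => h.within i (hQ hi), fun i hi j hj => h.sep i (hQ hi) j (hQ hj)⟩

theorem Avoids.mono {I : ItemSet n} {Q Q' : Finset (Fin n)} {pos : Fin n → Fin d → ℝ}
    {obs : Finset (Cuboid d)} (h : I.Avoids Q pos obs) (hQ : Q' ⊆ Q) : I.Avoids Q' pos obs :=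
  fun i hi => h i (hQ hi)

/-- `B` is a `𝒱`-Box or an `𝒩`-Box for `Q` and the items of `Q` can be packed in it. -/
def Filled (I : ItemSet n) (B : Cuboid d) (Q : Finset (Fin n)) : Prop :=
  (∃ pos, I.PackedIn Q pos B) ∧ (I.IsVBox B Q ∨ I.IsNBox B Q)

/-- The items of `Q` can be distributed to at most `C` filled boxes in `R` avoiding `obs`. -/
def BoxFam (I : ItemSet n) (R : Cuboid d) (obs : Finset (Cuboid d)) (Q : Finset (Fin n))
    (C : ℕ) : Prop :=
  ∃ (β : Type) (_ : Fintype β) (B : β → Cuboid d) (A : β → Finset (Fin n)),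
    Fintype.card β ≤ C ∧ (∀ j, (B j).Within R) ∧ (∀ j, ∀ o ∈ obs, (B j).Sep o) ∧
    (∀ j k, j ≠ k → (B j).Sep (B k)) ∧ (∀ j k, j ≠ k → Disjoint (A j) (A k)) ∧
    Q = Finset.univ.biUnion A ∧ ∀ j, I.Filled (B j) (A j)

theorem BoxFam.mono {I : ItemSet n} {R : Cuboid d} {obs : Finset (Cuboid d)}
    {Q : Finset (Fin n)} {C C' : ℕ} (h : I.BoxFam R obs Q C) (hC : C ≤ C') :
    I.BoxFam R obs Q C' := by
  obtain ⟨β, hβ, B, A, h1, h2⟩ := h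
  exact ⟨β, hβ, B, A, h1.trans hC, h2⟩

theorem BoxFam.empty (I : ItemSet n) (R : Cuboid d) (obs : Finset (Cuboid d)) (C : ℕ) :
    I.BoxFam R obs ∅ C :=
  ⟨Empty, inferInstance, fun j => j.elim, fun j => j.elim, by simp, fun j => j.elim,
    fun j => j.elim, fun j => j.elim, fun j => j.elim, by simp, fun j => j.elim⟩

theorem vol_cubeAt (I : ItemSet n) (i : Fin n) (x : Fin d → ℝ) :
    (I.cubeAt i x).vol = I.size i ^ d := by
  simp [Cuboid.vol, cubeAt]

theorem totalProfit_mono (I : ItemSet n) {Q Q' : Finset (Fin n)} (h : Q ⊆ Q') :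
    I.totalProfit Q ≤ I.totalProfit Q' :=
  Finset.sum_le_sum_of_subset_of_nonneg h fun i _ _ => (I.profit_pos i).le

theorem totalProfit_nonneg (I : ItemSet n) (Q : Finset (Fin n)) : 0 ≤ I.totalProfit Q :=
  Finset.sum_nonneg fun i _ => (I.profit_pos i).le

/-- Separated hypercuboids inside a set of finite measure have total volume at most its measure. -/
theorem _root_.Cuboid.sum_vol_le_volume {ι : Type*} {Q : Finset ι} {B : ι → Cuboid d}
    (hsep : ∀ i ∈ Q, ∀ j ∈ Q, i ≠ j → (B i).Sep (B j))
    {E : Set (Fin d → ℝ)} (hE : volume E ≠ ⊤) (hsub : ∀ i ∈ Q, (B i).halfOpen ⊆ E) :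
    ∑ i ∈ Q, (B i).vol ≤ volume.real E := by
  have h1 : ∑ i ∈ Q, (B i).vol = volume.real (⋃ i ∈ Q, (B i).halfOpen) := by
    rw [measureReal_biUnion_finset (fun i hi j hj hij => (hsep i hi j hj hij).disjoint)
      (fun i _ => (B i).measurableSet_halfOpen) (fun i _ => (B i).volume_halfOpen_ne_top)]
    exact Finset.sum_congr rfl fun i _ => (Cuboid.volume_real_halfOpen _).symm
  rw [h1]
  exact measureReal_mono (Set.iUnion₂_subset hsub) hE

theorem totalVol_le_volume (I : ItemSet n) {Q : Finset (Fin n)} {pos : Fin n → Fin d → ℝ}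
    (hsep : ∀ i ∈ Q, ∀ j ∈ Q, i ≠ j → (I.cubeAt i (pos i)).Sep (I.cubeAt j (pos j)))
    {E : Set (Fin d → ℝ)} (hE : volume E ≠ ⊤)
    (hsub : ∀ i ∈ Q, (I.cubeAt i (pos i)).halfOpen ⊆ E) :
    I.totalVol d Q ≤ volume.real E := by
  have := Cuboid.sum_vol_le_volume hsep hE hsub
  simpa only [vol_cubeAt, totalVol] using this

/-- The part of `R` which is not covered by the obstacles. -/
def _root_.Cuboid.free (R : Cuboid d) (obs : Finset (Cuboid d)) : Set (Fin d → ℝ) :=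
  R.halfOpen \ ⋃ o ∈ obs, o.halfOpen

theorem _root_.Cuboid.measurableSet_free (R : Cuboid d) (obs : Finset (Cuboid d)) :
    MeasurableSet (R.free obs) :=
  R.measurableSet_halfOpen.diff
    (Finset.measurableSet_biUnion _ fun o _ => o.measurableSet_halfOpen)

theorem _root_.Cuboid.volume_free_ne_top (R : Cuboid d) (obs : Finset (Cuboid d)) :
    volume (R.free obs) ≠ ⊤ :=
  ne_top_of_le_ne_top R.volume_halfOpen_ne_top (measure_mono Set.sdiff_subset)

theorem _root_.Cuboid.volume_free_le (R : Cuboid d) (obs : Finset (Cuboid d)) :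
    volume.real (R.free obs) ≤ R.vol := by
  rw [← R.volume_real_halfOpen]
  exact measureReal_mono Set.sdiff_subset R.volume_halfOpen_ne_top

theorem _root_.Cuboid.Within.subset_free {A R : Cuboid d} {obs : Finset (Cuboid d)}
    (h : A.Within R) (hs : ∀ o ∈ obs, A.Sep o) : A.halfOpen ⊆ R.free obs := by
  intro x hx
  refine ⟨h.subset hx, ?_⟩
  simp only [Set.mem_iUnion, not_exists]
  exact fun o ho hxo => Set.disjoint_left.1 (hs o ho).disjoint hx hxo

theorem totalVol_le_free (I : ItemSet n) {Q : Finset (Fin n)} {pos : Fin n → Fin d → ℝ}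
    {R : Cuboid d} {obs : Finset (Cuboid d)} (h : I.PackedIn Q pos R) (ha : I.Avoids Q pos obs) :
    I.totalVol d Q ≤ volume.real (R.free obs) :=
  I.totalVol_le_volume h.sep (R.volume_free_ne_top obs)
    fun i hi => (h.within i hi).subset_free (ha i hi)

/-! ### Packing criteria for 𝒩-Boxes and 𝒱-Boxes -/

/-- Few items whose number is at most the number of grid cells can be packed in a box. -/
theorem FitsScale.filled_of_card_le {I : ItemSet n} {B : Cuboid d} {Q : Finset (Fin n)} {shat : ℝ}
    {m : Fin d → ℕ} (h : I.FitsScale B Q shat m) (hcard : Q.card ≤ ∏ k, m k) : I.Filled B Q := by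
  refine ⟨?_, Or.inr ⟨shat, m, h, hcard⟩⟩
  -- Distinct items get distinct cells of the grid of width `shat`, and each is placed at the lower
  -- corner of its cell.
  have : Nonempty (Q ↪ (∀ k, Fin (m k))) := by
    rw [Function.Embedding.nonempty_iff_card_le]
    simpa using hcard
  obtain ⟨e⟩ := this
  refine ⟨fun i k => if hi : i ∈ Q then B.lower k + (e ⟨i, hi⟩ k : ℕ) * shat else 0, ?_, ?_⟩
  · intro i hi k
    simp only [cubeAt, dif_pos hi]
    have h1 : ((e ⟨i, hi⟩ k : ℕ) : ℝ) + 1 ≤ m k := by exact_mod_cast (e ⟨i, hi⟩ k).2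
    have h2 : (0 : ℝ) ≤ (e ⟨i, hi⟩ k : ℕ) := Nat.cast_nonneg _
    have h3 := h.size_le i hi
    have h4 := h.shat_pos
    rw [h.side_eq k]
    constructor
    · nlinarith
    · nlinarith
  · intro i hi j hj hij
    have hne : e ⟨i, hi⟩ ≠ e ⟨j, hj⟩ := fun hE => hij (by simpa using e.injective hE)
    obtain ⟨k, hk⟩ := Function.ne_iff.1 hne
    refine ⟨k, ?_⟩
    simp only [cubeAt, dif_pos hi, dif_pos hj]
    have h4 := h.shat_pos
    have hi' := h.size_le i hi
    have hj' := h.size_le j hj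
    rcases lt_or_gt_of_ne (fun hE => hk (Fin.ext hE)) with hlt | hlt
    · left
      have : ((e ⟨i, hi⟩ k : ℕ) : ℝ) + 1 ≤ (e ⟨j, hj⟩ k : ℕ) := by exact_mod_cast hlt
      nlinarith
    · right
      have : ((e ⟨j, hj⟩ k : ℕ) : ℝ) + 1 ≤ (e ⟨i, hi⟩ k : ℕ) := by exact_mod_cast hlt
      nlinarith

end ItemSet

/-- Layered packing of cubes, sorted by decreasing size, in a box with side lengths `L`. -/
theorem exists_layered_packing {ι : Type*} (s : ι → ℝ) (hs : ∀ i, 0 < s i) :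
    ∀ (d : ℕ) (L : Fin d → ℝ) (shat : ℝ), (∀ k, shat ≤ L k) →
      ∀ S : Finset ι, (∀ i ∈ S, s i ≤ shat) →
      ∃ (T : Finset ι) (pos : ι → Fin d → ℝ), T ⊆ S ∧ (S.Nonempty → T.Nonempty) ∧
        (∀ i ∈ T, ∀ k, 0 ≤ pos i k ∧ pos i k + s i ≤ L k) ∧
        (∀ i ∈ T, ∀ j ∈ T, i ≠ j →
          ∃ k, pos i k + s i ≤ pos j k ∨ pos j k + s j ≤ pos i k) ∧
        (∀ i ∈ T, ∀ j ∈ S, j ∉ T → s j ≤ s i) ∧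
        (T = S ∨ ∏ k, (L k - shat) ≤ ∑ i ∈ T, s i ^ d) := by
  classical
  intro d
  induction d with
  | zero =>
    intro L shat hL S hS
    rcases S.eq_empty_or_nonempty with rfl | hne
    · exact ⟨∅, fun _ k => k.elim0, by simp⟩
    -- In dimension zero no two cubes can be separated, so only the largest is taken; its power `s i
    -- ^ 0 = 1` equals the empty product.
    · obtain ⟨i, hi, hmax⟩ := Finset.exists_max_image S s hne
      refine ⟨{i}, fun _ k => k.elim0, by simpa using hi, by simp, fun _ _ k => k.elim0, ?_, ?_,
        Or.inr (by simp)⟩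
      · intro a ha b hb hab
        simp only [Finset.mem_singleton] at ha hb
        exact absurd (ha.trans hb.symm) hab
      · intro a ha b hb _
        simp only [Finset.mem_singleton] at ha
        subst ha
        exact hmax b hb
  | succ d ih =>
    intro L shat hL
    set A : ℝ := ∏ k : Fin d, (L k.succ - shat) with hA
    have hA0 : 0 ≤ A := Finset.prod_nonneg fun k _ => sub_nonneg.2 (hL _)
    -- Layers are stacked along axis 0. Here `H` is the height still available and `h` a bound on
    -- the sizes still to be packed. The volume estimate telescopes: each layer pays for the
    -- thickness of the next one.
    have key : ∀ (N : ℕ) (S : Finset ι), S.card ≤ N → ∀ (H h : ℝ), (∀ i ∈ S, s i ≤ h) → h ≤ shat →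
        ∃ (T : Finset ι) (pos : ι → Fin (d + 1) → ℝ), T ⊆ S ∧ (S.Nonempty → h ≤ H → T.Nonempty) ∧
        (∀ i ∈ T, 0 ≤ pos i 0 ∧ pos i 0 + s i ≤ H) ∧
        (∀ i ∈ T, ∀ k : Fin d, 0 ≤ pos i k.succ ∧ pos i k.succ + s i ≤ L k.succ) ∧
        (∀ i ∈ T, ∀ j ∈ T, i ≠ j →
          ∃ k, pos i k + s i ≤ pos j k ∨ pos j k + s j ≤ pos i k) ∧
        (∀ i ∈ T, ∀ j ∈ S, j ∉ T → s j ≤ s i) ∧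
        (T = S ∨ (H - h) * A ≤ ∑ i ∈ T, s i ^ (d + 1)) := by
      intro N
      induction N with
      | zero =>
        intro S hN H h _ _
        have : S = ∅ := by simpa using hN
        subst this
        exact ⟨∅, fun _ _ => 0, by simp⟩
      | succ N ihN =>
        intro S hN H h hSh hsh
        rcases S.eq_empty_or_nonempty with rfl | hne
        · exact ⟨∅, fun _ _ => 0, by simp⟩
        obtain ⟨i0, hi0, hmax⟩ := Finset.exists_max_image S s hne
        by_cases hH : H < s i0
        · refine ⟨∅, fun _ _ => 0, by simp, ?_, by simp, by simp, by simp, by simp, Or.inr ?_⟩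
          · intro _ hh
            linarith [hSh i0 hi0]
          · have : H - h ≤ 0 := by linarith [hSh i0 hi0]
            simpa using mul_nonpos_of_nonpos_of_nonneg this hA0
        push Not at hH
        obtain ⟨T1, p1, hT1S, hT1ne, hin1, hsep1, hsort1, hfull1⟩ :=
          ih (fun k => L k.succ) shat (fun k => hL _) S (fun i hi => (hSh i hi).trans hsh)
        have hT1ne := hT1ne hne
        by_cases hTS : T1 = S
        · subst hTS
          refine ⟨T1, fun i => Fin.cons 0 (p1 i), le_rfl, fun _ _ => hne, ?_, ?_, ?_, ?_,
            Or.inl rfl⟩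
          · intro i hi
            simpa using (hmax i hi).trans hH
          · intro i hi k
            simpa using hin1 i hi k
          · intro i hi j hj hij
            obtain ⟨k, hk⟩ := hsep1 i hi j hj hij
            exact ⟨k.succ, by simpa using hk⟩
          · intro i hi j hj hj'
            exact absurd hj hj'
        have hfull1 := hfull1.resolve_left hTS
        set S' := S \ T1 with hS'
        have hS'ne : S'.Nonempty := by
          rw [hS', Finset.sdiff_nonempty]
          exact fun hle => hTS (hT1S.antisymm hle)
        have hcard : S'.card ≤ N := by
          have h1 := Finset.card_sdiff_add_card_eq_card hT1S
          have h2 := hT1ne.card_pos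
          rw [hS']
          omega
        obtain ⟨i1, hi1, hmax1⟩ := Finset.exists_max_image S' s hS'ne
        have hi1S : i1 ∈ S := (Finset.mem_sdiff.1 hi1).1
        obtain ⟨T2, p2, hT2S, -, hin2, hin2', hsep2, hsort2, hfull2⟩ :=
          ihN S' hcard (H - s i0) (s i1) hmax1 ((hSh i1 hi1S).trans hsh)
        have hdisj : Disjoint T1 T2 :=
          Finset.disjoint_of_subset_right hT2S Finset.disjoint_sdiff
        have hn2 : ∀ i ∈ T2, i ∉ T1 := fun i hi hi' => Finset.disjoint_left.1 hdisj hi' hi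
        refine ⟨T1 ∪ T2, fun i => if i ∈ T1 then Fin.cons 0 (p1 i) else
            Fin.cons (p2 i 0 + s i0) (fun k => p2 i k.succ), ?_, ?_, ?_, ?_, ?_, ?_, ?_⟩
        · exact Finset.union_subset hT1S (hT2S.trans Finset.sdiff_subset)
        · exact fun _ _ => hT1ne.mono Finset.subset_union_left
        · intro i hi
          rcases Finset.mem_union.1 hi with hi | hi
          · simpa [hi] using (hmax i (hT1S hi)).trans hH
          · have := hin2 i hi
            simp only [hn2 i hi, if_false, Fin.cons_zero]
            constructor <;> linarith [this.1, this.2, hs i0]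
        · intro i hi k
          rcases Finset.mem_union.1 hi with hi | hi
          · simpa [hi] using hin1 i hi k
          · simpa [hn2 i hi] using hin2' i hi k
        · intro i hi j hj hij
          rcases Finset.mem_union.1 hi with hi | hi <;> rcases Finset.mem_union.1 hj with hj | hj
          · obtain ⟨k, hk⟩ := hsep1 i hi j hj hij
            exact ⟨k.succ, by simpa [hi, hj] using hk⟩
          · refine ⟨0, Or.inl ?_⟩
            simp only [hi, hn2 j hj, if_true, if_false, Fin.cons_zero]
            linarith [(hin2 j hj).1, hmax i (hT1S hi)]
          · refine ⟨0, Or.inr ?_⟩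
            simp only [hj, hn2 i hi, if_true, if_false, Fin.cons_zero]
            linarith [(hin2 i hi).1, hmax j (hT1S hj)]
          · obtain ⟨k, hk⟩ := hsep2 i hi j hj hij
            refine ⟨k, ?_⟩
            simp only [hn2 i hi, hn2 j hj, if_false]
            refine Fin.cases (fun hk => ?_) (fun k hk => ?_) k hk
            · simp only [Fin.cons_zero]
              exact hk.imp (fun h => by linarith) (fun h => by linarith)
            · simpa using hk
        · intro i hi j hj hj'
          rw [Finset.mem_union, not_or] at hj'
          rcases Finset.mem_union.1 hi with hi | hi
          · exact hsort1 i hi j hj hj'.1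
          · exact hsort2 i hi j (Finset.mem_sdiff.2 ⟨hj, hj'.1⟩) hj'.2
        · rcases hfull2 with h2 | h2
          · left
            rw [h2, hS', Finset.union_sdiff_of_subset hT1S]
          · right
            rw [Finset.sum_union hdisj]
            -- Every item of the layer is at least as large as `i1`, the largest item left over.
            -- Since the layer covers base volume `A`, its volume is at least `A` times the
            -- thickness of the next layer.
            have h3 : s i1 * A ≤ ∑ i ∈ T1, s i ^ (d + 1) := by
              calc s i1 * A ≤ s i1 * ∑ i ∈ T1, s i ^ d :=
                    mul_le_mul_of_nonneg_left hfull1 (hs i1).le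
                _ = ∑ i ∈ T1, s i1 * s i ^ d := Finset.mul_sum _ _ _
                _ ≤ ∑ i ∈ T1, s i ^ (d + 1) := by
                    refine Finset.sum_le_sum fun i hi => ?_
                    rw [pow_succ']
                    exact mul_le_mul_of_nonneg_right
                      (hsort1 i hi i1 hi1S (Finset.mem_sdiff.1 hi1).2) (pow_pos (hs i) d).le
            have h4 : (H - h) * A ≤ (H - s i0) * A :=
              mul_le_mul_of_nonneg_right (by linarith [hSh i0 hi0]) hA0
            nlinarith
    intro S hS
    obtain ⟨T, pos, h1, h2, h3, h4, h5, h6, h7⟩ := key S.card S le_rfl (L 0) shat hS le_rfl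
    refine ⟨T, pos, h1, fun hne => h2 hne (hL 0), ?_, h5, h6, ?_⟩
    · intro i hi k
      exact Fin.cases (h3 i hi) (h4 i hi) k
    · rw [Fin.prod_univ_succ]
      exact h7

/-- By induction on the factors, dropping a nonnegative second-order term. For `a = shat` the left
side is `VOL - shat * SURF / 2`, the 𝒱-Box bound, and the right side is the volume that the layered
packing guarantees. -/
theorem prod_sub_sum_le_prod_sub {ι : Type*} [DecidableEq ι] (S : Finset ι) (L : ι → ℝ) {a : ℝ}
    (ha : 0 ≤ a) (hL : ∀ k ∈ S, a ≤ L k) :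
    ∏ k ∈ S, L k - a * ∑ k ∈ S, ∏ l ∈ S.erase k, L l ≤ ∏ k ∈ S, (L k - a) := by
  induction S using Finset.induction_on with
  | empty => simp
  | insert x S hx ih =>
    have ih := ih fun k hk => hL k (Finset.mem_insert_of_mem hk)
    have hxL := hL x (Finset.mem_insert_self _ _)
    have h0 : 0 ≤ ∑ k ∈ S, ∏ l ∈ S.erase k, L l :=
      Finset.sum_nonneg fun k _ => Finset.prod_nonneg fun l hl =>
        ha.trans (hL l (Finset.mem_insert_of_mem (Finset.mem_of_mem_erase hl)))
    have h1 : ∑ k ∈ S, ∏ l ∈ (insert x S).erase k, L l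
        = L x * ∑ k ∈ S, ∏ l ∈ S.erase k, L l := by
      rw [Finset.mul_sum]
      refine Finset.sum_congr rfl fun k hk => ?_
      rw [Finset.erase_insert_of_ne (ne_of_mem_of_not_mem hk hx).symm, Finset.prod_insert]
      exact fun h => hx (Finset.mem_of_mem_erase h)
    rw [Finset.prod_insert hx, Finset.prod_insert hx, Finset.sum_insert hx, h1,
      Finset.erase_insert hx]
    nlinarith [mul_le_mul_of_nonneg_left ih (sub_nonneg.2 hxL), mul_nonneg (mul_nonneg ha ha) h0]

namespace ItemSet

variable {n d : ℕ}

/-- Items whose volume satisfies the bound for `𝒱`-Boxes can be packed. -/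
theorem FitsScale.filled_of_totalVol_le {I : ItemSet n} {B : Cuboid d} {Q : Finset (Fin n)}
    {shat : ℝ} {m : Fin d → ℕ} (h : I.FitsScale B Q shat m)
    (hvol : I.totalVol d Q ≤ B.vol - shat * (B.surf / 2)) : I.Filled B Q := by
  refine ⟨?_, Or.inl ⟨shat, m, h, hvol⟩⟩
  have hside : ∀ k, shat ≤ B.side k := fun k => by
    rw [h.side_eq k]
    have : (1 : ℝ) ≤ m k := by exact_mod_cast h.m_pos k
    nlinarith [h.shat_pos]
  obtain ⟨T, pos, hTQ, -, hin, hsep, -, hfull⟩ :=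
    exists_layered_packing I.size I.size_pos d B.side shat hside Q h.size_le
  have hT : T = Q := by
    rcases hfull with hT | hfull
    · exact hT
    · by_contra hne
      have hlt : ∑ i ∈ T, I.size i ^ d < I.totalVol d Q := by
        obtain ⟨j, hj, hjT⟩ := Finset.exists_of_ssubset (hTQ.ssubset_of_ne hne)
        exact Finset.sum_lt_sum_of_subset hTQ hj hjT (pow_pos (I.size_pos j) d)
          fun i _ _ => (pow_pos (I.size_pos i) d).le
      have h1 := prod_sub_sum_le_prod_sub Finset.univ B.side h.shat_pos.le fun k _ => hside k
      have h2 : B.surf / 2 = ∑ k, ∏ l ∈ Finset.univ.erase k, B.side l := by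
        rw [Cuboid.surf]; ring
      rw [h2, Cuboid.vol] at hvol
      linarith
  subst hT
  refine ⟨fun i k => B.lower k + pos i k, ?_, ?_⟩
  · intro i hi k
    have := hin i hi k
    simp only [cubeAt]
    constructor <;> linarith [this.1, this.2]
  · intro i hi j hj hij
    obtain ⟨k, hk⟩ := hsep i hi j hj hij
    exact ⟨k, hk.imp (fun h => by simp only [cubeAt]; linarith)
      (fun h => by simp only [cubeAt]; linarith)⟩

end ItemSet

/-! ### Tiny items in the free cells of a grid -/

/-- Greedy distribution of small weights to bins of equal capacity. -/
theorem exists_greedy_assignment {ι β : Type*} [Fintype β] [DecidableEq β] (v : ι → ℝ)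
    {v0 cap : ℝ} (S : Finset ι) (hv : ∀ i ∈ S, 0 < v i ∧ v i ≤ v0)
    (hsum : ∑ i ∈ S, v i ≤ Fintype.card β * (cap - v0)) (hcap : 0 ≤ cap) :
    ∃ a : ι → Option β, (∀ i ∈ S, (a i).isSome) ∧
      ∀ b, ∑ i ∈ S with a i = some b, v i ≤ cap := by
  classical
  induction S using Finset.induction_on with
  | empty => exact ⟨fun _ => none, by simp, by simpa using fun _ => hcap⟩
  | insert x S hx ih =>
    have hvx := hv x (Finset.mem_insert_self _ _)
    rw [Finset.sum_insert hx] at hsum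
    obtain ⟨a, ha, hb⟩ := ih (fun i hi => hv i (Finset.mem_insert_of_mem hi)) (by linarith)
    -- If every bin were loaded above `cap - v0`, the total would exceed the assumed bound. A bin
    -- loaded at most that much accepts any further weight.
    have : ∃ b, ∑ i ∈ S with a i = some b, v i ≤ cap - v0 := by
      by_contra! hcon
      have h1 : (Fintype.card β : ℝ) * (cap - v0) ≤ ∑ b, ∑ i ∈ S with a i = some b, v i := by
        have := Finset.sum_le_sum fun b (_ : b ∈ Finset.univ) => (hcon b).le
        simpa only [Finset.sum_const, Finset.card_univ, nsmul_eq_mul] using this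
      have h2 : ∑ b, ∑ i ∈ S with a i = some b, v i ≤ ∑ i ∈ S, v i := by
        simp only [Finset.sum_filter]
        rw [Finset.sum_comm]
        refine Finset.sum_le_sum fun i hi => ?_
        obtain ⟨b, hb⟩ := Option.isSome_iff_exists.1 (ha i hi)
        simp [hb]
      linarith
    obtain ⟨b0, hb0⟩ := this
    have hupd : ∀ i ∈ S, Function.update a x (some b0) i = a i := fun i hi =>
      Function.update_of_ne (ne_of_mem_of_not_mem hi hx) _ _
    refine ⟨Function.update a x (some b0), ?_, ?_⟩
    · intro i hi
      rcases Finset.mem_insert.1 hi with rfl | hi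
      · simp
      · rw [hupd i hi]; exact ha i hi
    · intro b
      rw [Finset.filter_insert]
      have hcong : S.filter (fun i => Function.update a x (some b0) i = some b)
          = S.filter (fun i => a i = some b) :=
        Finset.filter_congr fun i hi => by rw [hupd i hi]
      rw [hcong]
      split_ifs with hif
      · have hbb : b0 = b := by simpa using hif
        subst hbb
        rw [Finset.sum_insert (by simp [hx])]
        linarith
      · exact hb b

namespace Cuboid

variable {d : ℕ}

/-- The cell with index `j` of the regular `N₁ × ⋯ × N_d` grid in `R`. -/
noncomputable def gridCell (R : Cuboid d) (N : Fin d → ℕ) (j : ∀ k, Fin (N k)) : Cuboid d where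
  lower k := R.lower k + (j k : ℕ) * (R.side k / N k)
  side k := R.side k / N k
  side_pos k := div_pos (R.side_pos k) (by exact_mod_cast (j k).pos)

theorem gridCell_within (R : Cuboid d) (N : Fin d → ℕ) (j : ∀ k, Fin (N k)) :
    (R.gridCell N j).Within R := by
  intro k
  have hN : (0 : ℝ) < N k := by exact_mod_cast (j k).pos
  have h1 : ((j k : ℕ) : ℝ) + 1 ≤ N k := by exact_mod_cast (j k).2
  have h2 := div_pos (R.side_pos k) hN
  have h3 : R.side k = N k * (R.side k / N k) := by field_simp
  have h4 : (0 : ℝ) ≤ (j k : ℕ) := Nat.cast_nonneg _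
  simp only [gridCell]
  constructor <;> nlinarith

theorem gridCell_sep (R : Cuboid d) (N : Fin d → ℕ) {i j : ∀ k, Fin (N k)} (h : i ≠ j) :
    (R.gridCell N i).Sep (R.gridCell N j) := by
  obtain ⟨k, hk⟩ := Function.ne_iff.1 h
  refine ⟨k, ?_⟩
  have hN : (0 : ℝ) < N k := by exact_mod_cast (j k).pos
  have h2 := div_pos (R.side_pos k) hN
  simp only [gridCell]
  rcases lt_or_gt_of_ne (fun hE => hk (Fin.ext hE)) with hlt | hlt
  · left
    have : ((i k : ℕ) : ℝ) + 1 ≤ (j k : ℕ) := by exact_mod_cast hlt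
    nlinarith
  · right
    have : ((j k : ℕ) : ℝ) + 1 ≤ (i k : ℕ) := by exact_mod_cast hlt
    nlinarith

theorem gridCell_vol (R : Cuboid d) (N : Fin d → ℕ) (j : ∀ k, Fin (N k)) :
    (R.gridCell N j).vol = R.vol / ∏ k, (N k : ℝ) := by
  simp [vol, gridCell, Finset.prod_div_distrib]

theorem exists_mem_gridCell (R : Cuboid d) (N : Fin d → ℕ) (hN : ∀ k, 0 < N k)
    {x : Fin d → ℝ} (hx : x ∈ R.halfOpen) : ∃ j, x ∈ (R.gridCell N j).halfOpen := by
  rw [mem_halfOpen] at hx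
  have hc : ∀ k, (0 : ℝ) < R.side k / N k := fun k =>
    div_pos (R.side_pos k) (by exact_mod_cast hN k)
  have hlt : ∀ k, ⌊(x k - R.lower k) / (R.side k / N k)⌋₊ < N k := by
    intro k
    have h0 : (0 : ℝ) < N k := by exact_mod_cast hN k
    rw [Nat.floor_lt (div_nonneg (sub_nonneg.2 (hx k).1) (hc k).le), div_lt_iff₀ (hc k)]
    have : (N k : ℝ) * (R.side k / N k) = R.side k := by field_simp
    linarith [(hx k).2]
  refine ⟨fun k => ⟨_, hlt k⟩, mem_halfOpen.2 fun k => ?_⟩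
  have h1 := Nat.floor_le (div_nonneg (sub_nonneg.2 (hx k).1) (hc k).le)
  have h2 := Nat.lt_floor_add_one ((x k - R.lower k) / (R.side k / N k))
  rw [le_div_iff₀ (hc k)] at h1
  rw [div_lt_iff₀ (hc k)] at h2
  simp only [gridCell]
  constructor <;> linarith

/-- A facet of `o` orthogonal to axis `k` lies strictly between those of `A`. -/
def Cut (o A : Cuboid d) (k : Fin d) : Prop :=
  (A.lower k < o.lower k ∧ o.lower k < A.lower k + A.side k) ∨
    (A.lower k < o.lower k + o.side k ∧ o.lower k + o.side k < A.lower k + A.side k)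

/-- If the interiors meet and no endpoint of `o` lies strictly inside the interval of `A` on any
axis, then `o` covers `A` on every axis. Hence a grid cell avoids an obstacle, is cut by one of its
facets, or is covered by it. -/
theorem within_of_not_cut {o A : Cuboid d} (h : ∀ k, ¬ o.Cut A k) (hs : ¬ A.Sep o) :
    A.Within o := by
  simp only [Sep, not_exists, not_or, not_le] at hs
  intro k
  have h1 := h k
  have h2 := hs k
  rw [Cut, not_or, not_and, not_and] at h1
  constructor
  · by_contra! hlt
    exact h1.1 hlt h2.1
  · by_contra! hlt
    exact h1.2 h2.2 hlt

/-- All cells crossed by the hyperplane share their index along axis `k`. Letting that index vary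
injects pairs of a crossed cell and a new index into the set of all cells. -/
theorem card_gridCell_face (R : Cuboid d) (N : ℕ) (k : Fin d) (x : ℝ) :
    (Finset.univ.filter fun j : Fin d → Fin N =>
      (R.gridCell (fun _ => N) j).lower k < x ∧
        x < (R.gridCell (fun _ => N) j).lower k + (R.gridCell (fun _ => N) j).side k).card * N
      ≤ N ^ d := by
  classical
  have hcard : (Finset.univ : Finset (Fin d → Fin N)).card = N ^ d := by simp
  have hcard' : ∀ X : Finset (Fin d → Fin N),
      X.card * N = (X ×ˢ (Finset.univ : Finset (Fin N))).card := fun X => by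
    rw [Finset.card_product, Finset.card_univ, Fintype.card_fin]
  rw [← hcard, hcard']
  refine Finset.card_le_card_of_injOn (fun p => Function.update p.1 k p.2) (by simp) ?_
  rintro ⟨i, t⟩ hi ⟨j, u⟩ hj hij
  simp only [Finset.coe_product, Set.mem_prod, Finset.mem_coe, Finset.mem_filter,
    Finset.mem_univ, true_and, and_true] at hi hj
  have hN : (0 : ℝ) < N := by exact_mod_cast (i k).pos
  have h2 := div_pos (R.side_pos k) hN
  have hk : i k = j k := by
    by_contra hk
    simp only [gridCell] at hi hj
    rcases lt_or_gt_of_ne (fun hE => hk (Fin.ext hE)) with hlt | hlt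
    · have : ((i k : ℕ) : ℝ) + 1 ≤ (j k : ℕ) := by exact_mod_cast hlt
      nlinarith [hi.2, hj.1]
    · have : ((j k : ℕ) : ℝ) + 1 ≤ (i k : ℕ) := by exact_mod_cast hlt
      nlinarith [hi.1, hj.2]
  have hut : t = u := by simpa using congrFun hij k
  have hij' : i = j := by
    funext l
    by_cases hl : l = k
    · subst hl; exact hk
    · simpa [hl] using congrFun hij l
  rw [hut, hij']

open Classical in
/-- The number of cells of a regular grid which are cut by a facet of an obstacle. -/
theorem card_gridCell_cut (R : Cuboid d) (obs : Finset (Cuboid d)) (N : ℕ) :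
    (Finset.univ.filter fun j : Fin d → Fin N =>
      ∃ o ∈ obs, ∃ k, o.Cut (R.gridCell (fun _ => N) j) k).card * N
      ≤ obs.card * d * 2 * N ^ d := by
  set F : Cuboid d → Fin d → Bool → Finset (Fin d → Fin N) := fun o k b =>
    Finset.univ.filter fun j : Fin d → Fin N =>
      (R.gridCell (fun _ => N) j).lower k < (if b then o.lower k else o.lower k + o.side k) ∧
        (if b then o.lower k else o.lower k + o.side k) <
          (R.gridCell (fun _ => N) j).lower k + (R.gridCell (fun _ => N) j).side k with hF
  have hsub : (Finset.univ.filter fun j : Fin d → Fin N =>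
      ∃ o ∈ obs, ∃ k, o.Cut (R.gridCell (fun _ => N) j) k) ⊆
      (obs ×ˢ (Finset.univ : Finset (Fin d × Bool))).biUnion fun p => F p.1 p.2.1 p.2.2 := by
    intro j hj
    simp only [Finset.mem_filter, Finset.mem_univ, true_and] at hj
    obtain ⟨o, ho, k, hk | hk⟩ := hj
    · simp only [Finset.mem_biUnion, Finset.mem_product, Finset.mem_univ, and_true]
      exact ⟨(o, k, true), ho, by simpa [hF] using hk⟩
    · simp only [Finset.mem_biUnion, Finset.mem_product, Finset.mem_univ, and_true]
      exact ⟨(o, k, false), ho, by simpa [hF] using hk⟩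
  calc _ ≤ (∑ p ∈ obs ×ˢ (Finset.univ : Finset (Fin d × Bool)), (F p.1 p.2.1 p.2.2).card) * N :=
        Nat.mul_le_mul_right _ ((Finset.card_le_card hsub).trans Finset.card_biUnion_le)
    _ = ∑ p ∈ obs ×ˢ (Finset.univ : Finset (Fin d × Bool)), (F p.1 p.2.1 p.2.2).card * N :=
        Finset.sum_mul _ _ _
    _ ≤ ∑ p ∈ obs ×ˢ (Finset.univ : Finset (Fin d × Bool)), N ^ d :=
        Finset.sum_le_sum fun p _ => card_gridCell_face R N p.2.1 _
    _ = obs.card * d * 2 * N ^ d := by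
        rw [Finset.sum_const, Finset.card_product, Finset.card_univ, Fintype.card_prod,
          Fintype.card_fin, Fintype.card_bool, smul_eq_mul]
        ring

open Classical in
/-- The uncovered part of `R` is covered by the cells of a grid that avoid the obstacles, and the
cells that are cut by facets of obstacles. -/
theorem volume_free_le_grid (R : Cuboid d) (obs : Finset (Cuboid d)) {N : ℕ} (hN : 0 < N) :
    volume.real (R.free obs) ≤
      (Finset.univ.filter fun j : Fin d → Fin N =>
        ∀ o ∈ obs, (R.gridCell (fun _ => N) j).Sep o).card * (R.vol / N ^ d) +
      obs.card * d * 2 / N * R.vol := by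
  set G := Finset.univ.filter fun j : Fin d → Fin N =>
    ∀ o ∈ obs, (R.gridCell (fun _ => N) j).Sep o with hG
  set Bd := Finset.univ.filter fun j : Fin d → Fin N =>
    ∃ o ∈ obs, ∃ k, o.Cut (R.gridCell (fun _ => N) j) k with hBd
  have hsub : R.free obs ⊆ ⋃ j ∈ G ∪ Bd, (R.gridCell (fun _ => N) j).halfOpen := by
    intro x hx
    obtain ⟨j, hj⟩ := exists_mem_gridCell R (fun _ => N) (fun _ => hN) hx.1
    refine Set.mem_iUnion₂.2 ⟨j, ?_, hj⟩
    by_contra hjn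
    simp only [hG, hBd, Finset.mem_union, Finset.mem_filter, Finset.mem_univ, true_and,
      not_or, not_forall, not_exists, not_and] at hjn
    obtain ⟨⟨o, ho, hns⟩, hcut⟩ := hjn
    have := (within_of_not_cut (hcut o ho) hns).subset hj
    exact hx.2 (Set.mem_iUnion₂.2 ⟨o, ho, this⟩)
  have hV : ∀ j : Fin d → Fin N,
      volume.real (R.gridCell (fun _ => N) j).halfOpen = R.vol / N ^ d := by
    intro j
    rw [volume_real_halfOpen, gridCell_vol]
    simp
  have h1 : volume.real (R.free obs) ≤ ∑ j ∈ G ∪ Bd, R.vol / N ^ d := by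
    refine (measureReal_mono hsub ?_).trans ?_
    · refine ne_of_lt ((measure_biUnion_finset_le _ _).trans_lt ?_)
      exact ENNReal.sum_lt_top.2 fun j _ => (volume_halfOpen_ne_top _).lt_top
    · refine (measureReal_biUnion_finset_le _ _).trans (le_of_eq ?_)
      exact Finset.sum_congr rfl fun j _ => hV j
  have hN' : (0 : ℝ) < N := by exact_mod_cast hN
  have h2 : ((Bd.card : ℕ) : ℝ) * N ≤ obs.card * d * 2 * N ^ d := by
    exact_mod_cast card_gridCell_cut R obs N
  have h3 : ((G ∪ Bd).card : ℝ) ≤ G.card + Bd.card := by exact_mod_cast Finset.card_union_le _ _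
  have hv : 0 < R.vol / (N : ℝ) ^ d := div_pos R.vol_pos (pow_pos hN' d)
  have h4 : (Bd.card : ℝ) * (R.vol / N ^ d) ≤ obs.card * d * 2 / N * R.vol := by
    have : (Bd.card : ℝ) ≤ obs.card * d * 2 / N * N ^ d := by
      rw [div_mul_eq_mul_div, le_div_iff₀ hN']
      exact h2
    calc (Bd.card : ℝ) * (R.vol / N ^ d) ≤ (obs.card * d * 2 / N * N ^ d) * (R.vol / N ^ d) :=
          mul_le_mul_of_nonneg_right this hv.le
      _ = _ := by field_simp
  rw [Finset.sum_const, nsmul_eq_mul] at h1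
  nlinarith

end Cuboid

/-- Each term is the full product divided by one side, and that side is at least `N`. -/
theorem sum_prod_erase_le {ι : Type*} [Fintype ι] [DecidableEq ι] (L : ι → ℝ) {N : ℝ} (hN : 0 < N)
    (hL : ∀ k, N ≤ L k) :
    ∑ k, ∏ l ∈ Finset.univ.erase k, L l ≤ Fintype.card ι / N * ∏ k, L k := by
  have h : ∀ k ∈ Finset.univ, ∏ l ∈ Finset.univ.erase k, L l ≤ 1 / N * ∏ k, L k := by
    intro k hk
    rw [← Finset.mul_prod_erase _ _ hk]
    have h0 : 0 ≤ ∏ l ∈ Finset.univ.erase k, L l :=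
      Finset.prod_nonneg fun l _ => hN.le.trans (hL l)
    rw [← mul_assoc]
    refine le_mul_of_one_le_left h0 ?_
    rw [one_div_mul_eq_div, one_le_div hN]
    exact hL k
  refine (Finset.sum_le_sum h).trans (le_of_eq ?_)
  rw [Finset.sum_const, Finset.card_univ, nsmul_eq_mul]
  ring

/-- The volume bound for a box of `m₁ × ⋯ × m_d` grid cells is almost the volume of a slightly
larger box. -/
theorem floor_capacity {d : ℕ} (hd : 0 < d) (x : Fin d → ℝ) {N : ℕ} (hdN : d ≤ N)
    (hx : ∀ k, (N : ℝ) ≤ x k) :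
    (1 - (2 * d + 1) / N) * ∏ k, x k ≤
      ∏ k, (⌊x k⌋₊ : ℝ) - ∑ k, ∏ l ∈ Finset.univ.erase k, (⌊x l⌋₊ : ℝ) - 1 := by
  have hN : (0 : ℝ) < N := by exact_mod_cast hd.trans_le hdN
  have hN1 : (1 : ℝ) ≤ N := by exact_mod_cast hd.trans_le hdN
  have hm : ∀ k, (N : ℝ) ≤ ⌊x k⌋₊ := fun k => by exact_mod_cast Nat.le_floor (hx k)
  have h1 := sum_prod_erase_le (fun k => (⌊x k⌋₊ : ℝ)) hN hm
  have h2 := sum_prod_erase_le x hN hx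
  have h3 := prod_sub_sum_le_prod_sub Finset.univ x zero_le_one fun k _ => hN1.trans (hx k)
  have h4 : ∏ k, (x k - 1) ≤ ∏ k, (⌊x k⌋₊ : ℝ) := by
    refine Finset.prod_le_prod (fun k _ => by linarith [hx k]) fun k _ => ?_
    linarith [Nat.lt_floor_add_one (x k)]
  have h5 : (N : ℝ) ≤ ∏ k, x k := by
    have hk := Finset.mul_prod_erase Finset.univ x (Finset.mem_univ (⟨0, hd⟩ : Fin d))
    rw [← hk]
    have : 1 ≤ ∏ l ∈ Finset.univ.erase (⟨0, hd⟩ : Fin d), x l := by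
      have := Finset.prod_le_prod (s := Finset.univ.erase (⟨0, hd⟩ : Fin d))
        (f := fun _ => (1 : ℝ)) (g := x) (fun _ _ => zero_le_one) fun k _ => hN1.trans (hx k)
      simpa using this
    nlinarith [hx ⟨0, hd⟩]
  rw [Fintype.card_fin] at h1 h2
  set P := ∏ k, x k
  set M := ∏ k, (⌊x k⌋₊ : ℝ)
  set t : ℝ := d / N
  have ht0 : 0 ≤ t := by positivity
  have ht1 : t ≤ 1 := by
    rw [div_le_one hN]; exact_mod_cast hdN
  -- Rounding down costs a factor `1 - t` with `t = d / N`, the surface term costs another such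
  -- factor, and the final `1` costs at most `P / N`. Since `(1 - t)^2 ≥ 1 - 2t`, the total relative
  -- loss is at most `(2d + 1) / N`.
  have h6 : (1 - t) * P ≤ M := by linarith
  have h7 : (1 - t) * ((1 - t) * P) ≤ (1 - t) * M :=
    mul_le_mul_of_nonneg_left h6 (by linarith)
  have h8 : 1 ≤ 1 / N * P := by rwa [one_div_mul_eq_div, one_le_div hN]
  have h9 : ((2 * d + 1) / N : ℝ) = 2 * t + 1 / N := by simp only [t]; ring
  have hP : 0 ≤ P := by linarith
  rw [h9]
  nlinarith [mul_nonneg (mul_nonneg ht0 ht0) hP]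

namespace ItemSet

open Classical in
/-- Tiny items whose volume is a bit less than that of the free part of a hypercuboid with obstacles
can be packed into a bounded number of boxes. -/
theorem exists_vpack {d : ℕ} (hd : 0 < d) (q : ℕ) {η : ℝ} (hη : 0 < η) :
    ∃ (μ : ℝ) (C : ℕ), 0 < μ ∧ ∀ {n : ℕ} (I : ItemSet n) (R : Cuboid d) (obs : Finset (Cuboid d))
      (f : ℝ) (S : Finset (Fin n)), obs.card ≤ q → 0 < f → (∀ k, f ≤ R.side k) →
      (∀ i ∈ S, I.size i ≤ μ * f) →
      I.totalVol d S ≤ volume.real (R.free obs) - η * R.vol → I.BoxFam R obs S C := by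
  -- `N` is so fine that the cells cut by facets have at most η/2 of the volume of `R`. `N'` is the
  -- least box side in units of `shat`; rounding, the surface term and the greedy slack then cost at
  -- most another η/2.
  obtain ⟨N, hN⟩ := exists_nat_gt (max 1 ((4 * q * d) / η))
  obtain ⟨N', hN'⟩ := exists_nat_gt (max (d : ℝ) ((2 * (2 * d + 1)) / η))
  rw [max_lt_iff] at hN hN'
  have hN0 : (0 : ℝ) < N := by linarith
  have hN0' : (0 : ℝ) < N' := by
    have : (0 : ℝ) ≤ d := Nat.cast_nonneg d
    linarith
  have hNpos : 0 < N := by exact_mod_cast hN0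
  have hdN' : d ≤ N' := by exact_mod_cast hN'.1.le
  refine ⟨1 / (N * N'), N ^ d, by positivity, ?_⟩
  intro n I R obs f S hq hf hfR hsize hvol
  set shat : ℝ := 1 / (N * N') * f with hshat
  have hs0 : 0 < shat := by positivity
  set x : Fin d → ℝ := fun k => R.side k / N / shat with hx
  have hxN : ∀ k, (N' : ℝ) ≤ x k := by
    intro k
    simp only [hx, hshat]
    rw [le_div_iff₀ hs0, le_div_iff₀ hN0]
    have : (N' : ℝ) * (1 / (N * N') * f) * N = f := by field_simp
    rw [this]
    exact hfR k
  have hm0 : ∀ k, 0 < ⌊x k⌋₊ := fun k =>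
    lt_of_lt_of_le (by exact_mod_cast hN0') (Nat.le_floor (hxN k))
  -- The 𝒱-Box bound for the box of `⌊x k⌋₊` multiples of `shat` inside a grid cell. The next
  -- estimate also subtracts `shat ^ d`, the largest possible volume of one item, as slack for the
  -- greedy distribution.
  set cap : ℝ := shat ^ d * (∏ k, (⌊x k⌋₊ : ℝ) - ∑ k, ∏ l ∈ Finset.univ.erase k, (⌊x l⌋₊ : ℝ))
    with hcap
  have hprodx : shat ^ d * ∏ k, x k = R.vol / N ^ d := by
    simp only [hx, Cuboid.vol, Finset.prod_div_distrib, Finset.prod_const, Finset.card_univ,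
      Fintype.card_fin]
    field_simp
  have hcapge : (1 - (2 * d + 1) / N') * (R.vol / N ^ d) ≤ cap - shat ^ d := by
    have := mul_le_mul_of_nonneg_left (floor_capacity hd x hdN' hxN) (pow_pos hs0 d).le
    rw [← hprodx, hcap]
    linarith
  set G := Finset.univ.filter fun j : Fin d → Fin N =>
    ∀ o ∈ obs, (R.gridCell (fun _ => N) j).Sep o with hG
  have hgrid := R.volume_free_le_grid obs hNpos
  rw [← hG] at hgrid
  have hGcard : G.card ≤ N ^ d := by
    refine (Finset.card_le_univ G).trans ?_
    simp
  have hvpos := R.vol_pos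
  have hsum : ∑ i ∈ S, I.size i ^ d ≤ Fintype.card G * (cap - shat ^ d) := by
    have h1 : (G.card : ℝ) * ((1 - (2 * d + 1) / N') * (R.vol / N ^ d)) ≤
        G.card * (cap - shat ^ d) := mul_le_mul_of_nonneg_left hcapge (Nat.cast_nonneg _)
    have h2 : (G.card : ℝ) * (R.vol / N ^ d) ≤ R.vol := by
      rw [mul_div_assoc', div_le_iff₀ (pow_pos hN0 d), mul_comm]
      exact mul_le_mul_of_nonneg_left (by exact_mod_cast hGcard) hvpos.le
    have h3 : (obs.card : ℝ) * d * 2 / N ≤ η / 2 := by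
      have h5 := hN.2
      rw [div_lt_iff₀ hη] at h5
      rw [div_le_iff₀ hN0]
      have : (obs.card : ℝ) * d ≤ q * d :=
        mul_le_mul_of_nonneg_right (by exact_mod_cast hq) (Nat.cast_nonneg d)
      linarith
    have h4 : (2 * d + 1 : ℝ) / N' ≤ η / 2 := by
      have h5 := hN'.2
      rw [div_lt_iff₀ hη] at h5
      rw [div_le_iff₀ hN0']
      linarith
    have h6 : (2 * d + 1 : ℝ) / N' * (G.card * (R.vol / N ^ d)) ≤ η / 2 * R.vol := by
      refine mul_le_mul h4 h2 ?_ (by positivity)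
      positivity
    have h7 : (obs.card : ℝ) * d * 2 / N * R.vol ≤ η / 2 * R.vol :=
      mul_le_mul_of_nonneg_right h3 hvpos.le
    rw [totalVol] at hvol
    rw [Fintype.card_coe]
    nlinarith
  by_cases hS : S = ∅
  · subst hS
    exact BoxFam.empty I R obs _
  have hcap0 : 0 ≤ cap := by
    by_contra! hlt
    obtain ⟨i, hi⟩ := Finset.nonempty_iff_ne_empty.2 hS
    have h1 : 0 < ∑ i ∈ S, I.size i ^ d :=
      Finset.sum_pos (fun i _ => pow_pos (I.size_pos i) d) ⟨i, hi⟩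
    have h2 : (Fintype.card G : ℝ) * (cap - shat ^ d) ≤ 0 :=
      mul_nonpos_of_nonneg_of_nonpos (Nat.cast_nonneg _) (by linarith [pow_pos hs0 d])
    linarith
  obtain ⟨a, ha, hb⟩ := exists_greedy_assignment (β := G) (fun i => I.size i ^ d) S
    (fun i hi => ⟨pow_pos (I.size_pos i) d, pow_le_pow_left₀ (I.size_pos i).le (hsize i hi) d⟩)
    hsum hcap0
  have hwithin : ∀ j : Fin d → Fin N, (⟨(R.gridCell (fun _ => N) j).lower,
      fun k => ⌊x k⌋₊ * shat, fun k => mul_pos (by exact_mod_cast hm0 k) hs0⟩ : Cuboid d).Within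
      (R.gridCell (fun _ => N) j) := by
    intro j k
    refine ⟨le_rfl, ?_⟩
    have h1 : (⌊x k⌋₊ : ℝ) ≤ x k := Nat.floor_le (hN0'.le.trans (hxN k))
    have h2 : x k * shat = R.side k / N := by simp only [hx]; field_simp
    have h3 : (⌊x k⌋₊ : ℝ) * shat ≤ R.side k / N := by
      rw [← h2]; exact mul_le_mul_of_nonneg_right h1 hs0.le
    simpa [Cuboid.gridCell] using h3
  refine ⟨G, inferInstance, fun j => ⟨(R.gridCell (fun _ => N) j).lower,
    fun k => ⌊x k⌋₊ * shat, fun k => mul_pos (by exact_mod_cast hm0 k) hs0⟩,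
    fun j => S.filter fun i => a i = some j, ?_, ?_, ?_, ?_, ?_, ?_, ?_⟩
  · rw [Fintype.card_coe]
    exact hGcard
  · exact fun j => (hwithin j).trans (R.gridCell_within _ _)
  · intro j o ho
    exact ((Finset.mem_filter.1 j.2).2 o ho).mono_left (hwithin j)
  · intro j k hjk
    exact (R.gridCell_sep _ fun h => hjk (Subtype.ext h)).mono (hwithin _) (hwithin _)
  · intro j k hjk
    rw [Finset.disjoint_left]
    intro i hi hi'
    have h1 := (Finset.mem_filter.1 hi).2
    rw [(Finset.mem_filter.1 hi').2] at h1
    exact hjk (by simpa using h1.symm)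
  · ext i
    simp only [Finset.mem_biUnion, Finset.mem_univ, true_and, Finset.mem_filter]
    constructor
    · intro hi
      obtain ⟨j, hj⟩ := Option.isSome_iff_exists.1 (ha i hi)
      exact ⟨j, hi, hj⟩
    · rintro ⟨j, hi, -⟩
      exact hi
  · intro j
    refine FitsScale.filled_of_totalVol_le (shat := shat) (m := fun k => ⌊x k⌋₊)
      ⟨hs0, fun i hi => hsize i (Finset.mem_filter.1 hi).1, hm0, fun k => rfl⟩ ?_
    refine (hb j).trans (le_of_eq ?_)
    rw [hcap, Cuboid.vol, Cuboid.surf]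
    simp only [Finset.prod_mul_distrib, Finset.prod_const, Finset.card_univ, Fintype.card_fin,
      Finset.card_erase_of_mem (Finset.mem_univ _), ← Finset.sum_mul]
    have : shat ^ d = shat * shat ^ (d - 1) := by
      rw [← pow_succ', Nat.sub_add_cancel hd]
    rw [this]
    ring

end ItemSet

/-! ### Cells that are short along every axis -/

/-- A subset of prescribed weight whose profit density is at most the average. -/
theorem exists_subset_low_density {ι : Type*} (v p : ι → ℝ) {v0 α : ℝ} (S : Finset ι)
    (hv : ∀ i ∈ S, 0 < v i ∧ v i ≤ v0) (hα : 0 ≤ α)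
    (hαS : α ≤ ∑ i ∈ S, v i) (hv0 : 0 ≤ v0) :
    ∃ D ⊆ S, α ≤ ∑ i ∈ D, v i ∧ ∑ i ∈ D, v i ≤ α + v0 ∧
      (∑ i ∈ D, p i) * ∑ i ∈ S, v i ≤ (∑ i ∈ D, v i) * ∑ i ∈ S, p i := by
  classical
  have key : ∀ (N : ℕ) (D : Finset ι), D.card ≤ N → D ⊆ S → α ≤ ∑ i ∈ D, v i →
      (∑ i ∈ D, p i) * ∑ i ∈ S, v i ≤ (∑ i ∈ D, v i) * ∑ i ∈ S, p i →
      ∃ D ⊆ S, α ≤ ∑ i ∈ D, v i ∧ ∑ i ∈ D, v i ≤ α + v0 ∧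
        (∑ i ∈ D, p i) * ∑ i ∈ S, v i ≤ (∑ i ∈ D, v i) * ∑ i ∈ S, p i := by
    intro N
    induction N with
    | zero =>
      intro D hD hDS h1 h2
      have : D = ∅ := by simpa using hD
      subst this
      exact ⟨∅, hDS, h1, by simpa using add_nonneg hα hv0, h2⟩
    | succ N ih =>
      intro D hD hDS h1 h2
      by_cases hle : ∑ i ∈ D, v i ≤ α + v0
      · exact ⟨D, hDS, h1, hle, h2⟩
      push Not at hle
      have hpos : 0 < ∑ i ∈ D, v i := by linarith
      have hne : D.Nonempty := by
        rw [Finset.nonempty_iff_ne_empty]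
        rintro rfl
        simp at hpos
      -- Starting from `S`, an element of highest density is removed as long as the weight exceeds
      -- `α + v0`. This never raises the average density, and a removal takes at most `v0`, so the
      -- weight stays at least `α`.
      obtain ⟨x, hx, hmax⟩ := Finset.exists_max_image D (fun i => p i / v i) hne
      have hvx := hv x (hDS hx)
      have e1 := Finset.add_sum_erase D v hx
      have e2 := Finset.add_sum_erase D p hx
      refine ih (D.erase x) ?_ ((Finset.erase_subset _ _).trans hDS) (by linarith [hvx.2]) ?_
      · rw [Finset.card_erase_of_mem hx]; omega
      · have h3 : (∑ i ∈ D, p i) * v x ≤ p x * ∑ i ∈ D, v i := by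
          rw [Finset.sum_mul, Finset.mul_sum]
          refine Finset.sum_le_sum fun i hi => ?_
          have := hmax i hi
          rw [div_le_div_iff₀ (hv i (hDS hi)).1 hvx.1] at this
          exact this
        have hvD : 0 ≤ ∑ i ∈ D.erase x, v i :=
          Finset.sum_nonneg fun i hi => (hv i (hDS (Finset.mem_of_mem_erase hi))).1.le
        have hVS : 0 ≤ ∑ i ∈ S, v i := Finset.sum_nonneg fun i hi => (hv i hi).1.le
        refine le_of_mul_le_mul_right ?_ hpos
        have h4 : (∑ i ∈ D.erase x, p i) * ∑ i ∈ D, v i ≤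
            (∑ i ∈ D, p i) * ∑ i ∈ D.erase x, v i := by
          rw [← e1, ← e2] at h3 ⊢
          nlinarith
        have h5 := mul_le_mul_of_nonneg_right h4 hVS
        have h6 := mul_le_mul_of_nonneg_right h2 hvD
        nlinarith
  exact key S.card S le_rfl le_rfl hαS (mul_comm _ _).le

theorem Cuboid.vol_eq_pow {d : ℕ} {Z : Cuboid d} {f : ℝ} (hZ : ∀ k, Z.side k = f) :
    Z.vol = f ^ d := by
  simp [Cuboid.vol, hZ]

theorem Cuboid.vol_le_free {d : ℕ} {Z R : Cuboid d} {obs : Finset (Cuboid d)} (h : Z.Within R)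
    (hs : ∀ o ∈ obs, Z.Sep o) : Z.vol ≤ volume.real (R.free obs) := by
  rw [← Z.volume_real_halfOpen]
  exact measureReal_mono (h.subset_free hs) (R.volume_free_ne_top obs)

namespace ItemSet

/-- Tiny items packed in a box of bounded aspect ratio with obstacles that leave room for a cube
can be rearranged into boundedly many boxes, at a small loss of profit. -/
theorem exists_corner {d : ℕ} (hd : 0 < d) (q : ℕ) {c ε : ℝ} (hc : 0 < c) (hε : 0 < ε)
    (hε1 : ε ≤ 1) :
    ∃ (μ : ℝ) (C : ℕ), 0 < μ ∧ ∀ {n : ℕ} (I : ItemSet n) (R : Cuboid d) (obs : Finset (Cuboid d))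
      (f : ℝ) (S : Finset (Fin n)) (pos : Fin n → Fin d → ℝ), obs.card ≤ q → 0 < f →
      (∀ k, R.side k ≤ c * f) →
      (∃ Z : Cuboid d, (∀ k, Z.side k = f) ∧ Z.Within R ∧ ∀ o ∈ obs, Z.Sep o) →
      I.PackedIn S pos R → I.Avoids S pos obs → (∀ i ∈ S, I.size i ≤ μ * f) →
      ∃ S' ⊆ S, I.BoxFam R obs S' C ∧ (1 - ε) * I.totalProfit S ≤ I.totalProfit S' := by
  classical
  have hcd : 0 < c ^ d := pow_pos hc d
  -- The free cube has at least a fraction `1 / c ^ d` of the volume of `R`, so with this η the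
  -- waste is at most ε/4 of the free volume.
  obtain ⟨μ, C, hμ, hE⟩ := exists_vpack hd q (η := ε / 4 / c ^ d) (by positivity)
  refine ⟨min μ (ε / 8), C, by positivity, ?_⟩
  intro n I R obs f S pos hq hf hside ⟨Z, hZ, hZR, hZo⟩ hpack hav hsize
  have hF1 : f ^ d ≤ volume.real (R.free obs) := by
    rw [← Cuboid.vol_eq_pow hZ]
    exact Cuboid.vol_le_free hZR hZo
  have hRvol : R.vol ≤ c ^ d * f ^ d := by
    rw [← mul_pow, Cuboid.vol]
    calc ∏ k, R.side k ≤ ∏ _k : Fin d, c * f :=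
          Finset.prod_le_prod (fun k _ => (R.side_pos k).le) fun k _ => hside k
      _ = (c * f) ^ d := by simp
  have hfR : ∀ k, f ≤ R.side k := fun k => by
    have := hZR k
    rw [hZ k] at this
    linarith [this.1, this.2]
  set F := volume.real (R.free obs) with hFdef
  have hfd : 0 < f ^ d := pow_pos hf d
  have hηR : ε / 4 / c ^ d * R.vol ≤ ε / 4 * F := by
    calc ε / 4 / c ^ d * R.vol ≤ ε / 4 / c ^ d * (c ^ d * f ^ d) :=
          mul_le_mul_of_nonneg_left hRvol (by positivity)
      _ = ε / 4 * f ^ d := by field_simp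
      _ ≤ ε / 4 * F := mul_le_mul_of_nonneg_left hF1 (by positivity)
  have hV := I.totalVol_le_free hpack hav
  have hsz : ∀ S' ⊆ S, ∀ i ∈ S', I.size i ≤ μ * f := fun S' hS' i hi =>
    (hsize i (hS' hi)).trans (mul_le_mul_of_nonneg_right (min_le_left _ _) hf.le)
  by_cases hcase : I.totalVol d S ≤ (1 - ε / 4) * F
  · refine ⟨S, le_rfl, hE I R obs f S hq hf hfR (hsz S le_rfl) (by linarith), ?_⟩
    nlinarith [I.totalProfit_nonneg S]
  push Not at hcase
  have hFpos : 0 < F := hfd.trans_le hF1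
  have hv0 : ∀ i ∈ S, 0 < I.size i ^ d ∧ I.size i ^ d ≤ ε / 8 * F := by
    intro i hi
    refine ⟨pow_pos (I.size_pos i) d, ?_⟩
    have h1 : I.size i ≤ ε / 8 * f :=
      (hsize i hi).trans (mul_le_mul_of_nonneg_right (min_le_right _ _) hf.le)
    calc I.size i ^ d ≤ (ε / 8 * f) ^ d := pow_le_pow_left₀ (I.size_pos i).le h1 d
      _ = (ε / 8) ^ d * f ^ d := mul_pow _ _ _
      _ ≤ ε / 8 * F := by
          refine mul_le_mul ?_ hF1 hfd.le (by positivity)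
          exact pow_le_of_le_one (by positivity) (by linarith) hd.ne'
  -- The items nearly fill the free volume `F`. Those removed have volume at least ε/4 · F and
  -- overshoot by at most one item, that is by ε/8 · F. Their density is at most average, so their
  -- profit share is at most (3ε/8)/(1 - ε/4) ≤ ε.
  obtain ⟨D, hDS, hD1, hD2, hD3⟩ := exists_subset_low_density (fun i => I.size i ^ d) I.profit
    (v0 := ε / 8 * F) (α := ε / 4 * F) S hv0 (by positivity)
    (by rw [totalVol] at hcase; nlinarith) (by positivity)
  have e1 : I.totalVol d (S \ D) + ∑ i ∈ D, I.size i ^ d = I.totalVol d S :=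
    Finset.sum_sdiff hDS
  have e2 : I.totalProfit (S \ D) + ∑ i ∈ D, I.profit i = I.totalProfit S :=
    Finset.sum_sdiff hDS
  refine ⟨S \ D, Finset.sdiff_subset, hE I R obs f _ hq hf hfR (hsz _ Finset.sdiff_subset) ?_, ?_⟩
  · linarith
  · have hP := I.totalProfit_nonneg S
    have h3 : (∑ i ∈ D, I.profit i) * ((1 - ε / 4) * F) ≤ (ε * I.totalProfit S) *
        ((1 - ε / 4) * F) := by
      have hD0 : 0 ≤ ∑ i ∈ D, I.profit i := I.totalProfit_nonneg D
      calc _ ≤ (∑ i ∈ D, I.profit i) * I.totalVol d S :=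
            mul_le_mul_of_nonneg_left hcase.le hD0
        _ ≤ (∑ i ∈ D, I.size i ^ d) * I.totalProfit S := hD3
        _ ≤ (ε / 4 * F + ε / 8 * F) * I.totalProfit S := mul_le_mul_of_nonneg_right hD2 hP
        _ ≤ _ := by
            have : ε / 4 * F + ε / 8 * F ≤ ε * ((1 - ε / 4) * F) := by nlinarith
            calc _ ≤ ε * ((1 - ε / 4) * F) * I.totalProfit S :=
                  mul_le_mul_of_nonneg_right this hP
              _ = _ := by ring
    have h4 := le_of_mul_le_mul_right h3 (by nlinarith)
    linarith

end ItemSet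

/-! ### Decomposition into good cells by cheap cuts -/

namespace Cuboid

variable {d : ℕ}

/-- The part of `R` below the hyperplane `xₖ = x`. -/
def cutBelow (R : Cuboid d) (k : Fin d) (x : ℝ) (hx : R.lower k < x) : Cuboid d where
  lower := R.lower
  side := Function.update R.side k (x - R.lower k)
  side_pos l := by
    by_cases hl : l = k
    · subst hl; simpa using hx
    · simpa [hl] using R.side_pos l

/-- The part of `R` above the hyperplane `xₖ = x`. -/
def cutAbove (R : Cuboid d) (k : Fin d) (x : ℝ) (hx : x < R.lower k + R.side k) : Cuboid d where
  lower := Function.update R.lower k x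
  side := Function.update R.side k (R.lower k + R.side k - x)
  side_pos l := by
    by_cases hl : l = k
    · subst hl; simpa using hx
    · simpa [hl] using R.side_pos l

theorem within_cutBelow {A R : Cuboid d} {k : Fin d} {x : ℝ} (hx : R.lower k < x)
    (hA : A.Within R) (h : A.lower k + A.side k ≤ x) : A.Within (R.cutBelow k x hx) := by
  intro l
  by_cases hl : l = k
  · subst hl
    simpa [cutBelow] using ⟨(hA l).1, h⟩
  · simpa [cutBelow, hl] using hA l

theorem within_cutAbove {A R : Cuboid d} {k : Fin d} {x : ℝ} (hx : x < R.lower k + R.side k)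
    (hA : A.Within R) (h : x ≤ A.lower k) : A.Within (R.cutAbove k x hx) := by
  intro l
  by_cases hl : l = k
  · subst hl
    simpa [cutAbove] using ⟨h, (hA l).2⟩
  · simpa [cutAbove, hl] using hA l

theorem cutBelow_within (R : Cuboid d) {k : Fin d} {x : ℝ} (hx : R.lower k < x)
    (hx' : x ≤ R.lower k + R.side k) : (R.cutBelow k x hx).Within R := by
  intro l
  by_cases hl : l = k
  · subst hl
    simpa [cutBelow] using hx'
  · simp [cutBelow, hl]

theorem cutAbove_within (R : Cuboid d) {k : Fin d} {x : ℝ} (hx : x < R.lower k + R.side k)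
    (hx' : R.lower k ≤ x) : (R.cutAbove k x hx).Within R := by
  intro l
  by_cases hl : l = k
  · subst hl
    simpa [cutAbove] using hx'
  · simp [cutAbove, hl]

theorem cutBelow_sep_cutAbove (R : Cuboid d) {k : Fin d} {x : ℝ} (hx : R.lower k < x)
    (hx' : x < R.lower k + R.side k) : (R.cutBelow k x hx).Sep (R.cutAbove k x hx') :=
  ⟨k, Or.inl (by simp [cutBelow, cutAbove])⟩

open Classical in
/-- The coordinates of the facets of the obstacles which are strictly inside `R` along axis `k`. -/
noncomputable def inner (R : Cuboid d) (obs : Finset (Cuboid d)) (k : Fin d) : Finset ℝ :=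
  (obs.image (fun o => o.lower k) ∪ obs.image fun o => o.lower k + o.side k).filter
    fun x => R.lower k < x ∧ x < R.lower k + R.side k

theorem mem_inner {R : Cuboid d} {obs : Finset (Cuboid d)} {k : Fin d} {x : ℝ} :
    x ∈ R.inner obs k ↔ (∃ o ∈ obs, o.lower k = x ∨ o.lower k + o.side k = x) ∧
      R.lower k < x ∧ x < R.lower k + R.side k := by
  classical
  simp only [inner, Finset.mem_filter, Finset.mem_union, Finset.mem_image]
  refine and_congr_left fun _ => ?_
  constructor
  · rintro (⟨o, ho, h⟩ | ⟨o, ho, h⟩)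
    · exact ⟨o, ho, Or.inl h⟩
    · exact ⟨o, ho, Or.inr h⟩
  · rintro ⟨o, ho, h | h⟩
    · exact Or.inl ⟨o, ho, h⟩
    · exact Or.inr ⟨o, ho, h⟩

theorem card_inner_le (R : Cuboid d) (obs : Finset (Cuboid d)) (k : Fin d) :
    (R.inner obs k).card ≤ 2 * obs.card := by
  classical
  refine (Finset.card_filter_le _ _).trans ((Finset.card_union_le _ _).trans ?_)
  have h1 := Finset.card_image_le (s := obs) (f := fun o : Cuboid d => o.lower k)
  have h2 := Finset.card_image_le (s := obs) (f := fun o : Cuboid d => o.lower k + o.side k)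
  omega

theorem inner_cutBelow {R : Cuboid d} {obs : Finset (Cuboid d)} {k : Fin d} {x : ℝ}
    (hx : R.lower k < x) (hx' : x ≤ R.lower k + R.side k) (l : Fin d) :
    (R.cutBelow k x hx).inner obs l = (R.inner obs l).filter fun y => l = k → y < x := by
  classical
  ext y
  rw [Finset.mem_filter, mem_inner, mem_inner]
  by_cases hl : l = k
  · subst hl
    simp only [cutBelow, Function.update_self, forall_const]
    constructor
    · rintro ⟨h1, h2, h3⟩
      exact ⟨⟨h1, h2, by linarith⟩, by linarith⟩
    · rintro ⟨⟨h1, h2, h3⟩, h4⟩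
      exact ⟨h1, h2, by linarith⟩
  · simp [cutBelow, hl]

theorem inner_cutAbove {R : Cuboid d} {obs : Finset (Cuboid d)} {k : Fin d} {x : ℝ}
    (hx : x < R.lower k + R.side k) (hx' : R.lower k ≤ x) (l : Fin d) :
    (R.cutAbove k x hx).inner obs l = (R.inner obs l).filter fun y => l = k → x < y := by
  classical
  ext y
  rw [Finset.mem_filter, mem_inner, mem_inner]
  by_cases hl : l = k
  · subst hl
    simp only [cutAbove, Function.update_self, forall_const]
    constructor
    · rintro ⟨h1, h2, h3⟩
      exact ⟨⟨h1, by linarith, by linarith⟩, by linarith⟩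
    · rintro ⟨⟨h1, h2, h3⟩, h4⟩
      exact ⟨h1, h4, by linarith⟩
  · simp [cutAbove, hl]

/-- The number of facet coordinates of obstacles strictly inside `R`. -/
noncomputable def complexity (R : Cuboid d) (obs : Finset (Cuboid d)) : ℕ :=
  ∑ k, (R.inner obs k).card

/-- The measure on which the recursion over cuts terminates: a piece gains no inner coordinates, so
losing a single one makes it simpler. -/
theorem complexity_lt {R R' : Cuboid d} {obs : Finset (Cuboid d)} {k : Fin d} {x : ℝ}
    (hsub : ∀ l, R'.inner obs l ⊆ R.inner obs l) (hx : x ∈ R.inner obs k)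
    (hx' : x ∉ R'.inner obs k) : R'.complexity obs < R.complexity obs :=
  Finset.sum_lt_sum (fun l _ => Finset.card_le_card (hsub l))
    ⟨k, Finset.mem_univ k, Finset.card_lt_card ⟨hsub k, fun h => hx' (h hx)⟩⟩

theorem complexity_le (R : Cuboid d) (obs : Finset (Cuboid d)) :
    R.complexity obs ≤ d * (2 * obs.card) := by
  calc R.complexity obs ≤ ∑ _k : Fin d, 2 * obs.card :=
        Finset.sum_le_sum fun k _ => R.card_inner_le obs k
    _ = d * (2 * obs.card) := by simp

/-- A cube that starts at or below `a` already ends below the cut. Otherwise it slides down along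
axis `k` until it starts at `a`: inside `R` no facet lies beyond `a`, so obstacles that lay below
the cube on this axis still do. -/
theorem exists_cube_cutBelow {R Z : Cuboid d} {obs : Finset (Cuboid d)} {f a x : ℝ} {k : Fin d}
    (hZ : ∀ l, Z.side l = f) (hZR : Z.Within R) (hZo : ∀ o ∈ obs, Z.Sep o)
    (ha : R.lower k ≤ a) (hno : ∀ y ∈ R.inner obs k, y ≤ a) (hax : a + f ≤ x)
    (hx : R.lower k < x) :
    ∃ Z' : Cuboid d, (∀ l, Z'.side l = f) ∧ Z'.Within (R.cutBelow k x hx) ∧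
      ∀ o ∈ obs, Z'.Sep o := by
  by_cases hle : Z.lower k ≤ a
  · refine ⟨Z, hZ, within_cutBelow hx hZR ?_, hZo⟩
    rw [hZ k]; linarith
  push Not at hle
  refine ⟨⟨Function.update Z.lower k a, Z.side, Z.side_pos⟩, hZ, ?_, ?_⟩
  · refine within_cutBelow hx ?_ (by simpa [hZ k] using hax)
    intro l
    by_cases hl : l = k
    · subst hl
      have := hZR l
      simp only [Function.update_self]
      exact ⟨ha, by linarith [this.2]⟩
    · simpa [hl] using hZR l
  · intro o ho
    obtain ⟨l, hl⟩ := hZo o ho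
    refine ⟨l, ?_⟩
    by_cases hlk : l = k
    · subst hlk
      simp only [Function.update_self]
      rcases hl with hl | hl
      · left; linarith
      · right
        by_contra! hcon
        have h1 := hZR l
        have h2 := Z.side_pos l
        exact absurd (hno _ (mem_inner.2 ⟨⟨o, ho, Or.inr rfl⟩, by linarith, by linarith⟩))
          (not_le.2 hcon)
    · simpa [hlk] using hl

/-- The mirror image of `exists_cube_cutBelow`: the cube slides up until it ends at `a`. -/
theorem exists_cube_cutAbove {R Z : Cuboid d} {obs : Finset (Cuboid d)} {f a x : ℝ} {k : Fin d}
    (hZ : ∀ l, Z.side l = f) (hZR : Z.Within R) (hZo : ∀ o ∈ obs, Z.Sep o)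
    (ha : a ≤ R.lower k + R.side k) (hno : ∀ y ∈ R.inner obs k, a ≤ y) (hax : x ≤ a - f)
    (hx : x < R.lower k + R.side k) :
    ∃ Z' : Cuboid d, (∀ l, Z'.side l = f) ∧ Z'.Within (R.cutAbove k x hx) ∧
      ∀ o ∈ obs, Z'.Sep o := by
  by_cases hle : a ≤ Z.lower k + f
  · exact ⟨Z, hZ, within_cutAbove hx hZR (by linarith), hZo⟩
  push Not at hle
  refine ⟨⟨Function.update Z.lower k (a - f), Z.side, Z.side_pos⟩, hZ, ?_, ?_⟩
  · refine within_cutAbove hx ?_ (by simpa using hax)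
    intro l
    by_cases hl : l = k
    · subst hl
      have := hZR l
      simp only [Function.update_self, hZ l]
      exact ⟨by linarith [this.1], by linarith⟩
    · simpa [hl] using hZR l
  · intro o ho
    obtain ⟨l, hl⟩ := hZo o ho
    refine ⟨l, ?_⟩
    by_cases hlk : l = k
    · subst hlk
      simp only [Function.update_self, hZ l] at hl ⊢
      rcases hl with hl | hl
      · left
        by_contra! hcon
        have h1 := hZR l
        have h2 := Z.side_pos l
        rw [hZ l] at h1 h2
        exact absurd (hno _ (mem_inner.2 ⟨⟨o, ho, Or.inl rfl⟩, by linarith, by linarith⟩))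
          (not_le.2 (by linarith))
      · right; linarith
    · simpa [hlk] using hl

end Cuboid

namespace ItemSet

variable {n d : ℕ}

/-- Among cutting planes at distance at least `f`, one cuts items of small profit only. -/
theorem exists_cheap_cut (I : ItemSet n) (S : Finset (Fin n)) (pos : Fin n → Fin d → ℝ) {f : ℝ}
    (hf : ∀ i ∈ S, I.size i ≤ f) (k : Fin d) {T : ℕ} (hT : 0 < T) (x : Fin T → ℝ)
    (hx : ∀ s t, s < t → f ≤ |x s - x t|) :
    ∃ t, I.totalProfit (S.filter fun i => pos i k < x t ∧ x t < pos i k + I.size i) * T ≤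
      I.totalProfit S := by
  classical
  by_contra! hcon
  have h1 : ∑ t, I.totalProfit (S.filter fun i => pos i k < x t ∧ x t < pos i k + I.size i) ≤
      I.totalProfit S := by
    simp only [totalProfit, Finset.sum_filter]
    rw [Finset.sum_comm]
    refine Finset.sum_le_sum fun i hi => ?_
    rw [← Finset.sum_filter, Finset.sum_const, nsmul_eq_mul]
    -- The planes are at mutual distance at least `f`, so an item of size at most `f` is strictly
    -- crossed by at most one of them.
    have : (Finset.univ.filter fun t : Fin T =>
        pos i k < x t ∧ x t < pos i k + I.size i).card ≤ 1 := by
      rw [Finset.card_le_one]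
      intro s hs t ht
      simp only [Finset.mem_filter, Finset.mem_univ, true_and] at hs ht
      have hfi := hf i hi
      by_contra hne
      rcases lt_or_gt_of_ne hne with h | h <;>
      · have := hx _ _ h
        rcases le_abs.1 this with h' | h' <;> linarith [hs.1, hs.2, ht.1, ht.2]
    have h2 : ((Finset.univ.filter fun t : Fin T =>
        pos i k < x t ∧ x t < pos i k + I.size i).card : ℝ) ≤ 1 := by exact_mod_cast this
    nlinarith [I.profit_pos i]
  have hT' : (0 : ℝ) < T := by exact_mod_cast hT
  have h2 : ∑ _t : Fin T, I.totalProfit S < ∑ t, I.totalProfit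
      (S.filter fun i => pos i k < x t ∧ x t < pos i k + I.size i) * T :=
    Finset.sum_lt_sum_of_nonempty ⟨⟨0, hT⟩, Finset.mem_univ _⟩ fun t _ => hcon t
  rw [← Finset.sum_mul, Finset.sum_const, Finset.card_univ, Fintype.card_fin, nsmul_eq_mul] at h2
  nlinarith

/-- A region of the decomposition at scale `f`: along each axis it is short or no facet of an
obstacle is inside it. -/
structure GoodCell (I : ItemSet n) (obs : Finset (Cuboid d)) (pos : Fin n → Fin d → ℝ) (c : ℝ)
    (R : Cuboid d) (f : ℝ) (S : Finset (Fin n)) : Prop where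
  packed : I.PackedIn S pos R
  pos : 0 < f
  size_le : ∀ i ∈ S, I.size i ≤ f
  cube : ∃ Z : Cuboid d, (∀ k, Z.side k = f) ∧ Z.Within R ∧ ∀ o ∈ obs, Z.Sep o
  side : ∀ k, R.side k ≤ c * f ∨ R.inner obs k = ∅

/-- A decomposition of `R` into at most `C` good cells which contain all items of `S`, up to a
fraction `ρ` of the profit. -/
def Decomp (I : ItemSet n) (obs : Finset (Cuboid d)) (pos : Fin n → Fin d → ℝ) (c : ℝ)
    (R : Cuboid d) (S : Finset (Fin n)) (C : ℕ) (ρ : ℝ) : Prop :=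
  ∃ (β : Type) (_ : Fintype β) (B : β → Cuboid d) (f : β → ℝ) (A : β → Finset (Fin n)),
    Fintype.card β ≤ C ∧ (∀ j, (B j).Within R) ∧ (∀ j k, j ≠ k → (B j).Sep (B k)) ∧
    (∀ j, A j ⊆ S) ∧ (∀ j k, j ≠ k → Disjoint (A j) (A k)) ∧
    (∀ j, I.GoodCell obs pos c (B j) (f j) (A j)) ∧
    (1 - ρ) * I.totalProfit S ≤ ∑ j, I.totalProfit (A j)

theorem Decomp.mono {I : ItemSet n} {obs : Finset (Cuboid d)} {pos : Fin n → Fin d → ℝ} {c : ℝ}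
    {R : Cuboid d} {S : Finset (Fin n)} {C C' : ℕ} {ρ ρ' : ℝ} (h : I.Decomp obs pos c R S C ρ)
    (hC : C ≤ C') (hρ : ρ ≤ ρ') : I.Decomp obs pos c R S C' ρ' := by
  obtain ⟨β, hβ, B, f, A, h1, h2, h3, h4, h5, h6, h7⟩ := h
  refine ⟨β, hβ, B, f, A, h1.trans hC, h2, h3, h4, h5, h6, le_trans ?_ h7⟩
  exact mul_le_mul_of_nonneg_right (by linarith) (I.totalProfit_nonneg S)

theorem Decomp.empty (I : ItemSet n) (obs : Finset (Cuboid d)) (pos : Fin n → Fin d → ℝ) (c : ℝ)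
    (R : Cuboid d) (C : ℕ) (ρ : ℝ) : I.Decomp obs pos c R ∅ C ρ :=
  ⟨Empty, inferInstance, fun j => j.elim, fun j => j.elim, fun j => j.elim, by simp,
    fun j => j.elim, fun j => j.elim, fun j => j.elim, fun j => j.elim, fun j => j.elim,
    by simp [totalProfit]⟩

theorem GoodCell.decomp {I : ItemSet n} {obs : Finset (Cuboid d)} {pos : Fin n → Fin d → ℝ}
    {c : ℝ} {R : Cuboid d} {f : ℝ} {S : Finset (Fin n)} (h : I.GoodCell obs pos c R f S) {C : ℕ}
    (hC : 1 ≤ C) {ρ : ℝ} (hρ : 0 ≤ ρ) : I.Decomp obs pos c R S C ρ :=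
  ⟨Unit, inferInstance, fun _ => R, fun _ => f, fun _ => S, by simpa using hC,
    fun _ => Cuboid.Within.refl R, fun j k hjk => absurd rfl hjk, fun _ => le_rfl,
    fun j k hjk => absurd rfl hjk, fun _ => h, by
      have := mul_nonneg hρ (I.totalProfit_nonneg S)
      simp only [Finset.univ_unique, Finset.sum_singleton]
      linarith⟩

/-- Decompositions of the two sides of a cut can be combined. -/
theorem Decomp.of_cut {I : ItemSet n} {obs : Finset (Cuboid d)} {pos : Fin n → Fin d → ℝ} {c : ℝ}
    {R : Cuboid d} {S : Finset (Fin n)} {C₁ C₂ : ℕ} {ρ σ : ℝ} {k : Fin d} {x : ℝ}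
    (hx : R.lower k < x) (hx' : x < R.lower k + R.side k) (hρ : 0 ≤ ρ)
    (hcut : I.totalProfit (S.filter fun i => pos i k < x ∧ x < pos i k + I.size i) ≤
      σ * I.totalProfit S)
    (h₁ : I.Decomp obs pos c (R.cutBelow k x hx)
      (S.filter fun i => pos i k + I.size i ≤ x) C₁ ρ)
    (h₂ : I.Decomp obs pos c (R.cutAbove k x hx') (S.filter fun i => x ≤ pos i k) C₂ ρ) :
    I.Decomp obs pos c R S (C₁ + C₂) (ρ + σ) := by
  classical
  obtain ⟨β₁, _, B₁, f₁, A₁, a1, a2, a3, a4, a5, a6, a7⟩ := h₁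
  obtain ⟨β₂, _, B₂, f₂, A₂, b1, b2, b3, b4, b5, b6, b7⟩ := h₂
  set S₁ := S.filter fun i => pos i k + I.size i ≤ x with hS₁
  set S₂ := S.filter fun i => x ≤ pos i k with hS₂
  set S₃ := S.filter fun i => pos i k < x ∧ x < pos i k + I.size i with hS₃
  have hdisj : Disjoint S₁ S₂ := by
    rw [Finset.disjoint_left]
    intro i hi hi'
    have h1 := (Finset.mem_filter.1 hi).2
    have h2 := (Finset.mem_filter.1 hi').2
    linarith [I.size_pos i]
  have hsep := R.cutBelow_sep_cutAbove hx hx'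
  refine ⟨β₁ ⊕ β₂, inferInstance, Sum.elim B₁ B₂, Sum.elim f₁ f₂, Sum.elim A₁ A₂, ?_, ?_, ?_, ?_,
    ?_, ?_, ?_⟩
  · rw [Fintype.card_sum]; omega
  · rintro (j | j)
    · exact (a2 j).trans (R.cutBelow_within hx hx'.le)
    · exact (b2 j).trans (R.cutAbove_within hx' hx.le)
  · rintro (i | i) (j | j) hij
    · exact a3 i j fun h => hij (by rw [h])
    · exact hsep.mono (a2 i) (b2 j)
    · exact (hsep.mono (a2 j) (b2 i)).symm
    · exact b3 i j fun h => hij (by rw [h])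
  · rintro (j | j)
    · exact (a4 j).trans (Finset.filter_subset _ _)
    · exact (b4 j).trans (Finset.filter_subset _ _)
  · rintro (i | i) (j | j) hij
    · exact a5 i j fun h => hij (by rw [h])
    · exact hdisj.mono (a4 i) (b4 j)
    · exact (hdisj.mono (a4 j) (b4 i)).symm
    · exact b5 i j fun h => hij (by rw [h])
  · rintro (j | j)
    · exact a6 j
    · exact b6 j
  · rw [Fintype.sum_sum_type]
    simp only [Sum.elim_inl, Sum.elim_inr]
    have h12 : I.totalProfit (S₁ ∪ S₂) = I.totalProfit S₁ + I.totalProfit S₂ :=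
      Finset.sum_union hdisj
    have hle : I.totalProfit (S₁ ∪ S₂) ≤ I.totalProfit S :=
      I.totalProfit_mono (Finset.union_subset (Finset.filter_subset _ _)
        (Finset.filter_subset _ _))
    have hge : I.totalProfit S ≤ I.totalProfit (S₁ ∪ S₂) + I.totalProfit S₃ := by
      have hsub : S ⊆ (S₁ ∪ S₂) ∪ S₃ := by
        intro i hi
        simp only [hS₁, hS₂, hS₃, Finset.mem_union, Finset.mem_filter, hi, true_and]
        by_contra! hcon
        linarith [hcon.2 hcon.1.2, hcon.1.1]
      refine (I.totalProfit_mono hsub).trans ?_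
      have := Finset.sum_union_inter (s₁ := S₁ ∪ S₂) (s₂ := S₃) (f := I.profit)
      have h0 := I.totalProfit_nonneg ((S₁ ∪ S₂) ∩ S₃)
      simp only [totalProfit] at h0 ⊢
      linarith
    have := mul_le_mul_of_nonneg_left hle hρ
    nlinarith

/-- Up to a fraction `L / T` of the profit, every packing among obstacles can be decomposed into
boundedly many good cells. -/
theorem exists_decomp (d q M : ℕ) : ∃ C L : ℕ, ∀ {n : ℕ} (I : ItemSet n)
    (obs : Finset (Cuboid d)) (pos : Fin n → Fin d → ℝ) (T : ℕ), 0 < T → obs.card ≤ q →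
    ∀ (R : Cuboid d) (S : Finset (Fin n)), R.complexity obs ≤ M → I.PackedIn S pos R →
      I.Avoids S pos obs → I.Decomp obs pos (3 * T) R S C (L / T) := by
  classical
  induction M using Nat.strong_induction_on with
  | _ M ihM =>
  have hbelow : ∃ C L : ℕ, ∀ {n : ℕ} (I : ItemSet n)
      (obs : Finset (Cuboid d)) (pos : Fin n → Fin d → ℝ) (T : ℕ), 0 < T → obs.card ≤ q →
      ∀ (R : Cuboid d) (S : Finset (Fin n)), R.complexity obs < M → I.PackedIn S pos R →
      I.Avoids S pos obs → I.Decomp obs pos (3 * T) R S C (L / T) := by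
    rcases Nat.eq_zero_or_pos M with rfl | hM
    · exact ⟨0, 0, fun I obs pos T hT hq R S hR => absurd hR (Nat.not_lt_zero _)⟩
    · obtain ⟨C, L, h⟩ := ihM (M - 1) (by omega)
      exact ⟨C, L, fun I obs pos T hT hq R S hR => h I obs pos T hT hq R S (by omega)⟩
  obtain ⟨C, L, hCL⟩ := hbelow
  -- `F` lists the faces of `R` that may still need trimming, `false` for lower and `true` for
  -- upper. At any other face there is an inner facet coordinate within `T * f`, provided the axis
  -- has one at all. The scale `f` is kept while trimming, so a free cube of this side has to
  -- survive every cut.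
  have key : ∀ (e : ℕ) {n : ℕ} (I : ItemSet n)
      (obs : Finset (Cuboid d)) (pos : Fin n → Fin d → ℝ) (T : ℕ), 0 < T → obs.card ≤ q →
      ∀ (R : Cuboid d) (S : Finset (Fin n)) (f : ℝ) (F : Finset (Fin d × Bool)), F.card ≤ e →
      R.complexity obs ≤ M → I.PackedIn S pos R → I.Avoids S pos obs →
      0 < f → (∀ i ∈ S, I.size i ≤ f) →
      (∃ Z : Cuboid d, (∀ k, Z.side k = f) ∧ Z.Within R ∧ ∀ o ∈ obs, Z.Sep o) →
      (∀ k, (k, false) ∉ F → (R.inner obs k).Nonempty → ∃ a ∈ R.inner obs k,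
        a - R.lower k ≤ T * f) →
      (∀ k, (k, true) ∉ F → (R.inner obs k).Nonempty → ∃ a ∈ R.inner obs k,
        R.lower k + R.side k - a ≤ T * f) →
      I.Decomp obs pos (3 * T) R S (e * C + (2 * C + 1)) ((L + 1 + e : ℕ) / T) := by
    intro e
    induction e with
    | zero =>
      intro n I obs pos T hT hq R S f F hF hM hpack hav hf hsize hcube hlow hup
      have hF : F = ∅ := by simpa using hF
      subst hF
      have hT' : (0 : ℝ) < T := by exact_mod_cast hT
      by_cases hgood : ∀ k, R.side k ≤ 3 * T * f ∨ R.inner obs k = ∅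
      · exact GoodCell.decomp ⟨hpack, hf, hsize, hcube, hgood⟩ (by omega) (by positivity)
      push Not at hgood
      obtain ⟨k, hk, hne⟩ := hgood
      obtain ⟨a1, ha1, ha1'⟩ := hlow k (by simp) hne
      obtain ⟨a2, ha2, ha2'⟩ := hup k (by simp) hne
      -- The side exceeds `3 * T * f`, and facet coordinates lie within `T * f` of both faces, so
      -- two of them are more than `T * f` apart. A cheap plane between these two takes a coordinate
      -- away from either piece.
      have hgap : ∃ a ∈ R.inner obs k, ∃ b ∈ R.inner obs k, T * f < b - a := by
        by_contra! hcon
        linarith [hcon a1 ha1 a2 ha2]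
      obtain ⟨a, ha, b, hb, hab⟩ := hgap
      obtain ⟨t, ht⟩ := I.exists_cheap_cut S pos hsize k hT (fun t : Fin T => a + (t + 1 : ℕ) * f)
        (fun s t hst => by
          have : ((s : ℕ) : ℝ) + 1 ≤ (t : ℕ) := by exact_mod_cast hst
          rw [le_abs]
          right
          push_cast
          nlinarith)
      set x : ℝ := a + (t + 1 : ℕ) * f with hxdef
      have hta : a < x := by
        have : (0 : ℝ) < (t + 1 : ℕ) * f := by positivity
        linarith
      have htb : x < b := by
        have : ((t + 1 : ℕ) : ℝ) ≤ T := by exact_mod_cast t.2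
        nlinarith
      have ha' := Cuboid.mem_inner.1 ha
      have hb' := Cuboid.mem_inner.1 hb
      have hx1 : R.lower k < x := ha'.2.1.trans hta
      have hx2 : x < R.lower k + R.side k := htb.trans hb'.2.2
      have h1 := hCL I obs pos T hT hq (R.cutBelow k x hx1)
        (S.filter fun i => pos i k + I.size i ≤ x)
        (lt_of_lt_of_le (Cuboid.complexity_lt (x := b) (k := k)
          (fun l => by rw [Cuboid.inner_cutBelow hx1 hx2.le]; exact Finset.filter_subset _ _) hb
          (by rw [Cuboid.inner_cutBelow hx1 hx2.le, Finset.mem_filter]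
              exact fun h => absurd (h.2 rfl) (not_lt.2 htb.le))) hM)
        ⟨fun i hi => Cuboid.within_cutBelow hx1 (hpack.within i (Finset.mem_filter.1 hi).1)
          (Finset.mem_filter.1 hi).2, (hpack.mono (Finset.filter_subset _ _)).sep⟩
        (hav.mono (Finset.filter_subset _ _))
      have h2 := hCL I obs pos T hT hq (R.cutAbove k x hx2)
        (S.filter fun i => x ≤ pos i k)
        (lt_of_lt_of_le (Cuboid.complexity_lt (x := a) (k := k)
          (fun l => by rw [Cuboid.inner_cutAbove hx2 hx1.le]; exact Finset.filter_subset _ _) ha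
          (by rw [Cuboid.inner_cutAbove hx2 hx1.le, Finset.mem_filter]
              exact fun h => absurd (h.2 rfl) (not_lt.2 hta.le))) hM)
        ⟨fun i hi => Cuboid.within_cutAbove hx2 (hpack.within i (Finset.mem_filter.1 hi).1)
          (Finset.mem_filter.1 hi).2, (hpack.mono (Finset.filter_subset _ _)).sep⟩
        (hav.mono (Finset.filter_subset _ _))
      refine (Decomp.of_cut hx1 hx2 (by positivity) (σ := 1 / T) ?_ h1 h2).mono (by omega) ?_
      · rw [one_div_mul_eq_div, le_div_iff₀ hT']
        exact ht
      · push_cast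
        rw [← add_div, add_zero]
    | succ e ihe =>
      intro n I obs pos T hT hq R S f F hF hM hpack hav hf hsize hcube hlow hup
      have hT' : (0 : ℝ) < T := by exact_mod_cast hT
      have hmono : ∀ {R' : Cuboid d} {S' : Finset (Fin n)},
          I.Decomp obs pos (3 * T) R' S' (e * C + (2 * C + 1)) ((L + 1 + e : ℕ) / T) →
          I.Decomp obs pos (3 * T) R' S' ((e + 1) * C + (2 * C + 1))
            ((L + 1 + (e + 1) : ℕ) / T) := fun h =>
        h.mono (by ring_nf; omega) (by
          refine div_le_div_of_nonneg_right ?_ hT'.le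
          exact_mod_cast (by omega))
      rcases F.eq_empty_or_nonempty with rfl | ⟨⟨k, b⟩, hkb⟩
      · exact hmono (ihe I obs pos T hT hq R S f ∅ (by simp) hM hpack hav hf hsize hcube hlow hup)
      have hFe : (F.erase (k, b)).card ≤ e := by
        rw [Finset.card_erase_of_mem hkb]; omega
      have hnot : ∀ l b', (l, b') ∉ F.erase (k, b) → (l, b') ≠ (k, b) → (l, b') ∉ F :=
        fun l b' h hne h' => h (Finset.mem_erase.2 ⟨hne, h'⟩)
      cases b with
      | true =>
        by_cases htrim : (R.inner obs k).Nonempty → ∃ a ∈ R.inner obs k,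
            R.lower k + R.side k - a ≤ T * f
        · refine hmono (ihe I obs pos T hT hq R S f _ hFe hM hpack hav hf hsize hcube
            (fun l hl => hlow l (hnot _ _ hl (by simp))) fun l hl => ?_)
          by_cases hlk : l = k
          · subst hlk; exact htrim
          · exact hup l (hnot _ _ hl (by simp [hlk]))
        push Not at htrim
        obtain ⟨hne, hbig⟩ := htrim
        -- All facet coordinates are far from the upper face, so a cheap cut is made shortly beyond
        -- the last one. The lower piece keeps every coordinate and a free cube, and its new upper
        -- face is trimmed. The upper piece loses `a` and is handled by the induction on complexity.
        obtain ⟨a, ha, hmax⟩ := Finset.exists_max_image (R.inner obs k) id hne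
        have hbig := hbig a ha
        obtain ⟨t, ht⟩ := I.exists_cheap_cut S pos hsize k hT
          (fun t : Fin T => a + (t + 1 : ℕ) * f) (fun s t hst => by
            have : ((s : ℕ) : ℝ) + 1 ≤ (t : ℕ) := by exact_mod_cast hst
            rw [le_abs]
            right
            push_cast
            nlinarith)
        set x : ℝ := a + (t + 1 : ℕ) * f with hxdef
        have htT : ((t + 1 : ℕ) : ℝ) ≤ T := by exact_mod_cast t.2
        have ht1 : (1 : ℝ) ≤ (t + 1 : ℕ) := by exact_mod_cast Nat.succ_pos _
        have hta : a + f ≤ x := by nlinarith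
        have htx : x - a ≤ T * f := by
          rw [hxdef, add_sub_cancel_left]
          exact mul_le_mul_of_nonneg_right htT hf.le
        have ha' := Cuboid.mem_inner.1 ha
        have hx1 : R.lower k < x := by linarith [ha'.2.1]
        have hx2 : x < R.lower k + R.side k := by linarith
        have hin : ∀ l, (R.cutBelow k x hx1).inner obs l = R.inner obs l := fun l => by
          rw [Cuboid.inner_cutBelow hx1 hx2.le, Finset.filter_eq_self]
          rintro y hy rfl
          have : y ≤ a := hmax y hy
          linarith
        obtain ⟨Z, hZ, hZR, hZo⟩ := hcube
        have h1 := ihe I obs pos T hT hq (R.cutBelow k x hx1)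
          (S.filter fun i => pos i k + I.size i ≤ x) f _ hFe
          (by simpa only [Cuboid.complexity, hin] using hM)
          ⟨fun i hi => Cuboid.within_cutBelow hx1 (hpack.within i (Finset.mem_filter.1 hi).1)
            (Finset.mem_filter.1 hi).2, (hpack.mono (Finset.filter_subset _ _)).sep⟩
          (hav.mono (Finset.filter_subset _ _)) hf
          (fun i hi => hsize i (Finset.mem_filter.1 hi).1)
          (Cuboid.exists_cube_cutBelow hZ hZR hZo ha'.2.1.le hmax hta hx1)
          (fun l hl => by rw [hin]; exact hlow l (hnot _ _ hl (by simp)))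
          (fun l hl => by
            rw [hin]
            by_cases hlk : l = k
            · subst hlk
              intro _
              exact ⟨a, ha, by simpa [Cuboid.cutBelow] using htx⟩
            · simpa [Cuboid.cutBelow, hlk] using hup l (hnot _ _ hl (by simp [hlk])))
        have h2 := hCL I obs pos T hT hq (R.cutAbove k x hx2)
          (S.filter fun i => x ≤ pos i k)
          (lt_of_lt_of_le (Cuboid.complexity_lt (x := a) (k := k)
            (fun l => by rw [Cuboid.inner_cutAbove hx2 hx1.le]; exact Finset.filter_subset _ _) ha
            (by rw [Cuboid.inner_cutAbove hx2 hx1.le, Finset.mem_filter]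
                exact fun h => absurd (h.2 rfl) (not_lt.2 (by linarith)))) hM)
          ⟨fun i hi => Cuboid.within_cutAbove hx2 (hpack.within i (Finset.mem_filter.1 hi).1)
            (Finset.mem_filter.1 hi).2, (hpack.mono (Finset.filter_subset _ _)).sep⟩
          (hav.mono (Finset.filter_subset _ _))
        have h2' := h2.mono le_rfl (ρ' := (L + 1 + e : ℕ) / T)
          (div_le_div_of_nonneg_right (by exact_mod_cast (by omega)) hT'.le)
        refine (Decomp.of_cut hx1 hx2 (by positivity) (σ := 1 / T) ?_ h1 h2').mono
          (by ring_nf; omega) ?_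
        · rw [one_div_mul_eq_div, le_div_iff₀ hT']
          exact ht
        · push_cast
          rw [← add_div, add_assoc (_ + _) (e : ℝ) 1]
      | false =>
        by_cases htrim : (R.inner obs k).Nonempty → ∃ a ∈ R.inner obs k,
            a - R.lower k ≤ T * f
        · refine hmono (ihe I obs pos T hT hq R S f _ hFe hM hpack hav hf hsize hcube
            (fun l hl => ?_) fun l hl => hup l (hnot _ _ hl (by simp)))
          by_cases hlk : l = k
          · subst hlk; exact htrim
          · exact hlow l (hnot _ _ hl (by simp [hlk]))
        push Not at htrim
        obtain ⟨hne, hbig⟩ := htrim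
        obtain ⟨a, ha, hmin⟩ := Finset.exists_min_image (R.inner obs k) id hne
        have hbig := hbig a ha
        obtain ⟨t, ht⟩ := I.exists_cheap_cut S pos hsize k hT
          (fun t : Fin T => a - (t + 1 : ℕ) * f) (fun s t hst => by
            have : ((s : ℕ) : ℝ) + 1 ≤ (t : ℕ) := by exact_mod_cast hst
            rw [le_abs]
            left
            push_cast
            nlinarith)
        set x : ℝ := a - (t + 1 : ℕ) * f with hxdef
        have htT : ((t + 1 : ℕ) : ℝ) ≤ T := by exact_mod_cast t.2
        have ht1 : (1 : ℝ) ≤ (t + 1 : ℕ) := by exact_mod_cast Nat.succ_pos _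
        have hta : x ≤ a - f := by nlinarith
        have htx : a - x ≤ T * f := by
          rw [hxdef, sub_sub_cancel]
          exact mul_le_mul_of_nonneg_right htT hf.le
        have ha' := Cuboid.mem_inner.1 ha
        have hx1 : R.lower k < x := by linarith
        have hx2 : x < R.lower k + R.side k := by linarith [ha'.2.2]
        have hin : ∀ l, (R.cutAbove k x hx2).inner obs l = R.inner obs l := fun l => by
          rw [Cuboid.inner_cutAbove hx2 hx1.le, Finset.filter_eq_self]
          rintro y hy rfl
          have : a ≤ y := hmin y hy
          linarith
        obtain ⟨Z, hZ, hZR, hZo⟩ := hcube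
        have h1 := ihe I obs pos T hT hq (R.cutAbove k x hx2)
          (S.filter fun i => x ≤ pos i k) f _ hFe
          (by simpa only [Cuboid.complexity, hin] using hM)
          ⟨fun i hi => Cuboid.within_cutAbove hx2 (hpack.within i (Finset.mem_filter.1 hi).1)
            (Finset.mem_filter.1 hi).2, (hpack.mono (Finset.filter_subset _ _)).sep⟩
          (hav.mono (Finset.filter_subset _ _)) hf
          (fun i hi => hsize i (Finset.mem_filter.1 hi).1)
          (Cuboid.exists_cube_cutAbove hZ hZR hZo ha'.2.2.le hmin hta hx2)
          (fun l hl => by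
            rw [hin]
            by_cases hlk : l = k
            · subst hlk
              intro _
              exact ⟨a, ha, by simpa [Cuboid.cutAbove] using htx⟩
            · simpa [Cuboid.cutAbove, hlk] using hlow l (hnot _ _ hl (by simp [hlk])))
          (fun l hl => by
            rw [hin]
            have := hup l (hnot _ _ hl (by simp))
            by_cases hlk : l = k
            · subst hlk
              simpa [Cuboid.cutAbove] using this
            · simpa [Cuboid.cutAbove, hlk] using this)
        have h2 := hCL I obs pos T hT hq (R.cutBelow k x hx1)
          (S.filter fun i => pos i k + I.size i ≤ x)
          (lt_of_lt_of_le (Cuboid.complexity_lt (x := a) (k := k)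
            (fun l => by rw [Cuboid.inner_cutBelow hx1 hx2.le]; exact Finset.filter_subset _ _) ha
            (by rw [Cuboid.inner_cutBelow hx1 hx2.le, Finset.mem_filter]
                exact fun h => absurd (h.2 rfl) (not_lt.2 (by linarith)))) hM)
          ⟨fun i hi => Cuboid.within_cutBelow hx1 (hpack.within i (Finset.mem_filter.1 hi).1)
            (Finset.mem_filter.1 hi).2, (hpack.mono (Finset.filter_subset _ _)).sep⟩
          (hav.mono (Finset.filter_subset _ _))
        have h2' := h2.mono le_rfl (ρ' := (L + 1 + e : ℕ) / T)
          (div_le_div_of_nonneg_right (by exact_mod_cast (by omega)) hT'.le)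
        refine (Decomp.of_cut hx1 hx2 (by positivity) (σ := 1 / T) ?_ h2' h1).mono
          (by ring_nf; omega) ?_
        · rw [one_div_mul_eq_div, le_div_iff₀ hT']
          exact ht
        · push_cast
          rw [← add_div, add_assoc (_ + _) (e : ℝ) 1]
  -- At most `2d` trims, each splitting off one simpler region, and then at most one cut into two
  -- simpler regions. Every cut adds `1 / T` to the loss.
  refine ⟨d * 2 * C + (2 * C + 1), L + 1 + d * 2, ?_⟩
  intro n I obs pos T hT hq R S hM hpack hav
  rcases S.eq_empty_or_nonempty with rfl | hne
  · exact Decomp.empty I obs pos _ R _ _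
  -- The scale is the size of the largest item, whose own cube serves as the free cube.
  obtain ⟨i, hi, hmax⟩ := Finset.exists_max_image S I.size hne
  refine key (d * 2) I obs pos T hT hq R S (I.size i) Finset.univ ?_ hM hpack hav (I.size_pos i)
    hmax ⟨I.cubeAt i (pos i), fun _ => rfl, hpack.within i hi, hav i hi⟩
    (fun k hk => absurd (Finset.mem_univ _) hk) fun k hk => absurd (Finset.mem_univ _) hk
  rw [Finset.card_univ, Fintype.card_prod, Fintype.card_fin, Fintype.card_bool]

end ItemSet

/-! ### Linear grouping and assignment to slots -/

/-- The `b` largest elements of a finite set. -/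
theorem exists_top_subset {ι : Type*} (s : ι → ℝ) (Y : Finset ι) :
    ∀ b : ℕ, b ≤ Y.card → ∃ T ⊆ Y, T.card = b ∧ ∀ i ∈ T, ∀ j ∈ Y, j ∉ T → s j ≤ s i := by
  classical
  intro b
  induction b with
  | zero => exact fun _ => ⟨∅, by simp⟩
  | succ b ih =>
    intro hb
    obtain ⟨T, hTY, hT, hmax⟩ := ih (by omega)
    have hne : (Y \ T).Nonempty := by
      rw [← Finset.card_pos, Finset.card_sdiff_of_subset hTY]
      omega
    obtain ⟨x, hx, hxmax⟩ := Finset.exists_max_image (Y \ T) s hne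
    have hx' := Finset.mem_sdiff.1 hx
    refine ⟨insert x T, Finset.insert_subset hx'.1 hTY, by
      rw [Finset.card_insert_of_notMem hx'.2, hT], ?_⟩
    intro i hi j hj hjT
    rw [Finset.mem_insert, not_or] at hjT
    rcases Finset.mem_insert.1 hi with rfl | hi
    · exact hxmax j (Finset.mem_sdiff.2 ⟨hj, hjT.2⟩)
    · exact hmax i hi j hj hjT.2

/-- Linear grouping: the elements are divided into `g` classes of decreasing values, such that
class `γ` consists of values at least `σ γ`, and class `γ + 1` of at most as many values at most
`σ γ`. -/
theorem exists_linear_grouping {ι : Type*} (s : ι → ℝ) {m : ℝ} (b : ℕ) :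
    ∀ (g : ℕ) (Y : Finset ι), (∀ i ∈ Y, m ≤ s i) → Y.card ≤ g * b →
      ∃ (cls : ι → ℕ) (σ : ℕ → ℝ), (∀ i ∈ Y, cls i < g) ∧
        (Y.filter fun i => cls i = 0).card ≤ b ∧
        (∀ γ, (Y.filter fun i => cls i = γ + 1).card ≤ (Y.filter fun i => cls i = γ).card) ∧
        (∀ i ∈ Y, σ (cls i) ≤ s i) ∧ (∀ i ∈ Y, ∀ γ, cls i = γ + 1 → s i ≤ σ γ) ∧
        ∀ γ, m ≤ σ γ := by
  classical
  intro g
  induction g with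
  | zero =>
    intro Y _ hY
    have : Y = ∅ := by simpa using hY
    subst this
    exact ⟨fun _ => 0, fun _ => m, by simp⟩
  | succ g ih =>
    intro Y hm hY
    by_cases hle : Y.card ≤ b
    · refine ⟨fun _ => 0, fun _ => m, fun _ _ => Nat.succ_pos _, ?_, ?_, hm, ?_, fun _ => le_rfl⟩
      · exact (Finset.card_filter_le _ _).trans hle
      · intro γ
        simp
      · intro i _ γ h
        exact absurd h (by simp)
    push Not at hle
    obtain ⟨T, hTY, hT, hmax⟩ := exists_top_subset s Y b hle.le
    have hcard : (Y \ T).card = Y.card - b := by rw [Finset.card_sdiff_of_subset hTY, hT]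
    have hne : (Y \ T).Nonempty := by
      rw [← Finset.card_pos, hcard]
      omega
    obtain ⟨x, hx, hxmax⟩ := Finset.exists_max_image (Y \ T) s hne
    have hx' := Finset.mem_sdiff.1 hx
    obtain ⟨cls, σ, h1, h2, h3, h4, h5, h6⟩ := ih (Y \ T)
      (fun i hi => hm i (Finset.mem_sdiff.1 hi).1) (by
        rw [hcard]
        have : (g + 1) * b = g * b + b := by ring
        omega)
    have hfil : ∀ γ, (Y.filter fun i => (if i ∈ T then 0 else cls i + 1) = γ + 1) =
        (Y \ T).filter fun i => cls i = γ := by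
      intro γ
      ext i
      simp only [Finset.mem_filter, Finset.mem_sdiff]
      by_cases hi : i ∈ T <;> simp [hi]
    have hfil0 : (Y.filter fun i => (if i ∈ T then 0 else cls i + 1) = 0) = T := by
      ext i
      simp only [Finset.mem_filter]
      by_cases hi : i ∈ T
      · simp [hi, hTY hi]
      · simp [hi]
    -- Class 0 consists of the `b` largest values, and its threshold `s x` is the largest value of
    -- the rest. The last class has no successor, so the lower bound `m` serves as its threshold.
    refine ⟨fun i => if i ∈ T then 0 else cls i + 1, fun γ => γ.casesOn (s x) σ, ?_, ?_, ?_, ?_, ?_,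
      ?_⟩
    · intro i hi
      by_cases hiT : i ∈ T
      · simp [hiT]
      · have := h1 i (Finset.mem_sdiff.2 ⟨hi, hiT⟩)
        simp only [hiT, if_false]
        omega
    · rw [hfil0, hT]
    · intro γ
      rw [hfil]
      cases γ with
      | zero => rw [hfil0, hT]; exact h2
      | succ γ => rw [hfil]; exact h3 γ
    · intro i hi
      by_cases hiT : i ∈ T
      · simpa [hiT] using hmax i hiT x hx'.1 hx'.2
      · simpa [hiT] using h4 i (Finset.mem_sdiff.2 ⟨hi, hiT⟩)
    · intro i hi γ hγ
      by_cases hiT : i ∈ T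
      · simp [hiT] at hγ
      · have hi' := Finset.mem_sdiff.2 ⟨hi, hiT⟩
        simp only [hiT, if_false, Nat.add_right_cancel_iff] at hγ
        cases γ with
        | zero => exact hxmax i hi'
        | succ γ => exact h5 i hi' γ hγ
    · intro γ
      cases γ with
      | zero => exact hm x hx'.1
      | succ γ => exact h6 γ

/-- Distribution of elements to bins with prescribed capacities. -/
theorem exists_assignment_card_le {ι β : Type*} [DecidableEq β] (S : Finset ι) (Bn : Finset β)
    (cap : β → ℕ) (h : S.card ≤ ∑ b ∈ Bn, cap b) :
    ∃ a : ι → Option β, (∀ i ∈ S, ∃ b ∈ Bn, a i = some b) ∧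
      ∀ b ∈ Bn, (S.filter fun i => a i = some b).card ≤ cap b := by
  classical
  induction S using Finset.induction_on with
  | empty => exact ⟨fun _ => none, by simp⟩
  | insert x S hx ih =>
    rw [Finset.card_insert_of_notMem hx] at h
    obtain ⟨a, ha, hb⟩ := ih (by omega)
    have : ∃ b ∈ Bn, (S.filter fun i => a i = some b).card < cap b := by
      by_contra! hcon
      have h1 := Finset.sum_le_sum hcon
      have h2 : ∑ b ∈ Bn, (S.filter fun i => a i = some b).card ≤ S.card := by
        rw [← Finset.card_biUnion]
        · exact Finset.card_le_card (Finset.biUnion_subset.2 fun b _ => Finset.filter_subset _ _)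
        · intro b _ c _ hbc
          rw [Function.onFun, Finset.disjoint_left]
          intro i hi hi'
          have e1 := (Finset.mem_filter.1 hi).2
          rw [(Finset.mem_filter.1 hi').2] at e1
          exact hbc (by simpa using e1.symm)
      omega
    obtain ⟨b0, hb0, hlt⟩ := this
    have hupd : ∀ i ∈ S, Function.update a x (some b0) i = a i := fun i hi =>
      Function.update_of_ne (ne_of_mem_of_not_mem hi hx) _ _
    refine ⟨Function.update a x (some b0), ?_, ?_⟩
    · intro i hi
      rcases Finset.mem_insert.1 hi with rfl | hi
      · exact ⟨b0, hb0, by simp⟩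
      · rw [hupd i hi]; exact ha i hi
    · intro b hbB
      rw [Finset.filter_insert]
      have hcong : S.filter (fun i => Function.update a x (some b0) i = some b)
          = S.filter (fun i => a i = some b) :=
        Finset.filter_congr fun i hi => by rw [hupd i hi]
      rw [hcong]
      split_ifs with hif
      · have hbb : b0 = b := by simpa using hif
        subst hbb
        rw [Finset.card_insert_of_notMem (by simp [hx])]
        omega
      · exact hb b hbB

/-- Disjoint intervals of prescribed lengths. -/
theorem exists_disjoint_intervals {α : Type*} [DecidableEq α] (A : Finset α) (m : α → ℕ) :
    ∃ st : α → ℕ, (∀ a ∈ A, st a + m a ≤ ∑ b ∈ A, m b) ∧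
      ∀ a ∈ A, ∀ b ∈ A, a ≠ b → st a + m a ≤ st b ∨ st b + m b ≤ st a := by
  induction A using Finset.induction_on with
  | empty => exact ⟨fun _ => 0, by simp⟩
  | insert x A hx ih =>
    obtain ⟨st, h1, h2⟩ := ih
    have hupd : ∀ a ∈ A, Function.update st x (∑ b ∈ A, m b) a = st a := fun a ha =>
      Function.update_of_ne (ne_of_mem_of_not_mem ha hx) _ _
    refine ⟨Function.update st x (∑ b ∈ A, m b), ?_, ?_⟩
    · intro a ha
      rw [Finset.sum_insert hx]
      rcases Finset.mem_insert.1 ha with rfl | ha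
      · simp [add_comm]
      · rw [hupd a ha]
        have := h1 a ha
        omega
    · intro a ha b hb hab
      rcases Finset.mem_insert.1 ha with rfl | ha' <;>
        rcases Finset.mem_insert.1 hb with rfl | hb'
      · exact absurd rfl hab
      · right
        rw [hupd b hb', Function.update_self]
        exact h1 b hb'
      · left
        rw [hupd a ha', Function.update_self]
        exact h1 a ha'
      · rw [hupd a ha', hupd b hb']
        exact h2 a ha' b hb' hab

/-! ### Grids along unobstructed axes -/

namespace Cuboid

variable {d : ℕ}

/-- Without facets of obstacles inside `R` along axis `k`, separation along this axis is shared by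
all parts of `R`. -/
theorem sep_of_inner_eq_empty {A B R o : Cuboid d} {obs : Finset (Cuboid d)} {k : Fin d}
    (hk : R.inner obs k = ∅) (ho : o ∈ obs) (hA : A.Within R) (hB : B.Within R)
    (h : A.lower k + A.side k ≤ o.lower k ∨ o.lower k + o.side k ≤ A.lower k) : B.Sep o := by
  have h1 := hA k
  have h2 := hB k
  have h3 := A.side_pos k
  refine ⟨k, ?_⟩
  rcases h with h | h
  · left
    by_contra! hcon
    have : o.lower k ∈ R.inner obs k :=
      mem_inner.2 ⟨⟨o, ho, Or.inl rfl⟩, by linarith, by linarith⟩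
    simp [hk] at this
  · right
    by_contra! hcon
    have : o.lower k + o.side k ∈ R.inner obs k :=
      mem_inner.2 ⟨⟨o, ho, Or.inr rfl⟩, by linarith, by linarith⟩
    simp [hk] at this

theorem mem_halfOpen_congr_of_inner_eq_empty {R o : Cuboid d} {obs : Finset (Cuboid d)} {k : Fin d}
    (hk : R.inner obs k = ∅) (ho : o ∈ obs) {x y : ℝ}
    (hx : R.lower k ≤ x ∧ x < R.lower k + R.side k)
    (hy : R.lower k ≤ y ∧ y < R.lower k + R.side k)
    (h : o.lower k ≤ x ∧ x < o.lower k + o.side k) :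
    o.lower k ≤ y ∧ y < o.lower k + o.side k := by
  constructor
  · by_contra! hcon
    have : o.lower k ∈ R.inner obs k :=
      mem_inner.2 ⟨⟨o, ho, Or.inl rfl⟩, by linarith, by linarith⟩
    simp [hk] at this
  · by_contra! hcon
    have : o.lower k + o.side k ∈ R.inner obs k :=
      mem_inner.2 ⟨⟨o, ho, Or.inr rfl⟩, by linarith, by linarith⟩
    simp [hk] at this

/-- The translation from cell `i` to cell `j` moves only along axes without inner facets, where no
point of `R` enters or leaves an obstacle. It therefore maps the free part of one cell into that of
the other. -/
theorem volume_free_gridCell_le (R : Cuboid d) (obs : Finset (Cuboid d)) (N : Fin d → ℕ)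
    (hN : ∀ k, N k = 1 ∨ R.inner obs k = ∅) (i j : ∀ k, Fin (N k)) :
    volume.real ((R.gridCell N i).free obs) ≤ volume.real ((R.gridCell N j).free obs) := by
  set v : Fin d → ℝ := (R.gridCell N j).lower - (R.gridCell N i).lower with hv
  have hsub : (R.gridCell N i).free obs ⊆ (fun x => x + v) ⁻¹' (R.gridCell N j).free obs := by
    intro x hx
    have hxi := mem_halfOpen.1 hx.1
    have hxj : x + v ∈ (R.gridCell N j).halfOpen := by
      rw [mem_halfOpen]
      intro k
      have := hxi k
      simp only [hv, Pi.add_apply, Pi.sub_apply]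
      have hs : (R.gridCell N j).side k = (R.gridCell N i).side k := rfl
      constructor <;> linarith [this.1, this.2]
    refine ⟨hxj, ?_⟩
    intro hmem
    obtain ⟨o, ho, hox⟩ := Set.mem_iUnion₂.1 hmem
    refine hx.2 (Set.mem_iUnion₂.2 ⟨o, ho, ?_⟩)
    rw [mem_halfOpen] at hox ⊢
    have hxR := mem_halfOpen.1 ((R.gridCell_within N i).subset hx.1)
    have hxR' := mem_halfOpen.1 ((R.gridCell_within N j).subset hxj)
    intro k
    rcases hN k with h1 | hk
    · have hij : i k = j k := by
        have h2 := (i k).2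
        have h3 := (j k).2
        exact Fin.ext (by omega)
      have : (x + v) k = x k := by
        simp [hv, gridCell, hij]
      have h4 : o.lower k ≤ (x + v) k ∧ (x + v) k < o.lower k + o.side k := hox k
      rwa [this] at h4
    · exact mem_halfOpen_congr_of_inner_eq_empty hk ho (hxR' k) (hxR k) (hox k)
  refine (measureReal_mono hsub ?_).trans (le_of_eq ?_)
  · rw [measure_preimage_add_right]
    exact volume_free_ne_top _ _
  · rw [Measure.real, measure_preimage_add_right, Measure.real]

/-- All cells of a grid have the same free volume if no facet of an obstacle is inside `R` along
the subdivided axes. -/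
theorem prod_mul_volume_free_gridCell_le (R : Cuboid d) (obs : Finset (Cuboid d)) (N : Fin d → ℕ)
    (hN : ∀ k, N k = 1 ∨ R.inner obs k = ∅) (i : ∀ k, Fin (N k)) :
    (∏ k, (N k : ℝ)) * volume.real ((R.gridCell N i).free obs) ≤ volume.real (R.free obs) := by
  have h1 : (∏ k, (N k : ℝ)) * volume.real ((R.gridCell N i).free obs) ≤
      ∑ j : ∀ k, Fin (N k), volume.real ((R.gridCell N j).free obs) := by
    have h2 := Finset.sum_le_sum fun (j : ∀ k, Fin (N k)) (_ : j ∈ Finset.univ) =>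
      R.volume_free_gridCell_le obs N hN i j
    rw [Finset.sum_const, Finset.card_univ, nsmul_eq_mul] at h2
    have h3 : (Fintype.card (∀ k, Fin (N k)) : ℝ) = ∏ k, (N k : ℝ) := by
      rw [Fintype.card_pi]
      push_cast
      simp
    rwa [h3] at h2
  refine h1.trans ?_
  rw [← measureReal_biUnion_finset (fun a _ b _ hab => ?_) (fun a _ => measurableSet_free _ _)
    (fun a _ => volume_free_ne_top _ _)]
  · refine measureReal_mono (Set.iUnion₂_subset fun j _ x hx => ⟨?_, hx.2⟩)
      (volume_free_ne_top _ _)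
    exact (R.gridCell_within N j).subset hx.1
  · exact (R.gridCell_sep N hab).disjoint.mono Set.sdiff_subset Set.sdiff_subset

-- Turning boxes into obstacles costs at most their volume; this measures the room left for tiny
-- items.
open Classical in
theorem volume_free_union_ge (R : Cuboid d) (obs : Finset (Cuboid d)) {β : Type*} [Fintype β]
    (B : β → Cuboid d) :
    volume.real (R.free obs) - ∑ j, (B j).vol ≤
      volume.real (R.free (obs ∪ Finset.univ.image B)) := by
  have hsub : R.free obs ⊆ R.free (obs ∪ Finset.univ.image B) ∪
      ⋃ j ∈ Finset.univ, (B j).halfOpen := by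
    intro x hx
    by_cases hxB : ∃ j, x ∈ (B j).halfOpen
    · obtain ⟨j, hj⟩ := hxB
      exact Or.inr (Set.mem_iUnion₂.2 ⟨j, Finset.mem_univ j, hj⟩)
    · refine Or.inl ⟨hx.1, fun hmem => ?_⟩
      obtain ⟨o, ho, hox⟩ := Set.mem_iUnion₂.1 hmem
      rcases Finset.mem_union.1 ho with ho | ho
      · exact hx.2 (Set.mem_iUnion₂.2 ⟨o, ho, hox⟩)
      · obtain ⟨j, -, rfl⟩ := Finset.mem_image.1 ho
        exact hxB ⟨j, hox⟩
  have hfin : volume (⋃ j ∈ (Finset.univ : Finset β), (B j).halfOpen) ≠ ⊤ := by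
    refine ne_of_lt ((measure_biUnion_finset_le _ _).trans_lt ?_)
    exact ENNReal.sum_lt_top.2 fun j _ => (volume_halfOpen_ne_top _).lt_top
  have h1 := (measureReal_mono hsub
    (measure_union_ne_top (volume_free_ne_top _ _) hfin)).trans (measureReal_union_le _ _)
  have h2 : volume.real (⋃ j ∈ (Finset.univ : Finset β), (B j).halfOpen) ≤ ∑ j, (B j).vol := by
    refine (measureReal_biUnion_finset_le _ _).trans (le_of_eq ?_)
    exact Finset.sum_congr rfl fun j _ => (B j).volume_real_halfOpen
  linarith

end Cuboid

namespace ItemSet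

variable {n d : ℕ}

/-- The items that are inside no cell of a grid have small total volume. -/
theorem totalVol_crossing_le (I : ItemSet n) {S : Finset (Fin n)} {pos : Fin n → Fin d → ℝ}
    {R : Cuboid d} (hpack : I.PackedIn S pos R) {f : ℝ} (hf : 0 < f) (hsize : ∀ i ∈ S, I.size i ≤ f)
    (N : Fin d → ℕ) (hN : ∀ k, 0 < N k)
    (hcross : ∀ i ∈ S, ∀ j, ¬ (I.cubeAt i (pos i)).Within (R.gridCell N j)) :
    I.totalVol d S ≤ ∑ k, ((N k : ℝ) - 1) * (2 * f / R.side k) * R.vol := by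
  classical
  -- Slabs of thickness `2 * f` around the interior grid planes. An item inside no cell straddles
  -- such a plane and, having size at most `f`, lies in its slab.
  set W : (k : Fin d) → ℕ → Cuboid d := fun k t =>
    ⟨Function.update R.lower k (R.lower k + (t + 1) * (R.side k / N k) - f),
      Function.update R.side k (2 * f), fun l => by
        by_cases hl : l = k
        · subst hl; simpa using hf
        · simpa [hl] using R.side_pos l⟩ with hW
  have hWvol : ∀ k t, (W k t).vol = 2 * f / R.side k * R.vol := by
    intro k t
    rw [Cuboid.vol, Cuboid.vol, ← Finset.mul_prod_erase _ _ (Finset.mem_univ k),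
      ← Finset.mul_prod_erase Finset.univ R.side (Finset.mem_univ k)]
    have h1 : ∏ l ∈ Finset.univ.erase k, (W k t).side l = ∏ l ∈ Finset.univ.erase k, R.side l :=
      Finset.prod_congr rfl fun l hl => by simp [hW, Finset.ne_of_mem_erase hl]
    have h2 : (W k t).side k = 2 * f := by simp [hW]
    have h3 := R.side_pos k
    rw [h1, h2]
    field_simp
  have hsub : ∀ i ∈ S, (I.cubeAt i (pos i)).halfOpen ⊆
      ⋃ p ∈ (Finset.univ : Finset (Fin d)).sigma fun k => Finset.range (N k - 1),
        (W p.1 p.2).halfOpen := by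
    intro i hi
    have hwi := hpack.within i hi
    have hsi := I.size_pos i
    obtain ⟨j, hj⟩ := R.exists_mem_gridCell N hN (x := pos i) (by
      rw [Cuboid.mem_halfOpen]
      intro k
      have := hwi k
      simp only [cubeAt] at this
      exact ⟨this.1, by linarith [this.2]⟩)
    rw [Cuboid.mem_halfOpen] at hj
    have hex : ∃ k, (R.gridCell N j).lower k + (R.gridCell N j).side k < pos i k + I.size i := by
      by_contra! hcon
      exact hcross i hi j fun k => ⟨(hj k).1, hcon k⟩
    obtain ⟨k, hk⟩ := hex
    have hNk : (0 : ℝ) < N k := by exact_mod_cast hN k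
    have hjk := hj k
    have hup := (hwi k).2
    simp only [cubeAt, Cuboid.gridCell] at hk hjk hup
    set lam := R.side k / N k with hlam
    have hlam0 : 0 < lam := div_pos (R.side_pos k) hNk
    have hside : R.side k = N k * lam := by rw [hlam]; field_simp
    have hlt : (j k : ℕ) < N k - 1 := by
      have h1 : ((j k : ℕ) : ℝ) + 1 < N k := by
        by_contra! hcon
        nlinarith
      have : (j k : ℕ) + 1 < N k := by exact_mod_cast h1
      omega
    refine fun x hx => Set.mem_iUnion₂.2 ⟨⟨k, j k⟩, by simpa using hlt, ?_⟩
    rw [Cuboid.mem_halfOpen] at hx ⊢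
    intro l
    have hxl := hx l
    have hwl := hwi l
    simp only [cubeAt] at hxl hwl
    by_cases hl : l = k
    · subst hl
      have hs := hsize i hi
      simp only [hW, Function.update_self]
      constructor <;> nlinarith [hxl.1, hxl.2]
    · simp only [hW, Function.update_of_ne hl]
      exact ⟨by linarith [hxl.1, hwl.1], by linarith [hxl.2, hwl.2]⟩
  refine (I.totalVol_le_volume hpack.sep ?_ hsub).trans
    ((measureReal_biUnion_finset_le _ _).trans (le_of_eq ?_))
  · refine ne_of_lt ((measure_biUnion_finset_le _ _).trans_lt ?_)
    exact ENNReal.sum_lt_top.2 fun j _ => (Cuboid.volume_halfOpen_ne_top _).lt_top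
  · rw [Finset.sum_sigma]
    refine Finset.sum_congr rfl fun k _ => ?_
    simp only [Cuboid.volume_real_halfOpen, hWvol, Finset.sum_const, Finset.card_range,
      nsmul_eq_mul]
    rw [Nat.cast_sub (hN k)]
    push_cast
    ring

open Classical in
/-- Adding boxes to a family that avoids them. -/
theorem BoxFam.extend {I : ItemSet n} {R : Cuboid d} {obs : Finset (Cuboid d)}
    {β : Type} [Fintype β] {B : β → Cuboid d} {A : β → Finset (Fin n)} {Q : Finset (Fin n)} {C : ℕ}
    (hB : ∀ j, (B j).Within R) (hBo : ∀ j, ∀ o ∈ obs, (B j).Sep o)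
    (hBB : ∀ j k, j ≠ k → (B j).Sep (B k)) (hA : ∀ j k, j ≠ k → Disjoint (A j) (A k))
    (hfill : ∀ j, I.Filled (B j) (A j)) (hAQ : ∀ j, Disjoint (A j) Q)
    (h : I.BoxFam R (obs ∪ Finset.univ.image B) Q C) :
    I.BoxFam R obs (Finset.univ.biUnion A ∪ Q) (Fintype.card β + C) := by
  obtain ⟨β', _, B', A', h1, h2, h3, h4, h5, h6, h7⟩ := h
  have hsub : ∀ j, A' j ⊆ Q := fun j => by
    rw [h6]; exact Finset.subset_biUnion_of_mem A' (Finset.mem_univ j)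
  have hsep : ∀ j k, (B' j).Sep (B k) := fun j k =>
    h3 j (B k) (Finset.mem_union_right _ (Finset.mem_image_of_mem B (Finset.mem_univ k)))
  refine ⟨β ⊕ β', inferInstance, Sum.elim B B', Sum.elim A A', ?_, ?_, ?_, ?_, ?_, ?_, ?_⟩
  · rw [Fintype.card_sum]; omega
  · rintro (j | j)
    · exact hB j
    · exact h2 j
  · rintro (j | j) o ho
    · exact hBo j o ho
    · exact h3 j o (Finset.mem_union_left _ ho)
  · rintro (i | i) (j | j) hij
    · exact hBB i j fun h => hij (by rw [h])
    · exact (hsep j i).symm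
    · exact hsep i j
    · exact h4 i j fun h => hij (by rw [h])
  · rintro (i | i) (j | j) hij
    · exact hA i j fun h => hij (by rw [h])
    · exact (hAQ i).mono_right (hsub j)
    · exact ((hAQ j).mono_right (hsub i)).symm
    · exact h5 i j fun h => hij (by rw [h])
  · ext i
    rw [h6]
    simp
  · rintro (j | j)
    · exact hfill j
    · exact h7 j

end ItemSet

theorem exists_representatives {α τ : Type*} [DecidableEq α] [Fintype τ] (U : Finset α)
    (typ : α → τ) : ∃ ρ : α → α, (∀ u ∈ U, ρ u ∈ U ∧ typ (ρ u) = typ u) ∧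
      (U.image ρ).card ≤ Fintype.card τ := by
  classical
  rcases U.eq_empty_or_nonempty with rfl | ⟨u0, hu0⟩
  · exact ⟨id, by simp⟩
  set r : τ → α := fun t => if h : ∃ v ∈ U, typ v = t then h.choose else u0 with hr
  refine ⟨fun u => r (typ u), fun u hu => ?_, ?_⟩
  · have h : ∃ v ∈ U, typ v = typ u := ⟨u, hu, rfl⟩
    simp only [hr, dif_pos h]
    exact h.choose_spec
  · refine (Finset.card_le_card (t := Finset.univ.image r) ?_).trans
      (Finset.card_image_le.trans (le_of_eq Finset.card_univ))
    intro a ha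
    obtain ⟨u, -, rfl⟩ := Finset.mem_image.1 ha
    exact Finset.mem_image_of_mem r (Finset.mem_univ _)

/-! ### Merging cells with the same numbers of items of every class -/

namespace ItemSet

variable {n d : ℕ}

open Classical in
set_option maxHeartbeats 1600000 in
/-- Cells with equal numbers of items of every class are merged: each slot of a representative cell
becomes a box for as many items as there are cells, up to rounding. -/
theorem boxFam_of_linear_grouping {I : ItemSet n} {R : Cuboid d} {obs : Finset (Cuboid d)}
    {N : Fin d → ℕ} (hN0 : ∀ k, 0 < N k) (hN : ∀ k, N k = 1 ∨ R.inner obs k = ∅)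
    {d0 : Fin d} (hd0 : R.inner obs d0 = ∅) {f : ℝ} (hf : 0 < f)
    {Z : Cuboid d} (hZ : ∀ k, Z.side k = f) (hZR : Z.Within R) (hZo : ∀ o ∈ obs, Z.Sep o)
    {pos : Fin n → Fin d → ℝ} {Y X S : Finset (Fin n)}
    {cell : Fin n → ∀ k, Fin (N k)} {U : Finset (∀ k, Fin (N k))}
    (hcellU : ∀ i ∈ Y, cell i ∈ U)
    (hcell : ∀ i ∈ Y, (I.cubeAt i (pos i)).Within (R.gridCell N (cell i)))
    (hsepY : ∀ i ∈ Y, ∀ j ∈ Y, i ≠ j → (I.cubeAt i (pos i)).Sep (I.cubeAt j (pos j)))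
    (havY : I.Avoids Y pos obs)
    {g qu : ℕ} {cls : Fin n → ℕ} {σ : ℕ → ℝ} (hσ0 : ∀ γ, 0 < σ γ)
    (hcls : ∀ i ∈ Y, cls i < g)
    (hclass : ∀ γ, (Y.filter fun i => cls i = γ + 1).card ≤ (Y.filter fun i => cls i = γ).card)
    (hσle : ∀ i ∈ Y, σ (cls i) ≤ I.size i)
    (hσge : ∀ i ∈ Y, ∀ γ, cls i = γ + 1 → I.size i ≤ σ γ)
    (hqu : ∀ u, (Y.filter fun i => cell i = u).card ≤ qu)
    {fu : ℝ} (hfu : ∀ u, I.totalVol d (Y.filter fun i => cell i = u) ≤ fu)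
    {h : ℕ} (hlayers : U.card + (qu + 1) ^ g * ∏ k ∈ Finset.univ.erase d0, N k +
      h * ∏ k ∈ Finset.univ.erase d0, N k ≤ (∏ k ∈ Finset.univ.erase d0, N k) * N d0)
    {cap : Fin d → ℕ} (hcap0 : ∀ k, 0 < cap k) (hcapd : cap d0 * f ≤ h * (R.side d0 / N d0))
    (hcapk : ∀ k, k ≠ d0 → cap k = 1 ∨ (R.inner obs k = ∅ ∧ cap k * f ≤ R.side k))
    (hcount : X.card + (Y.filter fun i => cls i = 0).card ≤ ∏ k, cap k)
    (hYf : ∀ i ∈ Y, I.size i ≤ f) (hXf : ∀ i ∈ X, I.size i ≤ f)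
    (hYX : Disjoint Y X) (hYS : Disjoint Y S) (hXS : Disjoint X S) {C : ℕ} {η : ℝ}
    (hE : ∀ obs' : Finset (Cuboid d), obs'.card ≤ obs.card + ((qu + 1) ^ g * qu + 1) →
      I.totalVol d S ≤ volume.real (R.free obs') - η * R.vol → I.BoxFam R obs' S C)
    (hvol : I.totalVol d S ≤ volume.real (R.free obs) - I.totalVol d Y -
      (∏ k ∈ Finset.univ.erase d0, N k : ℕ) * ((qu + 1) ^ g : ℕ) * fu -
      (∏ k, cap k : ℕ) * f ^ d - η * R.vol) :
    I.BoxFam R obs (Y ∪ X ∪ S) ((qu + 1) ^ g * qu + 1 + C) := by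
  set P : ℕ := ∏ k ∈ Finset.univ.erase d0, N k with hP
  have hP0 : 0 < P := Finset.prod_pos fun k _ => hN0 k
  set lam : Fin d → ℝ := fun k => R.side k / N k with hlam
  have hNr : ∀ k, (0 : ℝ) < N k := fun k => by exact_mod_cast hN0 k
  have hlam0 : ∀ k, 0 < lam k := fun k => div_pos (R.side_pos k) (hNr k)
  have hside : ∀ k, R.side k = N k * lam k := fun k => by
    have := (hNr k).ne'
    simp only [hlam]; field_simp
  -- types of cells and representatives
  set typ : (∀ k, Fin (N k)) → Fin g → Fin (qu + 1) := fun u γ =>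
    ⟨(Y.filter fun i => cell i = u ∧ cls i = γ).card, Nat.lt_succ_of_le
      ((Finset.card_le_card (Finset.monotone_filter_right Y fun i _ hi => hi.1)).trans (hqu u))⟩
    with htyp
  obtain ⟨ρ, hρ, hρcard⟩ := exists_representatives U typ
  rw [Fintype.card_pi_const, Fintype.card_fin] at hρcard
  set Reps := U.image ρ with hReps
  have hρR : ∀ u ∈ U, ρ u ∈ Reps := fun u hu => Finset.mem_image_of_mem ρ hu
  set cnt : (∀ k, Fin (N k)) → ℕ := fun u => (U.filter fun v => ρ v = u).card with hcnt
  -- A layer orthogonal to `d0` has `P` cells. The cells represented by `u` are replaced by `m u`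
  -- full layers, which exceed them by at most one layer.
  set m : (∀ k, Fin (N k)) → ℕ := fun u => cnt u / P + 1 with hm
  have hm1 : ∀ u, cnt u ≤ m u * P := fun u => by
    have h1 := Nat.div_add_mod (cnt u) P
    have h2 := Nat.mod_lt (cnt u) hP0
    simp only [hm]
    nlinarith
  have hm2 : ∀ u, m u * P ≤ cnt u + P := fun u => by
    have h1 := Nat.div_mul_le_self (cnt u) P
    simp only [hm]
    nlinarith
  have hcntsum : ∑ u ∈ Reps, cnt u = U.card :=
    (Finset.card_eq_sum_card_fiberwise hρR).symm
  set H := ∑ u ∈ Reps, m u with hH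
  have hHh : H + h ≤ N d0 := by
    have h1 : H * P ≤ U.card + (qu + 1) ^ g * P := by
      rw [hH, Finset.sum_mul, ← hcntsum]
      refine (Finset.sum_le_sum fun u _ => hm2 u).trans ?_
      rw [Finset.sum_add_distrib, Finset.sum_const, smul_eq_mul]
      exact Nat.add_le_add_left (Nat.mul_le_mul_right _ hρcard) _
    refine Nat.le_of_mul_le_mul_left ?_ hP0
    nlinarith
  have hHhr : (H : ℝ) + h ≤ N d0 := by exact_mod_cast hHh
  obtain ⟨st, hst1, hst2⟩ := exists_disjoint_intervals Reps m
  -- the boxes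
  set w : Fin n → Fin d → ℝ := fun i k => pos i k - (R.gridCell N (cell i)).lower k with hw
  have hwY : ∀ i ∈ Y, ∀ k, 0 ≤ w i k ∧ w i k + I.size i ≤ lam k := by
    intro i hi k
    have := hcell i hi k
    simp only [cubeAt, Cuboid.gridCell] at this
    simp only [hw, Cuboid.gridCell]
    constructor <;> linarith [this.1, this.2]
  -- The representative cell is stretched linearly over its slab, by `m` along `d0` and by `N k`
  -- along the other axes, which keeps the slots separated. Each slot is first shrunk to side `σ
  -- (cls i)`, so that its image has sides that are integral multiples of it.
  set mult : Fin n → Fin d → ℕ := fun i k => if k = d0 then m (cell i) else N k with hmult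
  have hmult0 : ∀ i k, 0 < mult i k := fun i k => by
    simp only [hmult]
    split_ifs
    · exact Nat.succ_pos _
    · exact hN0 k
  have hmultr : ∀ i k, (0 : ℝ) < mult i k := fun i k => by exact_mod_cast hmult0 i k
  set Bx : Fin n → Cuboid d := fun i =>
    ⟨fun k => R.lower k + (if k = d0 then st (cell i) * lam d0 else 0) + mult i k * w i k,
      fun k => mult i k * σ (cls i), fun k => mul_pos (hmultr i k) (hσ0 _)⟩ with hBx
  set W : Finset (Fin n) := Y.filter fun i => cell i ∈ Reps with hW
  have hWY : ∀ i ∈ W, i ∈ Y := fun i hi => (Finset.mem_filter.1 hi).1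
  have hWR : ∀ i ∈ W, cell i ∈ Reps := fun i hi => (Finset.mem_filter.1 hi).2
  have hBxd : ∀ i ∈ W, R.lower d0 + st (cell i) * lam d0 ≤ (Bx i).lower d0 ∧
      (Bx i).lower d0 + (Bx i).side d0 ≤ R.lower d0 + (st (cell i) + m (cell i) : ℕ) * lam d0 := by
    intro i hi
    have h1 := hwY i (hWY i hi) d0
    have h2 := hσle i (hWY i hi)
    have h3 := hmultr i d0
    have h4 : mult i d0 = m (cell i) := by simp [hmult]
    simp only [hBx, if_true]
    rw [h4] at h3 ⊢
    push_cast
    constructor <;> nlinarith [h1.1, h1.2]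
  have hBxk : ∀ i ∈ W, ∀ k, k ≠ d0 → R.lower k ≤ (Bx i).lower k ∧
      (Bx i).lower k + (Bx i).side k ≤ R.lower k + R.side k := by
    intro i hi k hk
    have h1 := hwY i (hWY i hi) k
    have h2 := hσle i (hWY i hi)
    have h3 := hNr k
    have h4 : mult i k = N k := by simp [hmult, hk]
    simp only [hBx, hk, if_false, hside k, h4]
    constructor <;> nlinarith [h1.1, h1.2]
  have hstH : ∀ i ∈ W, ((st (cell i) + m (cell i) : ℕ) : ℝ) ≤ H := fun i hi => by
    exact_mod_cast hst1 _ (hWR i hi)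
  have hBxtop : ∀ i ∈ W, (Bx i).lower d0 + (Bx i).side d0 ≤ R.lower d0 + H * lam d0 :=
    fun i hi => (hBxd i hi).2.trans
      (add_le_add_right (mul_le_mul_of_nonneg_right (hstH i hi) (hlam0 d0).le) _)
  have hBxR : ∀ i ∈ W, (Bx i).Within R := by
    intro i hi k
    by_cases hk : k = d0
    · subst hk
      have h1 := hBxd i hi
      have h2 := hBxtop i hi
      have h3 : (0 : ℝ) ≤ st (cell i) * lam k := mul_nonneg (Nat.cast_nonneg _) (hlam0 k).le
      have h4 : (0 : ℝ) ≤ h := Nat.cast_nonneg _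
      rw [hside k]
      constructor
      · linarith [h1.1]
      · nlinarith [hlam0 k]
    · exact hBxk i hi k hk
  have hBxo : ∀ i ∈ W, ∀ o ∈ obs, (Bx i).Sep o := by
    intro i hi o ho
    obtain ⟨k, hk⟩ := havY i (hWY i hi) o ho
    by_cases hin : R.inner obs k = ∅
    · exact Cuboid.sep_of_inner_eq_empty hin ho
        ((hcell i (hWY i hi)).trans (R.gridCell_within N _)) (hBxR i hi) hk
    -- On an obstructed axis nothing is subdivided or stretched, so the box stays inside the
    -- interval of the original item.
    · have hN1 := (hN k).resolve_right hin
      have hkd : k ≠ d0 := fun h => hin (h ▸ hd0)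
      have hc0 : ((cell i k : ℕ) : ℝ) = 0 := by
        have := (cell i k).2
        exact_mod_cast (by omega : (cell i k : ℕ) = 0)
      have h2 := hσle i (hWY i hi)
      refine ⟨k, ?_⟩
      simp only [cubeAt] at hk
      simp only [hBx, hkd, if_false, hmult, hN1, hw, Cuboid.gridCell, hc0]
      push_cast
      rcases hk with hk | hk
      · left; linarith
      · right; linarith
  have hBxBx : ∀ i ∈ W, ∀ j ∈ W, i ≠ j → (Bx i).Sep (Bx j) := by
    intro i hi j hj hij
    by_cases hc : cell i = cell j
    · obtain ⟨k, hk⟩ := hsepY i (hWY i hi) j (hWY j hj) hij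
      refine ⟨k, ?_⟩
      have hmij : mult i k = mult j k := by simp [hmult, hc]
      have h2 := hσle i (hWY i hi)
      have h3 := hσle j (hWY j hj)
      have h4 := hmultr j k
      simp only [cubeAt] at hk
      simp only [hBx, hw, hc, hmij]
      rcases hk with hk | hk
      · left; nlinarith
      · right; nlinarith
    · refine ⟨d0, ?_⟩
      have h1 := hBxd i hi
      have h2 := hBxd j hj
      rcases hst2 _ (hWR i hi) _ (hWR j hj) hc with h3 | h3
      · left
        have h4 : ((st (cell i) + m (cell i) : ℕ) : ℝ) ≤ st (cell j) := by exact_mod_cast h3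
        linarith [mul_le_mul_of_nonneg_right h4 (hlam0 d0).le, h1.2, h2.1]
      · right
        have h4 : ((st (cell j) + m (cell j) : ℕ) : ℝ) ≤ st (cell i) := by exact_mod_cast h3
        linarith [mul_le_mul_of_nonneg_right h4 (hlam0 d0).le, h1.1, h2.2]
  -- the box for the remaining large items
  set Bs : Cuboid d := ⟨fun k => if k = d0 then R.lower d0 + H * lam d0 else
      if cap k = 1 then Z.lower k else R.lower k, fun k => cap k * f,
      fun k => mul_pos (by exact_mod_cast hcap0 k) hf⟩ with hBs
  have hBsR : Bs.Within R := by
    intro k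
    by_cases hk : k = d0
    · subst hk
      have h4 : (0 : ℝ) ≤ H := Nat.cast_nonneg _
      simp only [hBs, if_true]
      rw [hside k]
      constructor <;> nlinarith [hlam0 k]
    · simp only [hBs, hk, if_false]
      by_cases hc : cap k = 1
      · have := hZR k
        rw [hZ k] at this
        simpa [hc] using this
      · simpa [hc] using ((hcapk k hk).resolve_left hc).2
  have hBso : ∀ o ∈ obs, Bs.Sep o := by
    intro o ho
    obtain ⟨k, hk⟩ := hZo o ho
    by_cases hin : R.inner obs k = ∅
    · exact Cuboid.sep_of_inner_eq_empty hin ho hZR hBsR hk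
    · have hkd : k ≠ d0 := fun h => hin (h ▸ hd0)
      have hc : cap k = 1 := (hcapk k hkd).resolve_right fun h => hin h.1
      refine ⟨k, ?_⟩
      rw [hZ k] at hk
      simpa [hBs, hkd, hc] using hk
  have hBxBs : ∀ i ∈ W, (Bx i).Sep Bs := fun i hi =>
    ⟨d0, Or.inl (by simpa [hBs] using hBxtop i hi)⟩
  -- the contents
  have hprodmult : ∀ i, ∏ k, mult i k = m (cell i) * P := by
    intro i
    rw [← Finset.mul_prod_erase _ _ (Finset.mem_univ d0)]
    congr 1
    · simp [hmult]
    · exact Finset.prod_congr rfl fun k hk => by simp [hmult, Finset.ne_of_mem_erase hk]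
  have htypeq : ∀ v ∈ U, ∀ γ < g, (Y.filter fun i => cell i = v ∧ cls i = γ).card =
      (Y.filter fun i => cell i = ρ v ∧ cls i = γ).card := by
    intro v hv γ hγ
    have := congrFun (hρ v hv).2 ⟨γ, hγ⟩
    simp only [htyp, Fin.mk.injEq] at this
    exact this.symm
  -- A slot in the representative cell `u` stands for one slot in each of `cnt u` cells and offers
  -- `m u * P ≥ cnt u` places. The slots of class `γ` thus have room for as many items as class `γ`
  -- has, hence for class `γ + 1`.
  have hcapacity : ∀ γ, (Y.filter fun i => cls i = γ + 1).card ≤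
      ∑ i ∈ W.filter (fun i => cls i = γ), ∏ k, mult i k := by
    intro γ
    refine (hclass γ).trans ?_
    by_cases hγ : γ < g
    swap
    · have : (Y.filter fun i => cls i = γ) = ∅ :=
        Finset.filter_eq_empty_iff.2 fun i hi h => hγ (h ▸ hcls i hi)
      simp [this]
    have h1 : (Y.filter fun i => cls i = γ).card =
        ∑ v ∈ U, (Y.filter fun i => cell i = v ∧ cls i = γ).card := by
      rw [Finset.card_eq_sum_card_fiberwise (f := cell) (t := U)
        fun i hi => hcellU i (Finset.mem_filter.1 hi).1]
      refine Finset.sum_congr rfl fun v _ => ?_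
      rw [Finset.filter_filter]
      congr 1
      exact Finset.filter_congr fun i _ => and_comm
    have h2 : ∑ v ∈ U, (Y.filter fun i => cell i = v ∧ cls i = γ).card =
        ∑ u ∈ Reps, cnt u * (Y.filter fun i => cell i = u ∧ cls i = γ).card := by
      rw [← Finset.sum_fiberwise_of_maps_to hρR]
      refine Finset.sum_congr rfl fun u _ => ?_
      rw [hcnt, ← smul_eq_mul, ← Finset.sum_const]
      refine Finset.sum_congr rfl fun v hv => ?_
      rw [htypeq v (Finset.mem_filter.1 hv).1 γ hγ, (Finset.mem_filter.1 hv).2]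
    have h3 : ∑ i ∈ W.filter (fun i => cls i = γ), ∏ k, mult i k =
        ∑ u ∈ Reps, m u * P * (Y.filter fun i => cell i = u ∧ cls i = γ).card := by
      rw [← Finset.sum_fiberwise_of_maps_to (g := cell) (t := Reps)
        fun i hi => hWR i (Finset.mem_filter.1 hi).1]
      refine Finset.sum_congr rfl fun u hu => ?_
      have h4 : (W.filter (fun i => cls i = γ)).filter (fun i => cell i = u) =
          Y.filter fun i => cell i = u ∧ cls i = γ := by
        ext i
        simp only [hW, Finset.mem_filter]
        constructor
        · rintro ⟨⟨⟨a, -⟩, b⟩, c⟩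
          exact ⟨a, c, b⟩
        · rintro ⟨a, c, b⟩
          exact ⟨⟨⟨a, c ▸ hu⟩, b⟩, c⟩
      rw [h4, mul_comm, ← smul_eq_mul, ← Finset.sum_const]
      refine Finset.sum_congr rfl fun i hi => ?_
      rw [hprodmult, (Finset.mem_filter.1 hi).2.1]
    rw [h1, h2, h3]
    exact Finset.sum_le_sum fun u _ => Nat.mul_le_mul_right _ (hm1 u)
  choose a ha1 ha2 using fun γ => exists_assignment_card_le (Y.filter fun i => cls i = γ + 1)
    (W.filter fun i => cls i = γ) (fun i => ∏ k, mult i k) (hcapacity γ)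
  -- `none` is the extra box; it takes class 0, which has no preceding class to provide slots, and
  -- the items of `X`.
  set A : Option W → Finset (Fin n) := fun o => o.elim
    (X ∪ Y.filter fun i => cls i = 0)
    fun i => (Y.filter fun j => cls j = cls i + 1).filter fun j => a (cls i) j = some (i : Fin n)
    with hA
  set B : Option W → Cuboid d := fun o => o.elim Bs fun i => Bx i with hB
  have hAsub : ∀ i : W, A (some i) ⊆ Y := fun i =>
    (Finset.filter_subset _ _).trans (Finset.filter_subset _ _)
  have hAnone : ∀ i : W, Disjoint (A (some i)) (A none) := by
    intro i
    rw [Finset.disjoint_left]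
    intro j hj hj'
    rcases Finset.mem_union.1 hj' with hj' | hj'
    · exact Finset.disjoint_left.1 hYX (hAsub i hj) hj'
    · have h1 := (Finset.mem_filter.1 (Finset.mem_filter.1 hj).1).2
      rw [(Finset.mem_filter.1 hj').2] at h1
      omega
  have hunion : Finset.univ.biUnion A = Y ∪ X := by
    ext j
    simp only [Finset.mem_biUnion, Finset.mem_univ, true_and, Finset.mem_union]
    constructor
    · rintro ⟨(_ | i), hj⟩
      · rcases Finset.mem_union.1 hj with hj | hj
        · exact Or.inr hj
        · exact Or.inl (Finset.mem_filter.1 hj).1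
      · exact Or.inl (hAsub i hj)
    · rintro (hj | hj)
      · rcases Nat.eq_zero_or_pos (cls j) with h0 | h0
        · exact ⟨none, Finset.mem_union_right _ (Finset.mem_filter.2 ⟨hj, h0⟩)⟩
        · obtain ⟨γ, hγ⟩ : ∃ γ, cls j = γ + 1 := ⟨cls j - 1, by omega⟩
          have hj1 : j ∈ Y.filter fun i => cls i = γ + 1 := Finset.mem_filter.2 ⟨hj, hγ⟩
          obtain ⟨i, hi, hai⟩ := ha1 γ j hj1
          have hi' := Finset.mem_filter.1 hi
          refine ⟨some ⟨i, hi'.1⟩, ?_⟩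
          simp only [hA, Option.elim, Finset.mem_filter, hi'.2]
          exact ⟨⟨hj, hγ⟩, hai⟩
      · exact ⟨none, Finset.mem_union_left _ hj⟩
  have hWcard : W.card ≤ (qu + 1) ^ g * qu := by
    rw [Finset.card_eq_sum_card_fiberwise hWR]
    refine (Finset.sum_le_sum fun u hu => (Finset.card_le_card ?_).trans (hqu u)).trans ?_
    · exact Finset.filter_subset_filter _ (Finset.filter_subset _ _)
    · rw [Finset.sum_const, smul_eq_mul]
      exact Nat.mul_le_mul_right _ hρcard
  have hcardopt : Fintype.card (Option W) ≤ (qu + 1) ^ g * qu + 1 := by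
    rw [Fintype.card_option, Fintype.card_coe]
    omega
  -- the volume of the boxes
  have hsv : ∀ v ∈ U, ∑ i ∈ Y.filter (fun i => cell i = v), σ (cls i) ^ d =
      ∑ i ∈ Y.filter (fun i => cell i = ρ v), σ (cls i) ^ d := by
    have h1 : ∀ v, ∑ i ∈ Y.filter (fun i => cell i = v), σ (cls i) ^ d =
        ∑ γ ∈ Finset.range g,
          ((Y.filter fun i => cell i = v ∧ cls i = γ).card : ℝ) * σ γ ^ d := by
      intro v
      rw [← Finset.sum_fiberwise_of_maps_to (g := cls) (t := Finset.range g)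
        fun i hi => Finset.mem_range.2 (hcls i (Finset.mem_filter.1 hi).1)]
      refine Finset.sum_congr rfl fun γ _ => ?_
      rw [Finset.filter_filter, ← nsmul_eq_mul, ← Finset.sum_const]
      refine Finset.sum_congr rfl fun i hi => ?_
      rw [(Finset.mem_filter.1 hi).2.2]
    intro v hv
    rw [h1, h1]
    refine Finset.sum_congr rfl fun γ hγ => ?_
    rw [htypeq v hv γ (Finset.mem_range.1 hγ)]
  have hslot : ∀ u, ∑ i ∈ Y.filter (fun i => cell i = u), σ (cls i) ^ d ≤ fu := by
    intro u
    refine le_trans (Finset.sum_le_sum fun i hi => ?_) (hfu u)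
    exact pow_le_pow_left₀ (hσ0 _).le (hσle i (Finset.mem_filter.1 hi).1) d
  -- The `cnt` parts of the multiplicities add up to at most the volume of `Y`; rounding up to full
  -- layers costs at most `P * fu` per type.
  have hBxvol : ∑ i ∈ W, (Bx i).vol ≤ I.totalVol d Y + P * ((qu + 1) ^ g : ℕ) * fu := by
    have h1 : ∑ i ∈ W, (Bx i).vol =
        ∑ u ∈ Reps, ((m u * P : ℕ) : ℝ) * ∑ i ∈ Y.filter (fun i => cell i = u), σ (cls i) ^ d := by
      rw [← Finset.sum_fiberwise_of_maps_to hWR]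
      refine Finset.sum_congr rfl fun u hu => ?_
      have h4 : W.filter (fun i => cell i = u) = Y.filter fun i => cell i = u := by
        ext i
        simp only [hW, Finset.mem_filter]
        constructor
        · rintro ⟨⟨a, -⟩, c⟩
          exact ⟨a, c⟩
        · rintro ⟨a, c⟩
          exact ⟨⟨a, c ▸ hu⟩, c⟩
      rw [h4, Finset.mul_sum]
      refine Finset.sum_congr rfl fun i hi => ?_
      have h5 := hprodmult i
      rw [(Finset.mem_filter.1 hi).2] at h5
      rw [← h5, Cuboid.vol]
      simp only [hBx, Finset.prod_mul_distrib, Finset.prod_const, Finset.card_univ,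
        Fintype.card_fin]
      push_cast
      rfl
    have h2 : ∑ u ∈ Reps, (cnt u : ℝ) * ∑ i ∈ Y.filter (fun i => cell i = u), σ (cls i) ^ d =
        ∑ i ∈ Y, σ (cls i) ^ d := by
      rw [← Finset.sum_fiberwise_of_maps_to hcellU, ← Finset.sum_fiberwise_of_maps_to hρR]
      refine Finset.sum_congr rfl fun u _ => ?_
      rw [hcnt, ← nsmul_eq_mul, ← Finset.sum_const]
      refine Finset.sum_congr rfl fun v hv => ?_
      rw [hsv v (Finset.mem_filter.1 hv).1, (Finset.mem_filter.1 hv).2]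
    have h3 : ∑ i ∈ Y, σ (cls i) ^ d ≤ I.totalVol d Y :=
      Finset.sum_le_sum fun i hi => pow_le_pow_left₀ (hσ0 _).le (hσle i hi) d
    have h0 : ∀ u, 0 ≤ ∑ i ∈ Y.filter (fun i => cell i = u), σ (cls i) ^ d := fun u =>
      Finset.sum_nonneg fun i _ => (pow_pos (hσ0 _) d).le
    have h4 : ∑ u ∈ Reps, (P : ℝ) * ∑ i ∈ Y.filter (fun i => cell i = u), σ (cls i) ^ d ≤
        P * ((qu + 1) ^ g : ℕ) * fu := by
      rw [← Finset.mul_sum, mul_assoc]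
      refine mul_le_mul_of_nonneg_left ?_ (Nat.cast_nonneg _)
      refine (Finset.sum_le_sum fun u _ => hslot u).trans ?_
      rw [Finset.sum_const, nsmul_eq_mul]
      refine mul_le_mul_of_nonneg_right (by exact_mod_cast hρcard) ?_
      by_cases hU : Nonempty (∀ k, Fin (N k))
      · exact (h0 hU.some).trans (hslot _)
      · exact absurd ⟨fun k => ⟨0, hN0 k⟩⟩ hU
    rw [h1]
    refine le_trans (Finset.sum_le_sum (g := fun u => (cnt u : ℝ) *
      ∑ i ∈ Y.filter (fun i => cell i = u), σ (cls i) ^ d + P *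
      ∑ i ∈ Y.filter (fun i => cell i = u), σ (cls i) ^ d) fun u _ => ?_) ?_
    · rw [← add_mul]
      refine mul_le_mul_of_nonneg_right ?_ (h0 u)
      exact_mod_cast hm2 u
    · rw [Finset.sum_add_distrib, h2]
      linarith
  have hBvol : ∑ o, (B o).vol ≤ I.totalVol d Y + P * ((qu + 1) ^ g : ℕ) * fu +
      (∏ k, cap k : ℕ) * f ^ d := by
    rw [Fintype.sum_option]
    have h1 : Bs.vol = (∏ k, cap k : ℕ) * f ^ d := by
      simp [hBs, Cuboid.vol, Finset.prod_mul_distrib]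
    have h2 : ∑ i : W, (B (some i)).vol = ∑ i ∈ W, (Bx i).vol := by
      rw [← Finset.sum_coe_sort W]
      rfl
    have h3 : (B none).vol = Bs.vol := rfl
    rw [h2, h3, h1]
    linarith
  have hfam : I.BoxFam R (obs ∪ Finset.univ.image B) S C := by
    refine hE _ ?_ ?_
    · refine (Finset.card_union_le _ _).trans (Nat.add_le_add_left ?_ _)
      exact Finset.card_image_le.trans (by rw [Finset.card_univ]; exact hcardopt)
    · have := R.volume_free_union_ge obs B
      linarith
  have hfinal := BoxFam.extend (B := B) (A := A) ?_ ?_ ?_ ?_ ?_ ?_ hfam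
  · rw [hunion] at hfinal
    exact hfinal.mono (Nat.add_le_add_right hcardopt _)
  · rintro (_ | i)
    · exact hBsR
    · exact hBxR i i.2
  · rintro (_ | i)
    · exact hBso
    · exact hBxo i i.2
  · rintro (_ | i) (_ | j) hij
    · exact absurd rfl hij
    · exact (hBxBs j j.2).symm
    · exact hBxBs i i.2
    · exact hBxBx i i.2 j j.2 fun h => hij (by rw [Subtype.ext h])
  · rintro (_ | i) (_ | j) hij
    · exact absurd rfl hij
    · exact (hAnone j).symm
    · exact hAnone i
    · rw [Finset.disjoint_left]
      intro x hx hx'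
      have h1 := Finset.mem_filter.1 hx
      have h2 := Finset.mem_filter.1 hx'
      have h3 := (Finset.mem_filter.1 h1.1).2
      rw [(Finset.mem_filter.1 h2.1).2] at h3
      have h4 : cls (i : Fin n) = cls (j : Fin n) := by omega
      have h5 := h1.2
      rw [h4, h2.2] at h5
      exact hij (by rw [Subtype.ext (Option.some.inj h5)])
  · rintro (_ | i)
    · refine FitsScale.filled_of_card_le (shat := f) (m := cap)
        ⟨hf, ?_, hcap0, fun k => rfl⟩ ((Finset.card_union_le _ _).trans hcount)
      intro i hi
      rcases Finset.mem_union.1 hi with hi | hi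
      · exact hXf i hi
      · exact hYf i (Finset.mem_filter.1 hi).1
    · refine FitsScale.filled_of_card_le (shat := σ (cls i)) (m := mult i)
        ⟨hσ0 _, ?_, hmult0 i, fun k => rfl⟩ (ha2 (cls i) i (Finset.mem_filter.2 ⟨i.2, rfl⟩))
      intro j hj
      have h1 := Finset.mem_filter.1 (Finset.mem_filter.1 hj).1
      exact hσge j h1.1 _ h1.2
  · rintro (_ | i)
    · refine Finset.disjoint_union_left.2 ⟨hXS, hYS.mono_left (Finset.filter_subset _ _)⟩
    · exact hYS.mono_left (hAsub i)

end ItemSet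

/-! ### Long cells with a gap between tiny and large items -/

theorem half_le_floor {x : ℝ} (hx : 1 ≤ x) : x / 2 ≤ ⌊x⌋₊ := by
  have h1 := Nat.lt_floor_add_one x
  have h2 : (1 : ℝ) ≤ ⌊x⌋₊ := by exact_mod_cast Nat.le_floor (by exact_mod_cast hx)
  linarith

theorem prod_floor_bounds {d : ℕ} (x : Fin d → ℝ) (hx : ∀ k, 1 ≤ x k) :
    (∏ k, x k) / 2 ^ d ≤ (∏ k, ⌊x k⌋₊ : ℕ) ∧ ((∏ k, ⌊x k⌋₊ : ℕ) : ℝ) ≤ ∏ k, x k := by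
  push_cast
  constructor
  · have : (∏ k, x k) / 2 ^ d = ∏ k, x k / 2 := by simp [Finset.prod_div_distrib]
    rw [this]
    exact Finset.prod_le_prod (fun k _ => by linarith [hx k]) fun k _ => half_le_floor (hx k)
  · exact Finset.prod_le_prod (fun k _ => Nat.cast_nonneg _) fun k _ =>
      Nat.floor_le (by linarith [hx k])

namespace Cuboid

variable {d : ℕ}

theorem vol_le_of_short {R : Cuboid d} {f c : ℝ} (hf : 0 < f) (hc : 1 ≤ c) {Lg : Finset (Fin d)}
    (hside : ∀ k, k ∉ Lg → R.side k ≤ c * f) :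
    R.vol ≤ c ^ d * (f ^ d * ∏ k, if k ∈ Lg then R.side k / f else 1) := by
  have h : c ^ d * (f ^ d * ∏ k, if k ∈ Lg then R.side k / f else 1) =
      ∏ k, c * (f * if k ∈ Lg then R.side k / f else 1) := by
    rw [Finset.prod_mul_distrib, Finset.prod_mul_distrib, Finset.prod_const, Finset.prod_const,
      Finset.card_univ, Fintype.card_fin]
  rw [h, vol]
  refine Finset.prod_le_prod (fun k _ => (R.side_pos k).le) fun k _ => ?_
  have := R.side_pos k
  split_ifs with hk
  · rw [mul_div_cancel₀ _ hf.ne']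
    nlinarith
  · simpa using hside k hk

/-- Stretched over the whole of `R` along axes without inner facets, the free cube stays free. With
`vol_le_of_short` this makes the free part at least a fraction `1 / c ^ d` of `R`. -/
theorem le_volume_free {R Z : Cuboid d} {obs : Finset (Cuboid d)} {f : ℝ} (hf : 0 < f)
    {Lg : Finset (Fin d)} (hin : ∀ k ∈ Lg, R.inner obs k = ∅)
    (hZ : ∀ k, Z.side k = f) (hZR : Z.Within R) (hZo : ∀ o ∈ obs, Z.Sep o) :
    f ^ d * ∏ k, (if k ∈ Lg then R.side k / f else 1) ≤ volume.real (R.free obs) := by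
  classical
  set Z' : Cuboid d := ⟨fun k => if k ∈ Lg then R.lower k else Z.lower k,
    fun k => if k ∈ Lg then R.side k else f, fun k => by
      split_ifs
      · exact R.side_pos k
      · exact hf⟩ with hZ'
  have hvol : Z'.vol = f ^ d * ∏ k, (if k ∈ Lg then R.side k / f else 1) := by
    have h : f ^ d * ∏ k, (if k ∈ Lg then R.side k / f else 1) =
        ∏ k, f * (if k ∈ Lg then R.side k / f else 1) := by
      rw [Finset.prod_mul_distrib, Finset.prod_const, Finset.card_univ, Fintype.card_fin]
    rw [h, vol]
    refine Finset.prod_congr rfl fun k _ => ?_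
    simp only [hZ']
    split_ifs
    · rw [mul_div_cancel₀ _ hf.ne']
    · rw [mul_one]
  rw [← hvol]
  have hZ'R : Z'.Within R := by
    intro k
    have := hZR k
    rw [hZ k] at this
    simp only [hZ']
    split_ifs
    · exact ⟨le_rfl, le_rfl⟩
    · exact this
  refine vol_le_free hZ'R fun o ho => ?_
  obtain ⟨k, hk⟩ := hZo o ho
  by_cases hkL : k ∈ Lg
  · exact sep_of_inner_eq_empty (hin k hkL) ho hZR hZ'R hk
  · refine ⟨k, ?_⟩
    rw [hZ k] at hk
    simpa [hZ', hkL] using hk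

end Cuboid

namespace ItemSet

variable {n d : ℕ}

theorem card_mul_le_totalVol (I : ItemSet n) {Q : Finset (Fin n)} {a : ℝ} (ha : 0 ≤ a)
    (h : ∀ i ∈ Q, a ≤ I.size i) : (Q.card : ℝ) * a ^ d ≤ I.totalVol d Q := by
  have := Finset.sum_le_sum fun i hi => pow_le_pow_left₀ ha (h i hi) d
  rwa [Finset.sum_const, nsmul_eq_mul] at this

theorem totalVol_mono (I : ItemSet n) {Q Q' : Finset (Fin n)} (h : Q ⊆ Q') :
    I.totalVol d Q ≤ I.totalVol d Q' :=
  Finset.sum_le_sum_of_subset_of_nonneg h fun i _ _ => (pow_pos (I.size_pos i) d).le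

/-- A cheap set of cells of given cardinality. -/
theorem exists_cheap_cells {α : Type*} [Fintype α] [DecidableEq α] (I : ItemSet n)
    (S : Finset (Fin n)) (cell : Fin n → α) {ε : ℝ} (hε1 : ε ≤ 1)
    (hα : 1 ≤ ε * Fintype.card α) :
    ∃ U : Finset α, (U.card : ℝ) ≤ (1 - ε) * Fintype.card α ∧
      (1 - 2 * ε) * I.totalProfit S ≤ I.totalProfit (S.filter fun i => cell i ∈ U) := by
  -- All cells have weight one. The dropped set `D` has at most `ε * card + 1 ≤ 2 * ε * card` cells
  -- and at most average profit per cell, hence the factor 2 in the loss.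
  obtain ⟨D, -, hD1, hD2, hD3⟩ := exists_subset_low_density (fun _ : α => (1 : ℝ))
    (fun u => I.totalProfit (S.filter fun i => cell i = u)) (v0 := 1)
    (α := ε * Fintype.card α) Finset.univ (fun _ _ => ⟨one_pos, le_rfl⟩) (by positivity)
    (by simp only [Finset.sum_const, Finset.card_univ, nsmul_eq_mul, mul_one]
        exact mul_le_of_le_one_left (Nat.cast_nonneg _) hε1) zero_le_one
  have hsum : ∑ u, I.totalProfit (S.filter fun i => cell i = u) = I.totalProfit S :=
    Finset.sum_fiberwise _ _ _
  have hsumD : ∑ u ∈ D, I.totalProfit (S.filter fun i => cell i = u) =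
      I.totalProfit (S.filter fun i => cell i ∈ D) := by
    simp only [totalProfit]
    rw [← Finset.sum_fiberwise_of_maps_to (g := cell) (t := D)
      fun i hi => (Finset.mem_filter.1 hi).2]
    refine Finset.sum_congr rfl fun u hu => Finset.sum_congr ?_ fun _ _ => rfl
    ext i
    simp only [Finset.mem_filter]
    constructor
    · rintro ⟨a, rfl⟩
      exact ⟨⟨a, hu⟩, rfl⟩
    · rintro ⟨⟨a, -⟩, b⟩
      exact ⟨a, b⟩
  rw [hsum, hsumD] at hD3
  simp only [Finset.sum_const, nsmul_eq_mul, mul_one, Finset.card_univ] at hD1 hD2 hD3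
  refine ⟨Finset.univ \ D, ?_, ?_⟩
  · rw [Finset.card_sdiff_of_subset (Finset.subset_univ D), Finset.card_univ,
      Nat.cast_sub (Finset.card_le_univ D)]
    linarith
  · have hsplit : I.totalProfit (S.filter fun i => cell i ∈ Finset.univ \ D) +
        I.totalProfit (S.filter fun i => cell i ∈ D) = I.totalProfit S := by
      have := Finset.sum_filter_add_sum_filter_not S (fun i => cell i ∈ D) I.profit
      simp only [Finset.mem_sdiff, Finset.mem_univ, true_and, totalProfit]
      linarith
    have hc : (0 : ℝ) < Fintype.card α := by
      by_contra! hcon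
      nlinarith
    have h1 : I.totalProfit (S.filter fun i => cell i ∈ D) * Fintype.card α ≤
        2 * ε * I.totalProfit S * Fintype.card α := by
      have hP := I.totalProfit_nonneg S
      have : (D.card : ℝ) * I.totalProfit S ≤ (2 * (ε * Fintype.card α)) * I.totalProfit S :=
        mul_le_mul_of_nonneg_right (by linarith) hP
      linarith
    have h2 := le_of_mul_le_mul_right h1 hc
    linarith

set_option maxHeartbeats 1600000 in
open Classical in
/-- Rearrangement of large and tiny items in a box that is much longer than the items. -/
theorem exists_long_of_gap {d : ℕ} (hd : 0 < d) (q : ℕ) {c ε δ : ℝ} (hc : 1 ≤ c) (hε : 0 < ε)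
    (hε1 : ε ≤ 1) (hδ : 0 < δ) (hδ1 : δ ≤ 1) :
    ∃ (μ c' : ℝ) (C : ℕ), 0 < μ ∧ ∀ {n : ℕ} (I : ItemSet n) (R : Cuboid d)
      (obs : Finset (Cuboid d)) (f : ℝ) (S : Finset (Fin n)) (pos : Fin n → Fin d → ℝ)
      (Lg : Finset (Fin d)), obs.card ≤ q → 0 < f → Lg.Nonempty →
      (∀ k ∈ Lg, c' * f ≤ R.side k ∧ R.inner obs k = ∅) → (∀ k, k ∉ Lg → R.side k ≤ c * f) →
      (∃ Z : Cuboid d, (∀ k, Z.side k = f) ∧ Z.Within R ∧ ∀ o ∈ obs, Z.Sep o) →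
      I.PackedIn S pos R → I.Avoids S pos obs →
      (∀ i ∈ S, I.size i ≤ f ∧ (I.size i ≤ μ * f ∨ δ * f ≤ I.size i)) →
      ∃ S' ⊆ S, I.BoxFam R obs S' C ∧ (1 - ε) * I.totalProfit S ≤ I.totalProfit S' := by
  have hc0 : 0 < c := by linarith
  set e := ε / 2 with he
  have he0 : 0 < e := by positivity
  -- The extra box has at least `(e / 8) * W / 2 ^ d = 4 * κ * W` places, where `2 ^ d` accounts for
  -- rounding. At most `κ * W` crossing large items and `2 * κ * W` items of class 0 have to fit.
  set κ : ℝ := e / 32 / 2 ^ d with hκ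
  have hκ0 : 0 < κ := by positivity
  have hκδ : 0 < κ * δ ^ d := by positivity
  have hd' : (0 : ℝ) < d := by exact_mod_cast hd
  -- `K` is the minimal grid width in units of `f`, large enough that crossing items have little
  -- volume. `g` is the number of size classes, large enough that class 0 is small. `qu` bounds the
  -- large items in a cell of sides at most `(c + 2 * K) * f`.
  obtain ⟨K, hK⟩ := exists_nat_gt (max 1 (2 * d * c ^ d / (κ * δ ^ d)))
  obtain ⟨g, hg⟩ := exists_nat_gt (c ^ d / (κ * δ ^ d))
  obtain ⟨qu, hqu⟩ := exists_nat_gt (((c + 2 * K) / δ) ^ d)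
  rw [max_lt_iff] at hK
  have hK1 : (1 : ℝ) < K := hK.1
  have hK0 : (0 : ℝ) < K := by linarith
  have hξ : 2 * d / K * c ^ d ≤ κ * δ ^ d := by
    have := hK.2.le
    rw [div_le_iff₀ hκδ] at this
    rw [div_mul_eq_mul_div, div_le_iff₀ hK0]
    linarith
  have hg' : c ^ d ≤ κ * δ ^ d * g := by
    have := hg.le
    rw [div_le_iff₀ hκδ] at this
    linarith
  have hg0 : 0 < g := by
    have h1 : (0 : ℝ) < g := lt_of_le_of_lt (by positivity) hg
    exact_mod_cast h1
  set Ty : ℕ := (qu + 1) ^ g with hTy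
  have hTy1 : (1 : ℝ) ≤ Ty := by exact_mod_cast Nat.one_le_pow _ _ (Nat.succ_pos _)
  set η : ℝ := e / 8 / c ^ d with hη
  obtain ⟨μ, CE, hμ, hE⟩ := exists_vpack hd (q + (Ty * qu + 1)) (η := η) (by positivity)
  -- The three terms ensure at least `4 * Ty / e` layers along `d0`, so that one rounding layer per
  -- type is affordable, at least one grid cell on each long axis, and `1 ≤ κ * W`.
  set c' : ℝ := max (2 * K * (4 * Ty / e)) (max K (1 / κ)) with hc'
  refine ⟨μ, c', Ty * qu + 1 + CE, hμ, ?_⟩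
  intro n I R obs f S pos Lg hq hf hLg hlong hshort ⟨Z, hZ, hZR, hZo⟩ hpack hav hsize
  obtain ⟨d0, hd0⟩ := hLg
  have hcK : (K : ℝ) ≤ c' := (le_max_left _ _).trans (le_max_right _ _)
  have hcκ : 1 / κ ≤ c' := (le_max_right _ _).trans (le_max_right _ _)
  have hcT : 2 * K * (4 * Ty / e) ≤ c' := le_max_left _ _
  have hfR : ∀ k, f ≤ R.side k := fun k => by
    have := hZR k
    rw [hZ k] at this
    linarith [this.1, this.2]
  -- the grid
  set N : Fin d → ℕ := fun k => if k ∈ Lg then ⌊R.side k / (K * f)⌋₊ else 1 with hNdef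
  have hKf : 0 < K * f := mul_pos hK0 hf
  have hx1 : ∀ k ∈ Lg, 1 ≤ R.side k / (K * f) := fun k hk => by
    rw [one_le_div hKf]
    exact (mul_le_mul_of_nonneg_right hcK hf.le).trans (hlong k hk).1
  have hN0 : ∀ k, 0 < N k := fun k => by
    simp only [hNdef]
    split_ifs with hk
    · exact Nat.floor_pos.2 (hx1 k hk)
    · exact one_pos
  have hNr : ∀ k, (0 : ℝ) < N k := fun k => by exact_mod_cast hN0 k
  have hN : ∀ k, N k = 1 ∨ R.inner obs k = ∅ := fun k => by
    by_cases hk : k ∈ Lg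
    · exact Or.inr (hlong k hk).2
    · exact Or.inl (by simp [hNdef, hk])
  have hNle : ∀ k ∈ Lg, (N k : ℝ) * (K * f) ≤ R.side k := fun k hk => by
    rw [← le_div_iff₀ hKf]
    simp only [hNdef, hk, if_true]
    exact Nat.floor_le (by linarith [hx1 k hk])
  have hNge : ∀ k ∈ Lg, R.side k ≤ N k * (2 * K * f) := fun k hk => by
    have := half_le_floor (hx1 k hk)
    have h2 : R.side k = R.side k / (K * f) / 2 * (2 * K * f) := by field_simp
    rw [h2]
    refine mul_le_mul_of_nonneg_right ?_ (by positivity)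
    simpa only [hNdef, hk, if_true] using this
  have hNd0 : 4 * Ty / e ≤ N d0 := by
    have h1 := hNge d0 hd0
    have h2 := (mul_le_mul_of_nonneg_right hcT hf.le).trans (hlong d0 hd0).1
    have h3 : (4 * Ty / e) * (2 * K * f) ≤ N d0 * (2 * K * f) := by linarith
    exact le_of_mul_le_mul_right h3 (by positivity)
  have hNd0' : (Ty : ℝ) ≤ e * N d0 / 4 := by
    rw [div_le_iff₀ he0] at hNd0
    linarith
  -- volumes
  set W : ℝ := ∏ k, (if k ∈ Lg then R.side k / f else 1) with hW
  set V := R.vol with hV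
  set F := volume.real (R.free obs) with hF
  have hVW : V ≤ c ^ d * (f ^ d * W) := Cuboid.vol_le_of_short hf hc hshort
  have hFW : f ^ d * W ≤ F := Cuboid.le_volume_free hf (fun k hk => (hlong k hk).2) hZ hZR hZo
  have hfd : 0 < f ^ d := pow_pos hf d
  have hWge : ∀ k, 1 ≤ (if k ∈ Lg then R.side k / f else 1) := fun k => by
    split_ifs
    · rw [one_le_div hf]; exact hfR k
    · exact le_rfl
  have hW0 : 1 ≤ κ * W := by
    have h1 : R.side d0 / f ≤ W := by
      rw [hW, ← Finset.mul_prod_erase _ _ (Finset.mem_univ d0), if_pos hd0]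
      refine le_mul_of_one_le_right (div_pos (R.side_pos _) hf).le ?_
      have := Finset.prod_le_prod (s := Finset.univ.erase d0) (f := fun _ => (1 : ℝ))
        (fun _ _ => zero_le_one) fun k _ => hWge k
      simpa using this
    have h2 : c' ≤ R.side d0 / f := by
      rw [le_div_iff₀ hf]; exact (hlong d0 hd0).1
    have h3 : 1 / κ ≤ W := by linarith
    rwa [div_le_iff₀ hκ0, mul_comm] at h3
  have hWpos : 0 < W := by
    by_contra! hcon
    linarith [mul_nonpos_of_nonneg_of_nonpos hκ0.le hcon]
  have hFpos : 0 < F := (mul_pos hfd hWpos).trans_le hFW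
  -- cells of the items
  have hcellex : ∀ i, ∃ u : ∀ k, Fin (N k),
      (∃ u', (I.cubeAt i (pos i)).Within (R.gridCell N u')) →
        (I.cubeAt i (pos i)).Within (R.gridCell N u) := by
    intro i
    by_cases h : ∃ u', (I.cubeAt i (pos i)).Within (R.gridCell N u')
    · exact ⟨h.choose, fun _ => h.choose_spec⟩
    · exact ⟨fun k => ⟨0, hN0 k⟩, fun h' => absurd h' h⟩
  choose cell hcell using hcellex
  set In := S.filter fun i => ∃ u', (I.cubeAt i (pos i)).Within (R.gridCell N u') with hIn
  set Cr := S.filter fun i => ¬ ∃ u', (I.cubeAt i (pos i)).Within (R.gridCell N u') with hCr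
  have hInS : In ⊆ S := Finset.filter_subset _ _
  have hCrS : Cr ⊆ S := Finset.filter_subset _ _
  have hInCr : Disjoint In Cr := Finset.disjoint_filter_filter_not _ _ _
  have hNc : (Fintype.card (∀ k, Fin (N k)) : ℝ) = ∏ k, (N k : ℝ) := by
    rw [Fintype.card_pi]
    push_cast
    simp
  set P : ℕ := ∏ k ∈ Finset.univ.erase d0, N k with hP
  have hP0 : 0 < P := Finset.prod_pos fun k _ => hN0 k
  have hPr : (1 : ℝ) ≤ P := by exact_mod_cast hP0
  have hPN : ∏ k, (N k : ℝ) = P * N d0 := by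
    rw [← Finset.mul_prod_erase _ _ (Finset.mem_univ d0), hP]
    push_cast
    ring
  -- Dropping at least a fraction `e` of the cells frees the layers and the volume needed for
  -- rounding and for the extra box, at a loss of at most `2 * e = ε` of the profit inside cells.
  obtain ⟨U, hUcard, hUprofit⟩ := I.exists_cheap_cells In cell (ε := e) (by linarith) (by
    rw [hNc, hPN, mul_left_comm]
    exact one_le_mul_of_one_le_of_one_le hPr (by linarith))
  rw [hNc, hPN] at hUcard
  set Ik := In.filter fun i => cell i ∈ U with hIk
  have hIkIn : Ik ⊆ In := Finset.filter_subset _ _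
  set Y := Ik.filter fun i => δ * f ≤ I.size i with hY
  set X := Cr.filter fun i => δ * f ≤ I.size i with hX
  set Sm := (Ik ∪ Cr).filter fun i => ¬ δ * f ≤ I.size i with hSm
  have hYIk : Y ⊆ Ik := Finset.filter_subset _ _
  have hXCr : X ⊆ Cr := Finset.filter_subset _ _
  have hYS : Y ⊆ S := hYIk.trans (hIkIn.trans hInS)
  have hXS : X ⊆ S := hXCr.trans hCrS
  have hunion : Y ∪ X ∪ Sm = Ik ∪ Cr := by
    rw [hY, hX, hSm, ← Finset.filter_union, Finset.filter_union_filter_not_eq]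
  have hIkS : Ik ∪ Cr ⊆ S := Finset.union_subset (hIkIn.trans hInS) hCrS
  have hSmS : Sm ⊆ S := (Finset.filter_subset _ _).trans hIkS
  have hcellI : ∀ i ∈ In, (I.cubeAt i (pos i)).Within (R.gridCell N (cell i)) := fun i hi =>
    hcell i (Finset.mem_filter.1 hi).2
  -- volume bounds
  have hCrvol : I.totalVol d Cr ≤ 2 * d / K * V := by
    refine (I.totalVol_crossing_le (hpack.mono hCrS) hf (fun i hi => (hsize i (hCrS hi)).1) N hN0
      fun i hi u hu => (Finset.mem_filter.1 hi).2 ⟨u, hu⟩).trans ?_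
    have h1 : ∀ k ∈ Finset.univ, ((N k : ℝ) - 1) * (2 * f / R.side k) * V ≤ 2 / K * V := by
      intro k _
      refine mul_le_mul_of_nonneg_right ?_ R.vol_pos.le
      by_cases hk : k ∈ Lg
      · rw [mul_div_assoc', div_le_div_iff₀ (R.side_pos k) hK0]
        have h1 := hNle k hk
        have h2 : ((N k : ℝ) - 1) * (2 * f) * K = 2 * (N k * (K * f)) - 2 * (K * f) := by ring
        rw [h2]
        linarith
      · have : N k = 1 := by simp [hNdef, hk]
        rw [this]
        simp only [Nat.cast_one, sub_self, zero_mul]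
        positivity
    refine (Finset.sum_le_sum h1).trans (le_of_eq ?_)
    rw [Finset.sum_const, Finset.card_univ, Fintype.card_fin, nsmul_eq_mul]
    ring
  set fu : ℝ := F / (P * N d0) with hfu
  have hPNd : (0 : ℝ) < P * N d0 := mul_pos (by linarith) (hNr d0)
  have hcellvol : ∀ u, I.totalVol d (In.filter fun i => cell i = u) ≤ fu := by
    intro u
    have h1 := R.prod_mul_volume_free_gridCell_le obs N hN u
    rw [hPN] at h1
    rw [hfu, le_div_iff₀ hPNd]
    refine le_trans ?_ h1
    rw [mul_comm]
    refine mul_le_mul_of_nonneg_left ?_ hPNd.le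
    have hsub : In.filter (fun i => cell i = u) ⊆ In := Finset.filter_subset _ _
    refine I.totalVol_le_free (pos := pos) ⟨fun i hi => ?_, (hpack.mono (hsub.trans hInS)).sep⟩
      (hav.mono (hsub.trans hInS))
    have h2 := hcellI i (hsub hi)
    rwa [(Finset.mem_filter.1 hi).2] at h2
  have hIkvol : I.totalVol d Ik ≤ (1 - e) * F := by
    have h1 : I.totalVol d Ik = ∑ u ∈ U, I.totalVol d (Ik.filter fun i => cell i = u) :=
      (Finset.sum_fiberwise_of_maps_to (fun i hi => (Finset.mem_filter.1 hi).2) _).symm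
    have h2 : I.totalVol d Ik ≤ U.card * fu := by
      rw [h1, ← nsmul_eq_mul, ← Finset.sum_const]
      exact Finset.sum_le_sum fun u _ =>
        (I.totalVol_mono (Finset.filter_subset_filter _ hIkIn)).trans (hcellvol u)
    have h3 : (U.card : ℝ) * fu ≤ (1 - e) * (P * N d0) * fu :=
      mul_le_mul_of_nonneg_right hUcard (by positivity)
    have h4 : (1 - e) * (P * N d0) * fu = (1 - e) * F := by
      rw [hfu, mul_assoc, mul_div_cancel₀ _ hPNd.ne']
    linarith
  have hXvol : (X.card : ℝ) ≤ κ * W := by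
    have h1 := I.card_mul_le_totalVol (d := d) (Q := X) (a := δ * f) (by positivity)
      fun i hi => (Finset.mem_filter.1 hi).2
    have h2 := I.totalVol_mono (d := d) hXCr
    have h3 : 2 * d / K * V ≤ κ * δ ^ d * (f ^ d * W) := by
      calc 2 * d / K * V ≤ 2 * d / K * (c ^ d * (f ^ d * W)) :=
            mul_le_mul_of_nonneg_left hVW (by positivity)
        _ = (2 * d / K * c ^ d) * (f ^ d * W) := by ring
        _ ≤ _ := mul_le_mul_of_nonneg_right hξ (by positivity)
    rw [mul_pow] at h1
    have h4 : (X.card : ℝ) * (δ ^ d * f ^ d) ≤ κ * W * (δ ^ d * f ^ d) := by linarith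
    exact le_of_mul_le_mul_right h4 (by positivity)
  have hYcard : (Y.card : ℝ) ≤ κ * W * g := by
    have h1 := I.card_mul_le_totalVol (d := d) (Q := Y) (a := δ * f) (by positivity)
      fun i hi => (Finset.mem_filter.1 hi).2
    have h2 := I.totalVol_le_free (hpack.mono hYS) (hav.mono hYS)
    have h3 := R.volume_free_le obs
    have h5 : c ^ d * (f ^ d * W) ≤ κ * δ ^ d * g * (f ^ d * W) :=
      mul_le_mul_of_nonneg_right hg' (by positivity)
    rw [mul_pow] at h1
    have h4 : (Y.card : ℝ) * (δ ^ d * f ^ d) ≤ κ * W * g * (δ ^ d * f ^ d) := by linarith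
    exact le_of_mul_le_mul_right h4 (by positivity)
  -- grouping
  obtain ⟨cls, σ, g1, g2, g3, g4, g5, g6⟩ := exists_linear_grouping I.size (m := δ * f)
    (Y.card / g + 1) g Y (fun i hi => (Finset.mem_filter.1 hi).2) (by
      have h1 := Nat.div_add_mod Y.card g
      have h2 := Nat.mod_lt Y.card hg0
      rw [Nat.mul_add_one]
      linarith)
  have hb : (((Y.filter fun i => cls i = 0).card : ℕ) : ℝ) ≤ 2 * (κ * W) := by
    have h1 : (((Y.filter fun i => cls i = 0).card : ℕ) : ℝ) ≤ (Y.card / g : ℕ) + 1 := by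
      exact_mod_cast g2
    have h2 : ((Y.card / g : ℕ) : ℝ) ≤ κ * W := by
      refine Nat.cast_div_le.trans ?_
      rw [div_le_iff₀ (by exact_mod_cast hg0)]
      exact hYcard
    linarith
  have hcellcard : ∀ u, (Y.filter fun i => cell i = u).card ≤ qu := by
    intro u
    have hsub : Y.filter (fun i => cell i = u) ⊆ Y := Finset.filter_subset _ _
    have h1 := I.card_mul_le_totalVol (d := d) (Q := Y.filter fun i => cell i = u) (a := δ * f)
      (by positivity) fun i hi => (Finset.mem_filter.1 (hsub hi)).2
    have h2 : I.totalVol d (Y.filter fun i => cell i = u) ≤ (R.gridCell N u).vol := by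
      rw [← Cuboid.volume_real_halfOpen]
      refine I.totalVol_le_volume (hpack.mono (hsub.trans hYS)).sep
        (Cuboid.volume_halfOpen_ne_top _) fun i hi => ?_
      have h3 := hcellI i (hIkIn (hYIk (hsub hi)))
      rw [(Finset.mem_filter.1 hi).2] at h3
      exact h3.subset
    have h3 : (R.gridCell N u).vol ≤ ((c + 2 * K) * f) ^ d := by
      have : ((c + 2 * K) * f) ^ d = ∏ _k : Fin d, (c + 2 * K) * f := by simp
      rw [this]
      refine Finset.prod_le_prod (fun k _ => (Cuboid.side_pos _ k).le) fun k _ => ?_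
      simp only [Cuboid.gridCell]
      rw [div_le_iff₀ (hNr k)]
      by_cases hk : k ∈ Lg
      · have h4 := hNge k hk
        have h5 : 0 ≤ N k * (c * f) := by positivity
        linarith
      · have h4 := hshort k hk
        have h5 : N k = 1 := by simp [hNdef, hk]
        rw [h5, Nat.cast_one, mul_one, add_mul]
        have h6 : 0 ≤ 2 * K * f := by positivity
        linarith
    have h4 : (((Y.filter fun i => cell i = u).card : ℕ) : ℝ) ≤ ((c + 2 * K) / δ) ^ d := by
      rw [div_pow, le_div_iff₀ (pow_pos hδ d)]
      rw [mul_pow] at h1 h3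
      have : ((Y.filter fun i => cell i = u).card : ℝ) * δ ^ d * f ^ d ≤
          (c + 2 * K) ^ d * f ^ d := by linarith
      exact le_of_mul_le_mul_right this hfd
    exact_mod_cast (h4.trans hqu.le)
  -- the layers for the remaining large items
  set h : ℕ := ⌊e * N d0 / 4⌋₊ with hh
  have hx : 1 ≤ e * N d0 / 4 := hTy1.trans hNd0'
  have hh1 : (h : ℝ) ≤ e * N d0 / 4 := Nat.floor_le (by linarith)
  have hh2 : e * N d0 / 4 / 2 ≤ h := half_le_floor hx
  have hh3 : (1 : ℝ) ≤ h := by exact_mod_cast Nat.floor_pos.2 hx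
  -- The room for the extra box in units of `f`: `h` layers along `d0`, the full length of the other
  -- long axes, and the width of the free cube elsewhere.
  set y : Fin d → ℝ := fun k => if k = d0 then h * (R.side d0 / N d0) / f else
    if k ∈ Lg then R.side k / f else 1 with hy
  have hlamd0 : f ≤ R.side d0 / N d0 := by
    rw [le_div_iff₀ (hNr d0)]
    have h1 := hNle d0 hd0
    have h2 : (N d0 : ℝ) * f ≤ N d0 * (K * f) :=
      mul_le_mul_of_nonneg_left (le_mul_of_one_le_left hf.le hK1.le) (hNr d0).le
    linarith
  have hy1 : ∀ k, 1 ≤ y k := by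
    intro k
    simp only [hy]
    split_ifs
    · rw [one_le_div hf]
      exact hlamd0.trans (le_mul_of_one_le_left (hf.le.trans hlamd0) hh3)
    · rw [one_le_div hf]; exact hfR k
    · exact le_rfl
  have hyprod : ∏ k, y k = h / N d0 * W := by
    rw [hW, ← Finset.mul_prod_erase _ _ (Finset.mem_univ d0),
      ← Finset.mul_prod_erase Finset.univ (fun k => if k ∈ Lg then R.side k / f else 1)
        (Finset.mem_univ d0)]
    have h1 : ∏ k ∈ Finset.univ.erase d0, y k =
        ∏ k ∈ Finset.univ.erase d0, (if k ∈ Lg then R.side k / f else 1) :=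
      Finset.prod_congr rfl fun k hk => by simp [hy, Finset.ne_of_mem_erase hk]
    have h2 : y d0 = h / N d0 * (R.side d0 / f) := by
      simp only [hy, if_true]
      ring
    rw [h1, h2, if_pos hd0]
    ring
  have hcapb := prod_floor_bounds y hy1
  rw [hyprod] at hcapb
  have hhN1 : (h : ℝ) / N d0 ≤ e / 4 := by
    rw [div_le_iff₀ (hNr d0)]; linarith
  have hhN2 : e / 8 ≤ (h : ℝ) / N d0 := by
    rw [le_div_iff₀ (hNr d0)]; linarith
  have hcount : X.card + (Y.filter fun i => cls i = 0).card ≤ ∏ k, ⌊y k⌋₊ := by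
    have h1 : (4 * κ) * W ≤ (h : ℝ) / N d0 * W / 2 ^ d := by
      rw [le_div_iff₀ (by positivity)]
      have h2 : 4 * κ * W * 2 ^ d = e / 8 * W := by rw [hκ]; field_simp; norm_num
      rw [h2]
      exact mul_le_mul_of_nonneg_right hhN2 hWpos.le
    have h2 : (X.card : ℝ) + ((Y.filter fun i => cls i = 0).card : ℕ) ≤ (∏ k, ⌊y k⌋₊ : ℕ) := by
      have h3 := hcapb.1
      have h4 : 0 ≤ κ * W := by positivity
      linarith
    exact_mod_cast h2
  -- The kept cells hold at most `(1 - e) * F`. Crossing items take `e / 8`, rounding `e / 4`, the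
  -- extra box `e / 4` and the waste for tiny items `e / 8` of `F`, together less than `e`.
  have hvol : I.totalVol d Sm ≤ F - I.totalVol d Y - (P : ℕ) * (Ty : ℕ) * fu -
      (∏ k, ⌊y k⌋₊ : ℕ) * f ^ d - η * V := by
    have h1 : I.totalVol d Y + I.totalVol d Sm ≤ I.totalVol d Ik + I.totalVol d Cr := by
      have hdisj : Disjoint Y Sm := by
        rw [Finset.disjoint_left]
        intro i hi hi'
        exact (Finset.mem_filter.1 hi').2 (Finset.mem_filter.1 hi).2
      have h2 : I.totalVol d (Y ∪ Sm) = I.totalVol d Y + I.totalVol d Sm :=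
        Finset.sum_union hdisj
      have h3 : I.totalVol d (Ik ∪ Cr) = I.totalVol d Ik + I.totalVol d Cr :=
        Finset.sum_union (hInCr.mono_left hIkIn)
      rw [← h2, ← h3]
      exact I.totalVol_mono (Finset.union_subset (hYIk.trans Finset.subset_union_left)
        (Finset.filter_subset _ _))
    have h2 : (P : ℝ) * Ty * fu ≤ e / 4 * F := by
      have : (P : ℝ) * Ty * fu = Ty / N d0 * F := by
        have := (hNr d0).ne'
        have : (P : ℝ) ≠ 0 := by positivity
        rw [hfu]; field_simp
      rw [this]
      refine mul_le_mul_of_nonneg_right ?_ hFpos.le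
      rw [div_le_iff₀ (hNr d0)]
      linarith
    have h3 : ((∏ k, ⌊y k⌋₊ : ℕ) : ℝ) * f ^ d ≤ e / 4 * F := by
      calc ((∏ k, ⌊y k⌋₊ : ℕ) : ℝ) * f ^ d ≤ (h / N d0 * W) * f ^ d :=
            mul_le_mul_of_nonneg_right hcapb.2 hfd.le
        _ = h / N d0 * (f ^ d * W) := by ring
        _ ≤ e / 4 * F := mul_le_mul hhN1 hFW (by positivity) (by positivity)
    have hVF : V ≤ c ^ d * F := hVW.trans (mul_le_mul_of_nonneg_left hFW (by positivity))
    have h4 : η * V ≤ e / 8 * F := by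
      calc η * V ≤ η * (c ^ d * F) := mul_le_mul_of_nonneg_left hVF (by positivity)
        _ = e / 8 * F := by rw [hη]; field_simp
    have h5 : 2 * d / K * V ≤ e / 8 * F := by
      have hκe : κ * δ ^ d ≤ e / 8 := by
        have h6 : δ ^ d ≤ 1 := pow_le_one₀ hδ.le hδ1
        have h7 : κ ≤ e / 8 := by
          have h8 : (1 : ℝ) ≤ 2 ^ d := one_le_pow₀ (by norm_num)
          rw [hκ, div_le_iff₀ (by positivity)]
          have h9 := mul_le_mul_of_nonneg_left h8 (show 0 ≤ e / 8 by positivity)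
          linarith
        calc κ * δ ^ d ≤ κ * 1 := mul_le_mul_of_nonneg_left h6 hκ0.le
          _ ≤ e / 8 := by linarith
      calc 2 * d / K * V ≤ 2 * d / K * (c ^ d * F) :=
            mul_le_mul_of_nonneg_left hVF (by positivity)
        _ = (2 * d / K * c ^ d) * F := by ring
        _ ≤ e / 8 * F := mul_le_mul_of_nonneg_right (hξ.trans hκe) hFpos.le
    have h6 : I.totalVol d Ik ≤ F - e * F := by linarith
    have h7 := mul_pos he0 hFpos
    linarith
  have hlayers : U.card + (qu + 1) ^ g * P + h * P ≤ P * N d0 := by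
    have h1 : (U.card : ℝ) + Ty * P + h * P ≤ P * N d0 := by
      have h2 : (Ty : ℝ) * P ≤ e * N d0 / 4 * P := mul_le_mul_of_nonneg_right hNd0' (by linarith)
      have h3 : (h : ℝ) * P ≤ e * N d0 / 4 * P := mul_le_mul_of_nonneg_right hh1 (by linarith)
      have h4 := mul_pos he0 hPNd
      have h5 : (1 - e) * (P * N d0) = P * N d0 - e * (P * N d0) := by ring
      have h6 : e * N d0 / 4 * P = e * (P * N d0) / 4 := by ring
      linarith
    exact_mod_cast h1
  refine ⟨Ik ∪ Cr, hIkS, ?_, ?_⟩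
  · rw [← hunion]
    refine boxFam_of_linear_grouping hN0 hN (hlong d0 hd0).2 hf hZ hZR hZo
      (fun i hi => (Finset.mem_filter.1 (hYIk hi)).2)
      (fun i hi => hcellI i (hIkIn (hYIk hi))) (hpack.mono hYS).sep (hav.mono hYS)
      (fun γ => (mul_pos hδ hf).trans_le (g6 γ)) g1 g3 g4 g5 hcellcard
      (fun u => (I.totalVol_mono (Finset.filter_subset_filter _ (hYIk.trans hIkIn))).trans
        (hcellvol u)) hlayers (cap := fun k => ⌊y k⌋₊) (fun k => Nat.floor_pos.2 (hy1 k)) ?_ ?_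
      hcount (fun i hi => (hsize i (hYS hi)).1) (fun i hi => (hsize i (hXS hi)).1)
      ((hInCr.mono_left hIkIn).mono hYIk hXCr) ?_ ?_ (η := η) ?_ hvol
    · have h1 : (⌊y d0⌋₊ : ℝ) ≤ y d0 := Nat.floor_le (by linarith [hy1 d0])
      rw [← le_div_iff₀ hf]
      simpa only [hy, if_true] using h1
    · intro k hk
      by_cases hkL : k ∈ Lg
      · refine Or.inr ⟨(hlong k hkL).2, ?_⟩
        rw [← le_div_iff₀ hf]
        have h1 : (⌊y k⌋₊ : ℝ) ≤ y k := Nat.floor_le (by linarith [hy1 k])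
        simpa only [hy, hk, hkL, if_true, if_false] using h1
      · left
        simp [hy, hk, hkL]
    · rw [Finset.disjoint_left]
      intro i hi hi'
      exact (Finset.mem_filter.1 hi').2 (Finset.mem_filter.1 hi).2
    · rw [Finset.disjoint_left]
      intro i hi hi'
      exact (Finset.mem_filter.1 hi').2 (Finset.mem_filter.1 hi).2
    · intro obs' hobs' hv
      refine hE I R obs' f Sm (hobs'.trans (Nat.add_le_add_right hq _)) hf hfR ?_ hv
      intro i hi
      exact (hsize i (hSmS hi)).2.resolve_right (Finset.mem_filter.1 hi).2
  · have h1 : I.totalProfit (Ik ∪ Cr) = I.totalProfit Ik + I.totalProfit Cr :=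
      Finset.sum_union (hInCr.mono_left hIkIn)
    have h2 : I.totalProfit In + I.totalProfit Cr = I.totalProfit S :=
      Finset.sum_filter_add_sum_filter_not _ _ _
    have h3 : 1 - 2 * e = 1 - ε := by rw [he]; ring
    rw [h3] at hUprofit
    rw [h1]
    have h4 := mul_nonneg hε.le (I.totalProfit_nonneg Cr)
    have h5 : (1 - ε) * I.totalProfit S =
        (1 - ε) * I.totalProfit In + I.totalProfit Cr - ε * I.totalProfit Cr := by
      rw [← h2]; ring
    linarith

end ItemSet

/-! ### Rearranging an arbitrary good cell -/

namespace ItemSet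

variable {n d : ℕ}

theorem totalProfit_union (I : ItemSet n) {Q Q' : Finset (Fin n)} (h : Disjoint Q Q') :
    I.totalProfit (Q ∪ Q') = I.totalProfit Q + I.totalProfit Q' :=
  Finset.sum_union h

theorem totalProfit_sdiff (I : ItemSet n) {Q Q' : Finset (Fin n)} (h : Q' ⊆ Q) :
    I.totalProfit (Q \ Q') = I.totalProfit Q - I.totalProfit Q' :=
  eq_sub_of_add_eq (Finset.sum_sdiff h)

theorem totalProfit_biUnion {β : Type*} [Fintype β] (I : ItemSet n) {A : β → Finset (Fin n)}
    (h : ∀ j k, j ≠ k → Disjoint (A j) (A k)) :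
    I.totalProfit (Finset.univ.biUnion A) = ∑ j, I.totalProfit (A j) :=
  Finset.sum_biUnion fun j _ k _ hjk => h j k hjk

/-- One of several disjoint classes of items is cheap. -/
theorem exists_cheap_class (I : ItemSet n) {S : Finset (Fin n)} {t : ℕ} (ht : 0 < t)
    (M : Fin t → Finset (Fin n)) (hM : ∀ i, M i ⊆ S)
    (hdisj : ∀ i j, i ≠ j → Disjoint (M i) (M j)) :
    ∃ i, t * I.totalProfit (M i) ≤ I.totalProfit S := by
  have : Nonempty (Fin t) := ⟨⟨0, ht⟩⟩
  obtain ⟨i, -, hi⟩ := Finset.exists_min_image Finset.univ (fun i => I.totalProfit (M i))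
    Finset.univ_nonempty
  refine ⟨i, ?_⟩
  have h1 := Finset.card_nsmul_le_sum Finset.univ (fun i => I.totalProfit (M i)) _ hi
  rw [← I.totalProfit_biUnion hdisj, Finset.card_univ, Fintype.card_fin, nsmul_eq_mul] at h1
  exact h1.trans (I.totalProfit_mono (Finset.biUnion_subset.2 fun i _ => hM i))

open Classical in
/-- Rearrangement of the items in a box that is much longer than the items. -/
theorem exists_long (hd : 0 < d) (q : ℕ) {c ε : ℝ} (hc : 1 ≤ c) (hε : 0 < ε) (hε1 : ε ≤ 1) :
    ∃ (c' : ℝ) (C : ℕ), ∀ {n : ℕ} (I : ItemSet n) (R : Cuboid d)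
      (obs : Finset (Cuboid d)) (f : ℝ) (S : Finset (Fin n)) (pos : Fin n → Fin d → ℝ)
      (Lg : Finset (Fin d)), obs.card ≤ q → 0 < f → Lg.Nonempty →
      (∀ k ∈ Lg, c' * f ≤ R.side k ∧ R.inner obs k = ∅) → (∀ k, k ∉ Lg → R.side k ≤ c * f) →
      (∃ Z : Cuboid d, (∀ k, Z.side k = f) ∧ Z.Within R ∧ ∀ o ∈ obs, Z.Sep o) →
      I.PackedIn S pos R → I.Avoids S pos obs → (∀ i ∈ S, I.size i ≤ f) →
      ∃ S' ⊆ S, I.BoxFam R obs S' C ∧ (1 - ε) * I.totalProfit S ≤ I.totalProfit S' := by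
  have H := fun δ : {δ : ℝ // 0 < δ ∧ δ ≤ 1} =>
    exists_long_of_gap hd q hc (half_pos hε) (by linarith) δ.2.1 δ.2.2
  choose μ c' C hμ H using H
  -- Whatever is at most `δ (i + 1) * f` is tiny in the sense required when `δ i * f` is the bound
  -- for large items. The ranges between consecutive scales are disjoint, so one of `t > 2 / ε` of
  -- them has at most ε/2 of the profit and is discarded.
  let δ : ℕ → {δ : ℝ // 0 < δ ∧ δ ≤ 1} := fun i => Nat.rec ⟨1, one_pos, le_rfl⟩
    (fun _ x => ⟨min x (μ x), lt_min x.2.1 (hμ x), (min_le_left _ _).trans x.2.2⟩) i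
  have hδ : ∀ i, (δ (i + 1)).1 = min (δ i).1 (μ (δ i)) := fun i => rfl
  have hanti : Antitone fun i => (δ i).1 := antitone_nat_of_succ_le fun i => by
    rw [hδ]; exact min_le_left _ _
  obtain ⟨t, ht⟩ := exists_nat_gt (2 / ε)
  have ht0 : (0 : ℝ) < t := lt_trans (by positivity) ht
  obtain ⟨cm, hcm⟩ := ((Finset.range t).image fun i => c' (δ i)).exists_le
  obtain ⟨Cm, hCm⟩ := ((Finset.range t).image fun i => C (δ i)).exists_le
  refine ⟨cm, Cm, ?_⟩
  intro n I R obs f S pos Lg hq hf hLg hlong hshort hcube hpack hav hsize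
  obtain ⟨i, hi⟩ := I.exists_cheap_class (S := S) (t := t) (by exact_mod_cast ht0)
    (fun i => S.filter fun j => (δ (i + 1)).1 * f < I.size j ∧ I.size j < (δ i).1 * f)
    (fun i => Finset.filter_subset _ _) (fun i j hij => by
      rw [Finset.disjoint_left]
      intro a ha ha'
      have h1 := (Finset.mem_filter.1 ha).2
      have h2 := (Finset.mem_filter.1 ha').2
      rcases lt_or_gt_of_ne hij with h | h
      · have h3 : (δ j).1 ≤ (δ (i + 1)).1 := hanti (Nat.succ_le_of_lt h)
        have := mul_le_mul_of_nonneg_right h3 hf.le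
        linarith [h1.1, h2.2]
      · have h3 : (δ i).1 ≤ (δ (j + 1)).1 := hanti (Nat.succ_le_of_lt h)
        have := mul_le_mul_of_nonneg_right h3 hf.le
        linarith [h1.2, h2.1])
  set M := S.filter fun j => (δ (i + 1)).1 * f < I.size j ∧ I.size j < (δ i).1 * f with hM
  have hMS : M ⊆ S := Finset.filter_subset _ _
  have hsub : S \ M ⊆ S := Finset.sdiff_subset
  have hit : (i : ℕ) ∈ Finset.range t := Finset.mem_range.2 i.2
  obtain ⟨S', hS', hfam, hprofit⟩ := H (δ i) I R obs f (S \ M) pos Lg hq hf hLg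
    (fun k hk => ⟨(mul_le_mul_of_nonneg_right (hcm _ (Finset.mem_image_of_mem _ hit)) hf.le).trans
      (hlong k hk).1, (hlong k hk).2⟩) hshort hcube (hpack.mono hsub) (hav.mono hsub)
    (fun j hj => by
      refine ⟨hsize j (hsub hj), ?_⟩
      by_contra! hcon
      refine (Finset.mem_sdiff.1 hj).2 (Finset.mem_filter.2 ⟨hsub hj, ?_, hcon.2⟩)
      rw [hδ]
      exact (mul_le_mul_of_nonneg_right (min_le_right _ _) hf.le).trans_lt hcon.1)
  refine ⟨S', hS'.trans hsub, hfam.mono (hCm _ (Finset.mem_image_of_mem _ hit)), ?_⟩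
  rw [I.totalProfit_sdiff hMS] at hprofit
  have h1 : I.totalProfit M ≤ ε / 2 * I.totalProfit S := by
    have h2 : 2 / ε * I.totalProfit M ≤ I.totalProfit S :=
      (mul_le_mul_of_nonneg_right ht.le (I.totalProfit_nonneg M)).trans hi
    have h3 : ε / 2 * (2 / ε * I.totalProfit M) = I.totalProfit M := by field_simp
    rw [← h3]
    exact mul_le_mul_of_nonneg_left h2 (by positivity)
  have h2 := mul_le_mul_of_nonneg_left h1 (show 0 ≤ 1 - ε / 2 by linarith)
  have h3 : 0 ≤ (ε / 2) ^ 2 * I.totalProfit S :=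
    mul_nonneg (by positivity) (I.totalProfit_nonneg S)
  refine le_trans ?_ hprofit
  have h4 : (1 - ε / 2) * (I.totalProfit S - I.totalProfit M) = (1 - ε) * I.totalProfit S +
      ((1 - ε / 2) * (ε / 2 * I.totalProfit S) - (1 - ε / 2) * I.totalProfit M) +
      (ε / 2) ^ 2 * I.totalProfit S := by ring
  linarith

open Classical in
/-- Rearrangement of a good cell, up to boundedly many large items. -/
theorem exists_boxFam_of_goodCell (hd : 0 < d) (q : ℕ) {c ε : ℝ} (hc : 1 ≤ c) (hε : 0 < ε)
    (hε1 : ε ≤ 1) :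
    ∃ C : ℕ, ∀ {n : ℕ} (I : ItemSet n) (obs : Finset (Cuboid d)) (pos : Fin n → Fin d → ℝ)
      (R : Cuboid d) (f : ℝ) (S : Finset (Fin n)), obs.card ≤ q → I.GoodCell obs pos c R f S →
      I.Avoids S pos obs → ∃ L ⊆ S, L.card ≤ C ∧ ∃ S' ⊆ S \ L, I.BoxFam R obs S' C ∧
        (1 - ε) * I.totalProfit (S \ L) ≤ I.totalProfit S' := by
  have H := fun c : {c : ℝ // 1 ≤ c} => exists_long hd q c.2 hε hε1
  choose c' C H using H
  -- If the short axes are bounded by `cs i * f`, then `cs (i + 1) * f` is long enough for the other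
  -- axes.
  let cs : ℕ → {c : ℝ // 1 ≤ c} := fun i => Nat.rec ⟨c, hc⟩
    (fun _ x => ⟨max x (c' x), x.2.trans (le_max_left _ _)⟩) i
  have hcs : ∀ i, (cs (i + 1)).1 = max (cs i).1 (c' (cs i)) := fun i => rfl
  have hmono : Monotone fun i => (cs i).1 := monotone_nat_of_le_succ fun i => by
    rw [hcs]; exact le_max_left _ _
  have hcd : 0 < (cs d).1 := lt_of_lt_of_le one_pos (cs d).2
  obtain ⟨μ, Cc, hμ, hcorner⟩ := exists_corner hd q hcd hε hε1
  obtain ⟨Cm, hCm⟩ := ((Finset.range (d + 1)).image fun i => C (cs i)).exists_le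
  obtain ⟨Cl, hCl⟩ := exists_nat_ge (((cs d).1 / μ) ^ d)
  refine ⟨max Cm (max Cc Cl), ?_⟩
  intro n I obs pos R f S hq hgood hav
  have hf := hgood.pos
  -- The open ranges between consecutive thresholds are disjoint, and there are `d + 1` of them for
  -- `d` side lengths, so one contains no side.
  obtain ⟨j, hj⟩ : ∃ j : Fin (d + 1), ∀ k, R.side k ≤ (cs j).1 * f ∨ (cs (j + 1)).1 * f ≤ R.side k := by
    by_contra! hcon
    choose k hk using hcon
    obtain ⟨x, y, hxy, he⟩ := Fintype.exists_ne_map_eq_of_card_lt k (by simp)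
    wlog hlt : x < y generalizing x y
    · exact this y x hxy.symm he.symm (lt_of_le_of_ne (not_lt.1 hlt) hxy.symm)
    have h1 : (cs (x + 1)).1 ≤ (cs y).1 := hmono (Nat.succ_le_of_lt hlt)
    have h2 := mul_le_mul_of_nonneg_right h1 hf.le
    have h3 := (hk x).2
    have h4 := (hk y).1
    rw [he] at h3
    linarith
  by_cases hLg : (Finset.univ.filter fun k => ¬ R.side k ≤ (cs j).1 * f).Nonempty
  · obtain ⟨S', hS', hfam, hprofit⟩ := H (cs j) I R obs f S pos _ hq hf hLg
      (fun k hk => by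
        have hk' := (Finset.mem_filter.1 hk).2
        refine ⟨?_, (hgood.side k).resolve_left fun h => hk' (h.trans ?_)⟩
        · refine le_trans (mul_le_mul_of_nonneg_right ?_ hf.le) ((hj k).resolve_left hk')
          rw [hcs]
          exact le_max_right _ _
        · exact mul_le_mul_of_nonneg_right (hmono (Nat.zero_le j)) hf.le)
      (fun k hk => by simpa using hk) hgood.cube hgood.packed hav hgood.size_le
    refine ⟨∅, Finset.empty_subset _, by simp, S', by simpa using hS', hfam.mono ?_,
      by simpa using hprofit⟩
    exact (hCm _ (Finset.mem_image_of_mem _ (Finset.mem_range.2 j.2))).trans (le_max_left _ _)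
  · have hside : ∀ k, R.side k ≤ (cs d).1 * f := fun k => by
      have h1 : R.side k ≤ (cs j).1 * f := by
        by_contra hcon
        exact hLg ⟨k, Finset.mem_filter.2 ⟨Finset.mem_univ k, hcon⟩⟩
      exact h1.trans (mul_le_mul_of_nonneg_right (hmono (Nat.le_of_lt_succ j.2)) hf.le)
    -- The exceptional items: each has volume at least `(μ * f) ^ d` in a cell of volume at most
    -- `((cs d) * f) ^ d`, so their number is bounded.
    set L := S.filter fun i => ¬ I.size i ≤ μ * f with hL
    have hLS : L ⊆ S := Finset.filter_subset _ _
    have hsub : S \ L ⊆ S := Finset.sdiff_subset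
    obtain ⟨S', hS', hfam, hprofit⟩ := hcorner I R obs f (S \ L) pos hq hf hside hgood.cube
      (hgood.packed.mono hsub) (hav.mono hsub) fun i hi => by
        by_contra hcon
        exact (Finset.mem_sdiff.1 hi).2 (Finset.mem_filter.2 ⟨hsub hi, hcon⟩)
    refine ⟨L, hLS, ?_, S', hS', hfam.mono ((le_max_left _ _).trans (le_max_right _ _)), hprofit⟩
    refine le_trans ?_ ((le_max_right Cc Cl).trans (le_max_right _ _))
    have h1 := I.card_mul_le_totalVol (d := d) (Q := L) (a := μ * f) (by positivity)
      fun i hi => (not_le.1 (Finset.mem_filter.1 hi).2).le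
    have h2 := I.totalVol_le_volume (hgood.packed.mono hLS).sep R.volume_halfOpen_ne_top
      fun i hi => (hgood.packed.within i (hLS hi)).subset
    rw [Cuboid.volume_real_halfOpen] at h2
    have h3 : R.vol ≤ ((cs d).1 * f) ^ d := by
      have : ((cs d).1 * f) ^ d = ∏ _k : Fin d, (cs d).1 * f := by simp
      rw [this]
      exact Finset.prod_le_prod (fun k _ => (R.side_pos k).le) fun k _ => hside k
    have h4 : (L.card : ℝ) ≤ ((cs d).1 / μ) ^ d := by
      have h5 : ((cs d).1 / μ) ^ d = ((cs d).1 * f) ^ d / (μ * f) ^ d := by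
        rw [← div_pow, mul_div_mul_right _ _ hf.ne']
      rw [h5, le_div_iff₀ (by positivity)]
      linarith
    exact_mod_cast h4.trans hCl

/-! ### Iteration over the loose items and conclusion -/

/-- Box families in separated cells can be joined. -/
theorem BoxFam.sigma {β : Type} [Fintype β] {I : ItemSet n} {R : Cuboid d}
    {obs : Finset (Cuboid d)} {B : β → Cuboid d} {S : β → Finset (Fin n)} {C : ℕ}
    (hB : ∀ j, (B j).Within R) (hsep : ∀ j k, j ≠ k → (B j).Sep (B k))
    (hS : ∀ j k, j ≠ k → Disjoint (S j) (S k)) (h : ∀ j, I.BoxFam (B j) obs (S j) C) :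
    I.BoxFam R obs (Finset.univ.biUnion S) (Fintype.card β * C) := by
  choose γ hγ D A h1 h2 h3 h4 h5 h6 h7 using h
  have hAS : ∀ j l, A j l ⊆ S j := fun j l => by
    rw [h6 j]
    exact Finset.subset_biUnion_of_mem (A j) (Finset.mem_univ l)
  refine ⟨Σ j, γ j, inferInstance, fun x => D x.1 x.2, fun x => A x.1 x.2, ?_,
    fun x => (h2 x.1 x.2).trans (hB x.1), fun x => h3 x.1 x.2, ?_, ?_, ?_, fun x => h7 x.1 x.2⟩
  · rw [Fintype.card_sigma]
    exact (Finset.sum_le_card_nsmul _ _ _ fun j _ => h1 j).trans (by simp)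
  · rintro ⟨j, l⟩ ⟨k, m⟩ hne
    by_cases hjk : j = k
    · subst hjk
      exact h4 j l m fun hlm => hne (by rw [hlm])
    · exact (hsep j k hjk).mono (h2 j l) (h2 k m)
  · rintro ⟨j, l⟩ ⟨k, m⟩ hne
    by_cases hjk : j = k
    · subst hjk
      exact h5 j l m fun hlm => hne (by rw [hlm])
    · exact (hS j k hjk).mono (hAS j l) (hAS k m)
  · ext i
    simp only [Finset.mem_biUnion, Finset.mem_univ, true_and, Sigma.exists]
    refine exists_congr fun j => ?_
    rw [h6 j]
    simp

open Classical in
/-- Any packing can be rearranged into boundedly many loose items, which stay in place, and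
boundedly many boxes. -/
theorem exists_loose_of_profitable (hd : 0 < d) {ε : ℝ} (hε : 0 < ε) (hε1 : ε ≤ 1) (t : ℕ) :
    ∀ N : ℕ, ∃ Cb Cl : ℕ, ∀ {n : ℕ} (I : ItemSet n) (Q P : Finset (Fin n))
      (pos : Fin n → Fin d → ℝ), I.PackedIn Q pos (Cuboid.unit d) → P ⊆ Q → P.card ≤ N →
      (1 - t * ε) * I.totalProfit Q ≤ I.totalProfit P →
      ∃ P' ⊆ Q, ∃ S' ⊆ Q \ P', P'.card ≤ Cl ∧
        I.BoxFam (Cuboid.unit d) (P'.image fun i => I.cubeAt i (pos i)) S' Cb ∧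
        (1 - 3 * ε) * I.totalProfit Q ≤ I.totalProfit P' + I.totalProfit S' := by
  induction t with
  | zero =>
    intro N
    refine ⟨0, N, ?_⟩
    intro n I Q P pos _ hPQ hPN hP
    refine ⟨P, hPQ, ∅, Finset.empty_subset _, hPN, BoxFam.empty _ _ _ _, ?_⟩
    have := mul_nonneg hε.le (I.totalProfit_nonneg Q)
    have h0 := I.totalProfit_nonneg ∅
    push_cast at hP
    linarith
  | succ t ih =>
    intro N
    -- At most `N` obstacles have at most two facet coordinates each per axis, whence the complexity
    -- bound.
    obtain ⟨C, L, hdec⟩ := exists_decomp d N (d * (2 * N))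
    obtain ⟨T, hT⟩ := exists_nat_gt (max (L / ε) 1)
    rw [max_lt_iff] at hT
    have hT0 : (0 : ℝ) < T := by linarith [hT.2]
    have hLT : (L : ℝ) / T ≤ ε := by
      have := hT.1.le
      rw [div_le_iff₀ hε] at this
      rw [div_le_iff₀ hT0]
      linarith
    obtain ⟨C', hcell⟩ := exists_boxFam_of_goodCell hd N (c := 3 * T) (by linarith [hT.2]) hε hε1
    obtain ⟨Cb, Cl, ih⟩ := ih (N + C * C')
    refine ⟨max Cb (C * C'), max Cl N, ?_⟩
    intro n I Q P pos hpack hPQ hPN hP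
    set obs := P.image fun i => I.cubeAt i (pos i) with hobs
    have hobsN : obs.card ≤ N := Finset.card_image_le.trans hPN
    have hsub : Q \ P ⊆ Q := Finset.sdiff_subset
    have hav : I.Avoids (Q \ P) pos obs := by
      intro i hi o ho
      obtain ⟨j, hj, rfl⟩ := Finset.mem_image.1 ho
      refine hpack.sep i (hsub hi) j (hPQ hj) ?_
      rintro rfl
      exact (Finset.mem_sdiff.1 hi).2 hj
    obtain ⟨β, hβ, B, f, A, hβC, hBR, hBsep, hAS, hAdisj, hgood, hprofit⟩ :=
      hdec I obs pos T (by exact_mod_cast hT0) hobsN (Cuboid.unit d) (Q \ P)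
        (((Cuboid.unit d).complexity_le obs).trans (by gcongr)) (hpack.mono hsub) hav
    have hstep := fun j => hcell I obs pos (B j) (f j) (A j) hobsN (hgood j) (hav.mono (hAS j))
    choose Lc hLA hLcard S' hS'sub hfam hS'profit using hstep
    have hLdisj : ∀ j k, j ≠ k → Disjoint (Lc j) (Lc k) := fun j k hjk =>
      (hAdisj j k hjk).mono (hLA j) (hLA k)
    have hS'A : ∀ j, S' j ⊆ A j := fun j => (hS'sub j).trans Finset.sdiff_subset
    have hS'disj : ∀ j k, j ≠ k → Disjoint (S' j) (S' k) := fun j k hjk =>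
      (hAdisj j k hjk).mono (hS'A j) (hS'A k)
    set La := Finset.univ.biUnion Lc with hLa
    have hLaQ : La ⊆ Q \ P := Finset.biUnion_subset.2 fun j _ => (hLA j).trans (hAS j)
    have hLacard : La.card ≤ C * C' := by
      refine (Finset.card_biUnion_le_card_mul _ _ _ fun j _ => hLcard j).trans ?_
      exact Nat.mul_le_mul_right _ hβC
    -- If the exceptional items are cheap, the cuts, the rearrangement in the cells and discarding
    -- these items lose at most ε each. Otherwise adding them to `P` lowers `t + 1` to `t`; they are
    -- still at their original positions, so the induction applies to the same packing.
    by_cases hcheap : I.totalProfit La ≤ ε * I.totalProfit Q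
    · refine ⟨P, hPQ, Finset.univ.biUnion S', Finset.biUnion_subset.2 fun j _ =>
        (hS'A j).trans (hAS j), hPN.trans (le_max_right _ _),
        (BoxFam.sigma hBR hBsep hS'disj hfam).mono
          ((Nat.mul_le_mul_right _ hβC).trans (le_max_right _ _)), ?_⟩
      rw [I.totalProfit_biUnion hS'disj]
      have h1 : (1 - ε) * (∑ j, I.totalProfit (A j) - I.totalProfit La) ≤
          ∑ j, I.totalProfit (S' j) := by
        rw [hLa, I.totalProfit_biUnion hLdisj, ← Finset.sum_sub_distrib, Finset.mul_sum]
        refine Finset.sum_le_sum fun j _ => ?_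
        rw [← I.totalProfit_sdiff (hLA j)]
        exact hS'profit j
      have hQP := I.totalProfit_sdiff hPQ
      have h0 := I.totalProfit_nonneg (Q \ P)
      have hP0 := I.totalProfit_nonneg P
      have h2 : (1 - ε) * I.totalProfit (Q \ P) ≤ ∑ j, I.totalProfit (A j) :=
        (mul_le_mul_of_nonneg_right (by linarith) h0).trans hprofit
      have h3 : (1 - ε) * ((1 - ε) * I.totalProfit (Q \ P) - ε * I.totalProfit Q) ≤
          ∑ j, I.totalProfit (S' j) :=
        (mul_le_mul_of_nonneg_left (by linarith) (by linarith)).trans h1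
      have h4 := mul_nonneg (sq_nonneg ε) h0
      have h5 := mul_nonneg (sq_nonneg ε) (I.totalProfit_nonneg Q)
      have h6 := mul_nonneg hε.le hP0
      rw [hQP] at h3 h4
      nlinarith
    · push Not at hcheap
      have hdisj : Disjoint P La := Finset.disjoint_of_subset_right hLaQ Finset.disjoint_sdiff
      obtain ⟨P', hP', S'', hS'', h1, h2, h3⟩ := ih I Q (P ∪ La) pos hpack
        (Finset.union_subset hPQ (hLaQ.trans hsub))
        ((Finset.card_union_le _ _).trans (Nat.add_le_add hPN hLacard)) (by
          rw [I.totalProfit_union hdisj]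
          push_cast at hP
          linarith)
      exact ⟨P', hP', S'', hS'', h1.trans (le_max_left _ _), h2.mono (le_max_left _ _), h3⟩

/-- A box family avoiding the loose items gives a box structure on a packing. -/
theorem exists_boxStructure (I : ItemSet n) {P S : Finset (Fin n)} {pos : Fin n → Fin d → ℝ}
    {C : ℕ} (hdisj : Disjoint P S) (hP : I.PackedIn P pos (Cuboid.unit d)) {obs : Finset (Cuboid d)}
    (hobs : ∀ i ∈ P, I.cubeAt i (pos i) ∈ obs) (h : I.BoxFam (Cuboid.unit d) obs S C) :
    ∃ (X : Packing I d) (b : ℕ) (B : Fin b → Cuboid d) (Q : Fin b → Finset (Fin n)),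
      X.BoxStructure B Q ∧ b ≤ C ∧ X.loose Q = P ∧ X.items = P ∪ S := by
  classical
  obtain ⟨β, hβ, B, A, h1, h2, h3, h4, h5, rfl, h7⟩ := h
  choose posB hposB using fun j => (h7 j).1
  have hPA : ∀ i ∈ P, ∀ j, i ∉ A j := fun i hi j hj =>
    Finset.disjoint_left.1 hdisj hi (Finset.mem_biUnion.2 ⟨j, Finset.mem_univ j, hj⟩)
  set pos' : Fin n → Fin d → ℝ := fun i => if h : ∃ j, i ∈ A j then posB h.choose i else pos i
    with hpos'
  have hin : ∀ j, ∀ i ∈ A j, pos' i = posB j i := by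
    intro j i hi
    have hex : ∃ j, i ∈ A j := ⟨j, hi⟩
    have : hex.choose = j := by
      by_contra hne
      exact Finset.disjoint_left.1 (h5 _ _ hne) hex.choose_spec hi
    simp only [hpos']
    rw [dif_pos hex, this]
  have hout : ∀ i ∈ P, pos' i = pos i := fun i hi => by
    simp only [hpos']
    rw [dif_neg]
    rintro ⟨j, hj⟩
    exact hPA i hi j hj
  have hBin : ∀ j, ∀ i ∈ A j, (I.cubeAt i (pos' i)).Within (B j) := fun j i hi => by
    rw [hin j i hi]
    exact (hposB j).within i hi
  have hPB : ∀ i ∈ P, ∀ j, (I.cubeAt i (pos' i)).Sep (B j) := fun i hi j => by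
    rw [hout i hi]
    exact (h3 j _ (hobs i hi)).symm
  have hmem : ∀ i ∈ P ∪ Finset.univ.biUnion A, i ∈ P ∨ ∃ j, i ∈ A j := fun i hi => by
    simpa using hi
  have hins : ∀ i ∈ P ∪ Finset.univ.biUnion A, (I.cubeAt i (pos' i)).InKnapsack := by
    intro i hi
    rw [← Cuboid.within_unit]
    rcases hmem i hi with hi | ⟨j, hj⟩
    · rw [hout i hi]
      exact hP.within i hi
    · exact (hBin j i hj).trans (h2 j)
  have hsep : ∀ i ∈ P ∪ Finset.univ.biUnion A, ∀ j ∈ P ∪ Finset.univ.biUnion A, i ≠ j →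
      (I.cubeAt i (pos' i)).NonOverlapping (I.cubeAt j (pos' j)) := by
    intro i hi j hj hij
    refine Cuboid.Sep.nonOverlapping ?_
    rcases hmem i hi with hi | ⟨k, hk⟩ <;> rcases hmem j hj with hj | ⟨l, hl⟩
    · rw [hout i hi, hout j hj]
      exact hP.sep i hi j hj hij
    · exact ((hPB i hi l).symm.mono_left (hBin l j hl)).symm
    · exact (hPB j hj k).symm.mono_left (hBin k i hk)
    · by_cases hkl : k = l
      · subst hkl
        rw [hin k i hk, hin k j hl]
        exact (hposB k).sep i hk j hl hij
      · exact (h4 k l hkl).mono (hBin k i hk) (hBin l j hl)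
  set e := (Fintype.equivFin β).symm
  have hbi : Finset.univ.biUnion (fun j => A (e j)) = Finset.univ.biUnion A := by
    ext i
    simp only [Finset.mem_biUnion, Finset.mem_univ, true_and]
    exact ⟨fun ⟨j, hj⟩ => ⟨e j, hj⟩, fun ⟨j, hj⟩ => ⟨e.symm j, by simpa using hj⟩⟩
  have hloose : (⟨P ∪ Finset.univ.biUnion A, pos', hins, hsep⟩ : Packing I d).loose
      (fun j => A (e j)) = P := by
    rw [Packing.loose, hbi]
    exact Finset.union_sdiff_cancel_right hdisj
  refine ⟨⟨P ∪ Finset.univ.biUnion A, pos', hins, hsep⟩, Fintype.card β, fun j => B (e j),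
    fun j => A (e j), ⟨fun j => Cuboid.within_unit.1 (h2 _), fun j k hjk =>
      (h4 _ _ (e.injective.ne hjk)).nonOverlapping, fun j => ?_, fun j k hjk =>
      h5 _ _ (e.injective.ne hjk), fun j i hi => (hBin _ i hi).region_subset,
      fun j => (h7 _).2, fun i hi j => ?_⟩, h1, hloose, rfl⟩
  · exact (Finset.subset_biUnion_of_mem A (Finset.mem_univ _)).trans Finset.subset_union_right
  · rw [hloose] at hi
    exact (hPB i hi _).nonOverlapping

/-- Near-optimal packings into boundedly many boxes, for fixed dimension and accuracy. -/
theorem exists_near_optimal_boxStructure (hd : 0 < d) {ε : ℝ} (hε : 0 < ε) (hε1 : ε ≤ 1) :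
    ∃ Cb Cl : ℕ, ∀ (n : ℕ) (I : ItemSet n),
      ∃ (X : Packing I d) (b : ℕ) (B : Fin b → Cuboid d) (Q : Fin b → Finset (Fin n)),
        X.BoxStructure B Q ∧ b ≤ Cb ∧ (X.loose Q).card ≤ Cl ∧
          (1 - 3 * ε) * I.opt d ≤ X.profit := by
  classical
  -- With `t * ε ≥ 1` the profit hypothesis holds for the empty set, so the iteration starts without
  -- loose items.
  obtain ⟨t, ht⟩ := exists_nat_ge (1 / ε)
  rw [div_le_iff₀ hε] at ht
  obtain ⟨Cb, Cl, H⟩ := exists_loose_of_profitable hd hε hε1 t 0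
  refine ⟨Cb, Cl, fun n I => ?_⟩
  obtain ⟨O, hO⟩ := (I.isGreatest_opt d).1
  have hpack : I.PackedIn O.items O.pos (Cuboid.unit d) :=
    ⟨fun i hi => Cuboid.within_unit.2 (O.inside i hi), fun i hi j hj hij =>
      (O.nonOverlapping i hi j hj hij).sep⟩
  obtain ⟨P, hPO, S, hS, hPcard, hfam, hprofit⟩ := H I O.items ∅ O.pos hpack
    (Finset.empty_subset _) (by simp) (by
      have h0 := I.totalProfit_nonneg O.items
      have h1 : I.totalProfit ∅ = 0 := Finset.sum_empty
      rw [h1]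
      exact mul_nonpos_of_nonpos_of_nonneg (by linarith) h0)
  have hdisj : Disjoint P S := Finset.disjoint_of_subset_right hS Finset.disjoint_sdiff
  obtain ⟨X, b, B, Q, hX, hb, hloose, hitems⟩ := I.exists_boxStructure hdisj (hpack.mono hPO)
    (fun i hi => Finset.mem_image_of_mem _ hi) hfam
  refine ⟨X, b, B, Q, hX, hb, hloose ▸ hPcard, ?_⟩
  rw [Packing.profit, hitems, I.totalProfit_union hdisj, ← hO]
  exact hprofit

end ItemSet

theorem mainTheorem2 :
    ∃ Cboxes Clarge : ℕ → ℝ → ℕ,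
      ∀ d : ℕ, 2 ≤ d → ∀ ε : ℝ, 0 < ε → ε < 1 / 2 ^ (d + 2) →
        ∀ (n : ℕ) (I : ItemSet n),
          ∃ (P : Packing I d) (b : ℕ) (B : Fin b → Cuboid d) (Q : Fin b → Finset (Fin n)),
            P.BoxStructure B Q ∧
            b ≤ Cboxes d ε ∧
            (P.loose Q).card ≤ Clarge d ε ∧
            (1 - 2 ^ (d + 2) * ε) * I.opt d ≤ P.profit := by
  -- The hypotheses on `d` and `ε` stand inside the existential so that the constants can be chosen
  -- as functions of all pairs; outside the admissible range they are zero.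
  have H : ∀ (d : ℕ) (ε : ℝ), ∃ Cb Cl : ℕ, 2 ≤ d → 0 < ε → ε < 1 / 2 ^ (d + 2) →
      ∀ (n : ℕ) (I : ItemSet n),
        ∃ (P : Packing I d) (b : ℕ) (B : Fin b → Cuboid d) (Q : Fin b → Finset (Fin n)),
          P.BoxStructure B Q ∧ b ≤ Cb ∧ (P.loose Q).card ≤ Cl ∧
            (1 - 2 ^ (d + 2) * ε) * I.opt d ≤ P.profit := by
    intro d ε
    by_cases h : 2 ≤ d ∧ 0 < ε ∧ ε < 1 / 2 ^ (d + 2)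
    · obtain ⟨hd, hε, hε1⟩ := h
      -- The argument loses only `3 * ε`, so this comparison yields the stated factor.
      have hpow : (3 : ℝ) ≤ 2 ^ (d + 2) := by
        have h1 : (1 : ℝ) ≤ 2 ^ d := one_le_pow₀ (by norm_num)
        rw [pow_add]
        linarith
      have hε2 : ε ≤ 1 := by
        rw [lt_div_iff₀ (by positivity)] at hε1
        nlinarith
      obtain ⟨Cb, Cl, hC⟩ := ItemSet.exists_near_optimal_boxStructure (d := d) (by omega) hε hε2
      refine ⟨Cb, Cl, fun _ _ _ n I => ?_⟩
      obtain ⟨P, b, B, Q, h1, h2, h3, h4⟩ := hC n I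
      refine ⟨P, b, B, Q, h1, h2, h3, le_trans (mul_le_mul_of_nonneg_right ?_ ?_) h4⟩
      · have := mul_le_mul_of_nonneg_right hpow hε.le
        linarith
      · obtain ⟨O, hO⟩ := (I.isGreatest_opt d).1
        rw [← hO]
        exact I.totalProfit_nonneg O.items
    · exact ⟨0, 0, fun h1 h2 h3 => absurd ⟨h1, h2, h3⟩ h⟩
  choose Cb Cl H using H
  exact ⟨Cb, Cl, fun d hd ε hε hε1 n I => H d ε hd hε hε1 n I⟩
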